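/- Let $M$ be a smooth manifold (without boundary, Hausdorff, second countable, possibly disconnected) of dimension $n$. Conventions. For $\mathbb K\in\{\mathbb R,\mathbb C\}$ and a smooth $\mathbb K$-line bundle $L\to M$ with a section $\sigma$ that vanishes transversely, consider on the complement $\pi:L^*\setminus M\to M$ of the zero section of the dual the function $\varphi_\sigma(e_x)=\langle\sigma(x),e_x\rangle\in\mathbb K$, and the distribution $\mathcal F_\sigma=\ker d\varphi_\sigma$ tangent to its level sets. If $\mathbb K=\mathbb C$, $(L,\sigma)$ is a complex log divisor; its elliptic divisor $(W,s)$ is given by $(L\otimes\bar L,\sigma\otimes\bar\sigma)=(W,s)\otimes\mathbb C$, with ideal $I_s=s(\Gamma(W^*))\subset C^\infty(M;\mathbb R)$. If $\mathbb K=\mathbb R$, $(L,\sigma)$ is the $b$-divisor of the hypersurface $\sigma^{-1}(0)$. A family of submanifolds intersects transversely if, at every point $x$, the codimension of the intersection of the tangent spaces at $x$ of those members that contain $x$ is the sum of their codimensions. A Lie algebroid submersion is a fibrewise surjective morphism of Lie algebroids over a surjective submersion. A foliation is an involutive smooth subbundle of the tangent bundle, regarded as a Lie algebroid. (1) Let $(L,\sigma)$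 be a complex log divisor on $M$, $D=\sigma^{-1}(0)$, and $(W,s)$ its elliptic divisor. Then $\mathcal F=\mathcal F_\sigma$ is a foliation of real codimension two on $\pi:L^*\setminus M\to M$ whose leaves are the connected components of the level sets of $\varphi_\sigma$, and: $\mathcal F$ is $\mathbb C^*$-invariant; the connected components of $\pi^{-1}(D)$ are leaves; every other leaf is the graph of a smooth section of $L^*$ over a connected component of $M\setminus D$ (hence is mapped diffeomorphically to it by $\pi$); the real vector fields preserving $I_s$ are the sections of a Lie algebroid $\mathcal A_{|D|}\to M$ (the elliptic tangent bundle), and there is a Lie algebroid submersion $\mathcal F\to\mathcal A_{|D|}$ over $\pi$ which is a fibrewise isomorphism. (2) Let $Z_1,\dots,Z_k$ be transversely intersecting embedded hypersurfaces in $M$ with $b$-divisors $(W_i,s_i)$, so that $s_i$ vanishes transversely and $Z_i=s_i^{-1}(0)$. Let $\mathcal F_i=\mathcal F_{s_i}$ on $\pi_i:W_i^*\setminus M\to M$. Then the fibre product $\mathcal F=\mathcal F_1\times_{TM}\cdots\times_{TM}\mathcal F_k$ is a codimension-$k$ foliation on $\pi:(W_1^*\setminus M)\times_M\cdots\times_M(W_k^*\setminus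 M)\to M$; it is $(\mathbb R^*)^k$-invariant; the vector fields tangent to every $Z_i$ are the sections of a Lie algebroid $\mathcal A_Z\to M$ (the self-crossing $b$-tangent bundle), and there is a Lie algebroid submersion $\mathcal F\to\mathcal A_Z$ over $\pi$ which is a fibrewise isomorphism. (3) Let $I_{|D_1|},\dots,I_{|D_k|}$ be the ideals of the co-orientable elliptic divisors associated with complex log divisors $(L_i,\sigma_i)$ on $M$ whose zero loci $D_i=\sigma_i^{-1}(0)$ intersect transversely, and let $I_{|D|}=\prod_i I_{|D_i|}$. Let $\mathcal F_i=\mathcal F_{\sigma_i}$ on $L_i^*\setminus M$. Then the fibre product $\mathcal F=\mathcal F_1\times_{TM}\cdots\times_{TM}\mathcal F_k$ is a foliation of real codimension $2k$ on $\pi:(L_1^*\setminus M)\times_M\cdots\times_M(L_k^*\setminus M)\to M$; it is $(\mathbb C^*)^k$-invariant; the real vector fields preserving $I_{|D|}$ are the sections of a Lie algebroid $\mathcal A_{|D|}\to M$ (the self-crossing elliptic tangent bundle), and there is a Lie algebroid submersion $\mathcal F\to\mathcal A_{|D|}$ over $\pi$ which is a fibrewise isomorphism. -/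

import Mathlib

open Bundle Set
open scoped Manifold ContDiff Bundle Topology

noncomputable section

namespace Regularisation

/-! ### The dual of a line bundle -/

section Dual

variable {M : Type*} (𝕂 : Type*) [RCLike 𝕂] (L : M → Type*)
  [∀ x, AddCommGroup (L x)] [∀ x, Module 𝕂 (L x)] [∀ x, TopologicalSpace (L x)]

/-- The fibres `Hom_𝕂 (L x, 𝕂)` of the dual `L^*` of a `𝕂`-line bundle `L`. -/
def DualBundle (x : M) : Type _ := L x →L[𝕂] 𝕂

instance (x : M) : AddCommGroup (DualBundle 𝕂 L x) := inferInstanceAs (AddCommGroup (L x →L[𝕂] 𝕂))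
instance (x : M) : Module 𝕂 (DualBundle 𝕂 L x) := inferInstanceAs (Module 𝕂 (L x →L[𝕂] 𝕂))
instance (x : M) : Module ℝ (DualBundle 𝕂 L x) := inferInstanceAs (Module ℝ (L x →L[𝕂] 𝕂))
instance (x : M) : TopologicalSpace (DualBundle 𝕂 L x) :=
  inferInstanceAs (TopologicalSpace (L x →L[𝕂] 𝕂))
instance (x : M) : FunLike (DualBundle 𝕂 L x) (L x) 𝕂 :=
  inferInstanceAs (FunLike (L x →L[𝕂] 𝕂) (L x) 𝕂)
instance (x : M) : ContinuousLinearMapClass (DualBundle 𝕂 L x) 𝕂 (L x) 𝕂 :=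
  inferInstanceAs (ContinuousLinearMapClass (L x →L[𝕂] 𝕂) 𝕂 (L x) 𝕂)

variable {𝕂 L} in
@[ext] theorem DualBundle.ext {x : M} {ξ η : DualBundle 𝕂 L x} (h : ∀ v, ξ v = η v) : ξ = η :=
  ContinuousLinearMap.ext h
variable {𝕂 L} in
@[simp] theorem DualBundle.add_apply {x : M} (ξ η : DualBundle 𝕂 L x) (v : L x) :
    (ξ + η) v = ξ v + η v := rfl
variable {𝕂 L} in
@[simp] theorem DualBundle.smul_apply {x : M} (c : 𝕂) (ξ : DualBundle 𝕂 L x) (v : L x) :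
    (c • ξ) v = c * ξ v := rfl
variable {𝕂 L} in
@[simp] theorem DualBundle.real_smul_apply {x : M} (c : ℝ) (ξ : DualBundle 𝕂 L x) (v : L x) :
    (c • ξ) v = c • ξ v := rfl

variable [TopologicalSpace M] [TopologicalSpace (TotalSpace 𝕂 L)] [FiberBundle 𝕂 L]
  [VectorBundle 𝕂 𝕂 L]

variable {𝕂 L} in
/-- The trivialization of the dual bundle given by evaluation on the local frame of `L` that
corresponds to `1`. -/
def DualBundle.pretriv (e : Trivialization 𝕂 (π 𝕂 L)) [MemTrivializationAtlas e] :
    Pretrivialization 𝕂 (π 𝕂 (DualBundle 𝕂 L)) where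
  toFun p := ⟨p.1, p.2 (e.symmL 𝕂 p.1 1)⟩
  invFun p := ⟨p.1, (p.2 • e.continuousLinearMapAt 𝕂 p.1 : L p.1 →L[𝕂] 𝕂)⟩
  source := TotalSpace.proj ⁻¹' e.baseSet
  target := e.baseSet ×ˢ univ
  map_source' := fun _ h => ⟨h, mem_univ _⟩
  map_target' := fun _ h => h.1
  left_inv' := fun ⟨x, ξ⟩ h => by
    refine congrArg (TotalSpace.mk x) (DualBundle.ext fun v => ?_)
    change ξ (e.symmL 𝕂 x 1) * e.continuousLinearMapAt 𝕂 x v = ξ v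
    rw [mul_comm, ← smul_eq_mul, ← map_smul, ← map_smul, smul_eq_mul, mul_one,
      e.symmL_continuousLinearMapAt h]
  right_inv' := fun ⟨x, c⟩ h => by
    simp only [Prod.mk_right_inj]
    change c * e.continuousLinearMapAt 𝕂 x (e.symmL 𝕂 x 1) = c
    rw [e.continuousLinearMapAt_symmL h.1, mul_one]
  open_target := e.open_baseSet.prod isOpen_univ
  baseSet := e.baseSet
  open_baseSet := e.open_baseSet
  source_eq := rfl
  target_eq := rfl
  proj_toFun _ _ := rfl

variable {𝕂 L} in
theorem DualBundle.pretriv_coordChange (e e' : Trivialization 𝕂 (π 𝕂 L))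
    [MemTrivializationAtlas e] [MemTrivializationAtlas e'] {b : M} (hb : b ∈ e.baseSet ∩ e'.baseSet)
    (v : 𝕂) : (e'.coordChangeL 𝕂 e b 1) * v =
      (DualBundle.pretriv e' ⟨b, (DualBundle.pretriv e).symm b v⟩).2 := by
  rw [Pretrivialization.symm_apply _ (by exact hb.1)]
  change _ = v * e.continuousLinearMapAt 𝕂 b (e'.symmL 𝕂 b 1)
  rw [e'.coordChangeL_apply e ⟨hb.2, hb.1⟩, mul_comm, Trivialization.continuousLinearMapAt_apply,
    e'.symmL_apply hb.2, e.coe_linearMapAt_of_mem hb.1]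

/-- The local trivializations of the dual bundle. -/
def DualBundle.prebundle : VectorPrebundle ℝ 𝕂 (DualBundle 𝕂 L) where
  pretrivializationAtlas := {e | ∃ (e₁ : Trivialization 𝕂 (π 𝕂 L)) (_ : MemTrivializationAtlas e₁),
    e = DualBundle.pretriv e₁}
  pretrivialization_linear' := by
    rintro _ ⟨e, he, rfl⟩
    exact ⟨fun x _ => ⟨fun _ _ => rfl, fun _ _ => rfl⟩⟩
  pretrivializationAt x := DualBundle.pretriv (trivializationAt 𝕂 L x)
  mem_base_pretrivializationAt x := mem_baseSet_trivializationAt 𝕂 L x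
  pretrivialization_mem_atlas x := ⟨trivializationAt 𝕂 L x, inferInstance, rfl⟩
  exists_coordChange := by
    rintro _ ⟨e, he, rfl⟩ _ ⟨e', he', rfl⟩
    refine ⟨fun b => ContinuousLinearMap.lsmul ℝ 𝕂 ((e'.coordChangeL 𝕂 e b : 𝕂 →L[𝕂] 𝕂) 1),
      ?_, fun b hb v => DualBundle.pretriv_coordChange e e' hb v⟩
    refine (ContinuousLinearMap.lsmul ℝ 𝕂 : 𝕂 →L[ℝ] 𝕂 →L[ℝ] 𝕂).continuous.comp_continuousOn ?_
    have h := continuousOn_coordChange 𝕂 e' e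
    rw [inter_comm] at h
    exact h.clm_apply continuousOn_const
  totalSpaceMk_isInducing := by
    intro b
    let φ : L b ≃L[𝕂] 𝕂 := (trivializationAt 𝕂 L b).continuousLinearEquivAt 𝕂 b
      (mem_baseSet_trivializationAt _ _ _)
    let ψ : (L b →L[𝕂] 𝕂) ≃L[𝕂] (𝕂 →L[𝕂] 𝕂) := φ.arrowCongr (ContinuousLinearEquiv.refl 𝕂 𝕂)
    let χ : (𝕂 →L[𝕂] 𝕂) ≃ₜ 𝕂 :=
      { toFun := fun f => f 1
        invFun := fun c => ContinuousLinearMap.toSpanSingleton 𝕂 c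
        left_inv := fun f => by ext; simp
        right_inv := fun c => by simp
        continuous_toFun := (ContinuousLinearMap.apply 𝕂 𝕂 (1 : 𝕂)).continuous
        continuous_invFun := (ContinuousLinearMap.toSpanSingletonCLE (𝕜 := 𝕂)).continuous }
    have h : Topology.IsInducing fun x => (b, χ (ψ x)) :=
      Topology.isInducing_const_prod.mpr (χ.isInducing.comp ψ.toHomeomorph.isInducing)
    convert! h using 1
    funext ξ
    refine Prod.ext rfl ?_
    · change ξ ((trivializationAt 𝕂 L b).symmL 𝕂 b 1) = ξ (φ.symm 1)
      rw [Trivialization.symmL_apply _ (mem_baseSet_trivializationAt 𝕂 L b)]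
      rfl

instance : TopologicalSpace (TotalSpace 𝕂 (DualBundle 𝕂 L)) :=
  (DualBundle.prebundle 𝕂 L).totalSpaceTopology
instance : FiberBundle 𝕂 (DualBundle 𝕂 L) := (DualBundle.prebundle 𝕂 L).toFiberBundle
instance : VectorBundle ℝ 𝕂 (DualBundle 𝕂 L) := (DualBundle.prebundle 𝕂 L).toVectorBundle

variable {EB : Type*} [NormedAddCommGroup EB] [NormedSpace ℝ EB] {HB : Type*} [TopologicalSpace HB]
  (I : ModelWithCorners ℝ EB HB) [ChartedSpace HB M] [∀ x, Module ℝ (L x)]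
  [VectorBundle ℝ 𝕂 L] [ContMDiffVectorBundle ∞ 𝕂 L I]

instance DualBundle.prebundle_isContMDiff : (DualBundle.prebundle 𝕂 L).IsContMDiff I ∞ where
  exists_contMDiffCoordChange := by
    rintro _ ⟨e, he, rfl⟩ _ ⟨e', he', rfl⟩
    refine ⟨fun b => ContinuousLinearMap.lsmul ℝ 𝕂 ((e'.coordChangeL ℝ e b : 𝕂 →L[ℝ] 𝕂) 1),
      ?_, fun b hb v => ?_⟩
    · refine (ContinuousLinearMap.lsmul ℝ 𝕂 : 𝕂 →L[ℝ] 𝕂 →L[ℝ] 𝕂).contMDiff.comp_contMDiffOn ?_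
      have h := contMDiffOn_coordChangeL (IB := I) (n := ∞) e' e
      rw [inter_comm] at h
      exact h.clm_apply contMDiffOn_const
    · rw [← DualBundle.pretriv_coordChange e e' hb v]
      change (e'.coordChangeL ℝ e b 1) * v = _
      rw [e'.coordChangeL_apply e ⟨hb.2, hb.1⟩, e'.coordChangeL_apply e ⟨hb.2, hb.1⟩]

instance : ContMDiffVectorBundle ∞ 𝕂 (DualBundle 𝕂 L) I :=
  (DualBundle.prebundle 𝕂 L).contMDiffVectorBundle I

end Dual

/-! ### Finite direct sums of vector bundles -/

section DirectSum

variable {M : Type*} {ι : Type*} [Fintype ι] (F : Type*) [NormedAddCommGroup F] [NormedSpace ℝ F]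
  (E : ι → M → Type*) [∀ i x, AddCommGroup (E i x)] [∀ i x, Module ℝ (E i x)]
  [∀ i x, TopologicalSpace (E i x)]

/-- The fibres of the direct sum of a family of vector bundles. -/
def DirectSumBundle (x : M) : Type _ := ∀ i, E i x

instance (x : M) : AddCommGroup (DirectSumBundle E x) := inferInstanceAs (AddCommGroup (∀ i, E i x))
instance (x : M) : Module ℝ (DirectSumBundle E x) := inferInstanceAs (Module ℝ (∀ i, E i x))
instance (x : M) : TopologicalSpace (DirectSumBundle E x) :=
  inferInstanceAs (TopologicalSpace (∀ i, E i x))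

variable {E} in
/-- The `i`-th component of an element of a direct sum. -/
def DirectSumBundle.component {x : M} (i : ι) : DirectSumBundle E x →ₗ[ℝ] E i x where
  toFun v := v i
  map_add' _ _ := rfl
  map_smul' _ _ := rfl

variable [TopologicalSpace M] [∀ i, TopologicalSpace (TotalSpace F (E i))]
  [∀ i, FiberBundle F (E i)] [∀ i, VectorBundle ℝ F (E i)]

variable {F E} in
/-- The direct sum of local trivializations of the summands. -/
def DirectSumBundle.pretriv (e : ∀ i, Trivialization F (π F (E i)))
    [∀ i, MemTrivializationAtlas (e i)] :
    Pretrivialization (ι → F) (π (ι → F) (DirectSumBundle E)) where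
  toFun p := ⟨p.1, fun i => (e i).continuousLinearMapAt ℝ p.1 (p.2 i)⟩
  invFun p := ⟨p.1, fun i => (e i).symmL ℝ p.1 (p.2 i)⟩
  source := TotalSpace.proj ⁻¹' (⋂ i, (e i).baseSet)
  target := (⋂ i, (e i).baseSet) ×ˢ univ
  map_source' := fun _ h => ⟨h, mem_univ _⟩
  map_target' := fun _ h => h.1
  left_inv' := fun ⟨x, v⟩ h => by
    refine congrArg (TotalSpace.mk x) (funext fun i => ?_)
    exact (e i).symmL_continuousLinearMapAt (mem_iInter.1 h i) (v i)
  right_inv' := fun ⟨x, c⟩ h => by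
    simp only [Prod.mk_right_inj]
    funext i
    exact (e i).continuousLinearMapAt_symmL (mem_iInter.1 h.1 i) (c i)
  open_target := (isOpen_iInter_of_finite fun i => (e i).open_baseSet).prod isOpen_univ
  baseSet := ⋂ i, (e i).baseSet
  open_baseSet := isOpen_iInter_of_finite fun i => (e i).open_baseSet
  source_eq := rfl
  target_eq := rfl
  proj_toFun _ _ := rfl


open Classical in
/-- The direct sum of a family of endomorphisms. -/
def piMapL (c : ι → F →L[ℝ] F) : (ι → F) →L[ℝ] (ι → F) :=
  ∑ i, (ContinuousLinearMap.single ℝ (fun _ => F) i).comp ((c i).comp (ContinuousLinearMap.proj i))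

variable {F} in
theorem piMapL_apply (c : ι → F →L[ℝ] F) (v : ι → F) (i : ι) : piMapL F c v i = c i (v i) := by
  classical
  simp [piMapL, Finset.sum_apply, Pi.single_apply]

variable {F E} in
theorem DirectSumBundle.pretriv_coordChange (e e' : ∀ i, Trivialization F (π F (E i)))
    [∀ i, MemTrivializationAtlas (e i)] [∀ i, MemTrivializationAtlas (e' i)] {b : M}
    (hb : b ∈ (⋂ i, (e i).baseSet) ∩ ⋂ i, (e' i).baseSet) (v : ι → F) :
    piMapL F (fun i => ((e i).coordChangeL ℝ (e' i) b : F →L[ℝ] F)) v =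
      (DirectSumBundle.pretriv e' ⟨b, (DirectSumBundle.pretriv e).symm b v⟩).2 := by
  rw [Pretrivialization.symm_apply _ (by exact hb.1)]
  funext i
  have h1 := mem_iInter.1 hb.1 i
  have h2 := mem_iInter.1 hb.2 i
  change _ = (e' i).continuousLinearMapAt ℝ b ((e i).symmL ℝ b (v i))
  rw [piMapL_apply, Trivialization.continuousLinearMapAt_apply, (e i).symmL_apply h1,
    (e' i).coe_linearMapAt_of_mem h2]
  exact (e i).coordChangeL_apply (e' i) ⟨h1, h2⟩ (v i)

/-- The local trivializations of the direct sum. -/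
def DirectSumBundle.prebundle : VectorPrebundle ℝ (ι → F) (DirectSumBundle E) where
  pretrivializationAtlas := {e | ∃ (e₁ : ∀ i, Trivialization F (π F (E i)))
    (_ : ∀ i, MemTrivializationAtlas (e₁ i)), e = DirectSumBundle.pretriv e₁}
  pretrivialization_linear' := by
    rintro _ ⟨e, he, rfl⟩
    exact ⟨fun x _ => ⟨fun v w => funext fun i => map_add _ (v i) (w i),
      fun c v => funext fun i => map_smul _ c (v i)⟩⟩
  pretrivializationAt x := DirectSumBundle.pretriv (fun i => trivializationAt F (E i) x)
  mem_base_pretrivializationAt x := mem_iInter.2 fun i => mem_baseSet_trivializationAt F (E i) x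
  pretrivialization_mem_atlas x := ⟨fun i => trivializationAt F (E i) x, inferInstance, rfl⟩
  exists_coordChange := by
    rintro _ ⟨e, he, rfl⟩ _ ⟨e', he', rfl⟩
    refine ⟨fun b => piMapL F (fun i => ((e i).coordChangeL ℝ (e' i) b : F →L[ℝ] F)), ?_,
      fun b hb v => DirectSumBundle.pretriv_coordChange e e' hb v⟩
    unfold piMapL
    refine continuousOn_finsetSum _ fun i _ => ?_
    refine continuousOn_const.clm_comp (ContinuousOn.clm_comp ?_ continuousOn_const)
    exact (continuousOn_coordChange ℝ (e i) (e' i)).mono fun b hb =>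
      ⟨mem_iInter.1 hb.1 i, mem_iInter.1 hb.2 i⟩
  totalSpaceMk_isInducing := by
    intro b
    let φ : (∀ i, E i b) ≃L[ℝ] (ι → F) := ContinuousLinearEquiv.piCongrRight fun i =>
      (trivializationAt F (E i) b).continuousLinearEquivAt ℝ b (mem_baseSet_trivializationAt _ _ _)
    have h : Topology.IsInducing fun x : DirectSumBundle E b => (b, φ x) :=
      Topology.isInducing_const_prod.mpr φ.toHomeomorph.isInducing
    refine (congrArg Topology.IsInducing (funext fun v => ?_)).mpr h
    refine Prod.ext rfl (funext fun i => ?_)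
    change (trivializationAt F (E i) b).continuousLinearMapAt ℝ b (v i) =
      (trivializationAt F (E i) b).continuousLinearEquivAt ℝ b
        (mem_baseSet_trivializationAt _ _ _) (v i)
    rw [Trivialization.coe_continuousLinearEquivAt_eq,
      Trivialization.continuousLinearMapAt_apply, Trivialization.coe_linearMapAt_of_mem]
    exact mem_baseSet_trivializationAt _ _ _

instance : TopologicalSpace (TotalSpace (ι → F) (DirectSumBundle E)) :=
  (DirectSumBundle.prebundle F E).totalSpaceTopology
instance : FiberBundle (ι → F) (DirectSumBundle E) := (DirectSumBundle.prebundle F E).toFiberBundle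
instance : VectorBundle ℝ (ι → F) (DirectSumBundle E) :=
  (DirectSumBundle.prebundle F E).toVectorBundle

variable {EB : Type*} [NormedAddCommGroup EB] [NormedSpace ℝ EB] {HB : Type*} [TopologicalSpace HB]
  (I : ModelWithCorners ℝ EB HB) [ChartedSpace HB M] [∀ i, ContMDiffVectorBundle ∞ F (E i) I]

instance DirectSumBundle.prebundle_isContMDiff :
    (DirectSumBundle.prebundle F E).IsContMDiff I ∞ where
  exists_contMDiffCoordChange := by
    rintro _ ⟨e, he, rfl⟩ _ ⟨e', he', rfl⟩
    refine ⟨fun b => piMapL F (fun i => ((e i).coordChangeL ℝ (e' i) b : F →L[ℝ] F)), ?_,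
      fun b hb v => DirectSumBundle.pretriv_coordChange e e' hb v⟩
    unfold piMapL
    refine contMDiffOn_finsetSum fun i _ => ?_
    refine contMDiffOn_const.clm_comp (ContMDiffOn.clm_comp ?_ contMDiffOn_const)
    exact (contMDiffOn_coordChangeL (IB := I) (n := ∞) (e i) (e' i)).mono fun b hb =>
      ⟨mem_iInter.1 hb.1 i, mem_iInter.1 hb.2 i⟩

instance : ContMDiffVectorBundle ∞ (ι → F) (DirectSumBundle E) I :=
  (DirectSumBundle.prebundle F E).contMDiffVectorBundle I

end DirectSum

/-! ### Punctured bundles -/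

section Punctured

variable {M : Type*} [TopologicalSpace M] {ι : Type*} [Fintype ι] (𝕂 : Type*) [RCLike 𝕂]

section One

variable (L : M → Type*)
  [∀ x, AddCommGroup (L x)] [∀ x, Module 𝕂 (L x)] [∀ x, TopologicalSpace (L x)]
  [TopologicalSpace (TotalSpace 𝕂 L)] [FiberBundle 𝕂 L] [VectorBundle 𝕂 𝕂 L]

theorem isOpen_ne_zero : IsOpen {p : TotalSpace 𝕂 (DualBundle 𝕂 L) | p.2 ≠ 0} := by
  rw [isOpen_iff_mem_nhds]
  rintro ⟨x, ξ⟩ hξ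
  set e := trivializationAt 𝕂 (DualBundle 𝕂 L) x
  have hx : x ∈ e.baseSet := mem_baseSet_trivializationAt 𝕂 (DualBundle 𝕂 L) x
  have ho : IsOpen (e.source ∩ e ⁻¹' {q | q.2 ≠ 0}) :=
    e.continuousOn_toFun.isOpen_inter_preimage e.open_source
      (isOpen_ne_fun continuous_snd continuous_const)
  refine Filter.mem_of_superset (ho.mem_nhds ⟨e.mem_source.2 hx, fun h => hξ ?_⟩) ?_
  · have h' : e.linearEquivAt ℝ x hx ξ = 0 := h
    exact (e.linearEquivAt ℝ x hx).map_eq_zero_iff.1 h'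
  · rintro ⟨y, η⟩ ⟨hy, hη⟩ h0
    refine hη ?_
    have h0' : η = 0 := h0
    subst h0'
    exact map_zero (e.linearEquivAt ℝ y (e.mem_source.1 hy))

/-- The complement `L^* \ M` of the zero section in the dual of a line bundle. -/
def PuncturedDual : TopologicalSpace.Opens (TotalSpace 𝕂 (DualBundle 𝕂 L)) :=
  ⟨{p | p.2 ≠ 0}, isOpen_ne_zero 𝕂 L⟩

end One

variable (L : ι → M → Type*)
  [∀ i x, AddCommGroup (L i x)] [∀ i x, Module 𝕂 (L i x)] [∀ i x, TopologicalSpace (L i x)]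
  [∀ i, TopologicalSpace (TotalSpace 𝕂 (L i))] [∀ i, FiberBundle 𝕂 (L i)]
  [∀ i, VectorBundle 𝕂 𝕂 (L i)]

/-- The dual `L_1^* ⊕ ⋯ ⊕ L_k^*` of a direct sum of line bundles. -/
abbrev DualSum : M → Type _ := DirectSumBundle (fun i => DualBundle 𝕂 (L i))

theorem isOpen_forall_ne_zero :
    IsOpen {p : TotalSpace (ι → 𝕂) (DualSum 𝕂 L) | ∀ i, DirectSumBundle.component i p.2 ≠ 0} := by
  rw [isOpen_iff_mem_nhds]
  rintro ⟨x, ξ⟩ hξ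
  set e := trivializationAt (ι → 𝕂) (DualSum 𝕂 L) x
  have hx : x ∈ e.baseSet := mem_baseSet_trivializationAt (ι → 𝕂) (DualSum 𝕂 L) x
  have he : ∀ (y : M) (η : DualSum 𝕂 L y) (i : ι), (e ⟨y, η⟩).2 i =
      (trivializationAt 𝕂 (DualBundle 𝕂 (L i)) x).continuousLinearMapAt ℝ y
        (DirectSumBundle.component i η) :=
    fun _ _ _ => rfl
  have hi : ∀ i, x ∈ (trivializationAt 𝕂 (DualBundle 𝕂 (L i)) x).baseSet :=
    fun i => mem_baseSet_trivializationAt 𝕂 (DualBundle 𝕂 (L i)) x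
  have ho : IsOpen (e.source ∩ e ⁻¹' {q | ∀ i, q.2 i ≠ 0}) := by
    refine e.continuousOn_toFun.isOpen_inter_preimage e.open_source ?_
    rw [ofPred_forall]
    exact isOpen_iInter_of_finite fun i =>
      isOpen_ne_fun ((continuous_apply i).comp continuous_snd) continuous_const
  refine Filter.mem_of_superset (ho.mem_nhds ⟨e.mem_source.2 hx, fun i h => hξ i ?_⟩) ?_
  · have h' := (he x ξ i).symm.trans h
    have h'' := (trivializationAt 𝕂 (DualBundle 𝕂 (L i)) x).symmL_continuousLinearMapAt
      (R := ℝ) (hi i) (DirectSumBundle.component i ξ)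
    rw [h', map_zero] at h''
    exact h''.symm
  · rintro ⟨y, η⟩ ⟨hy, hη⟩ i h0
    refine hη i ?_
    rw [he, show DirectSumBundle.component i η = 0 from h0, map_zero]

/-- The fibre product over `M` of the punctured bundles `L_1^* \ M, …, L_k^* \ M`, as an open
subset of the total space of `L_1^* ⊕ ⋯ ⊕ L_k^*`. -/
def PuncturedDualSum : TopologicalSpace.Opens (TotalSpace (ι → 𝕂) (DualSum 𝕂 L)) :=
  ⟨{p | ∀ i, DirectSumBundle.component i p.2 ≠ 0}, isOpen_forall_ne_zero 𝕂 L⟩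

end Punctured

/-! ### Lie algebroids -/

section LieAlgebroid

variable {E : Type*} [NormedAddCommGroup E] [NormedSpace ℝ E] {H : Type*} [TopologicalSpace H]
  (I : ModelWithCorners ℝ E H) (M : Type*) [TopologicalSpace M] [ChartedSpace H M]
  [IsManifold I ∞ M]

/-- Smooth vector fields on `M`. -/
abbrev SmoothVectorField : Type _ := Cₛ^∞⟮I; E, (TangentSpace I : M → Type _)⟯

variable {I M} in
/-- The derivative `𝓛_v f` of a function `f` in the direction of a tangent vector `v`. -/
def dirDeriv (f : M → ℝ) {x : M} (v : TangentSpace I x) : ℝ := mfderiv I 𝓘(ℝ, ℝ) f x v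

/-- A Lie algebroid of rank `r` on `M`: a smooth vector bundle `Fib` with an anchor and a Lie
bracket on its space of smooth sections satisfying the Leibniz rule. -/
structure LieAlgebroid (r : ℕ) where
  Fib : M → Type
  [addCommGroup : ∀ x, AddCommGroup (Fib x)]
  [module : ∀ x, Module ℝ (Fib x)]
  [topFib : ∀ x, TopologicalSpace (Fib x)]
  [topTotal : TopologicalSpace (TotalSpace (EuclideanSpace ℝ (Fin r)) Fib)]
  [fiberBundle : FiberBundle (EuclideanSpace ℝ (Fin r)) Fib]
  [vectorBundle : VectorBundle ℝ (EuclideanSpace ℝ (Fin r)) Fib]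
  [contMDiffVectorBundle : ContMDiffVectorBundle ∞ (EuclideanSpace ℝ (Fin r)) Fib I]
  anchor : ∀ x, Fib x →ₗ[ℝ] TangentSpace I x
  contMDiff_anchor : ContMDiff (I.prod 𝓘(ℝ, EuclideanSpace ℝ (Fin r))) I.tangent ∞
    (fun p : TotalSpace (EuclideanSpace ℝ (Fin r)) Fib => (⟨p.1, anchor p.1 p.2⟩ : TangentBundle I M))
  bracket : Cₛ^∞⟮I; EuclideanSpace ℝ (Fin r), Fib⟯ → Cₛ^∞⟮I; EuclideanSpace ℝ (Fin r), Fib⟯ →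
    Cₛ^∞⟮I; EuclideanSpace ℝ (Fin r), Fib⟯
  bracket_add : ∀ a b c, bracket a (b + c) = bracket a b + bracket a c
  bracket_smul : ∀ (t : ℝ) a b, bracket a (t • b) = t • bracket a b
  bracket_antisymm : ∀ a b, bracket a b = - bracket b a
  bracket_jacobi : ∀ a b c,
    bracket a (bracket b c) = bracket (bracket a b) c + bracket b (bracket a c)
  bracket_leibniz : ∀ (f : C^∞⟮I, M; ℝ⟯) (a b c : Cₛ^∞⟮I; EuclideanSpace ℝ (Fin r), Fib⟯),
    (∀ x, c x = f x • b x) →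
      ∀ x, bracket a c x = f x • bracket a b x + dirDeriv f (anchor x (a x)) • b x

namespace LieAlgebroid

attribute [instance] addCommGroup module topFib topTotal fiberBundle vectorBundle
  contMDiffVectorBundle

variable {I M} {r : ℕ}

/-- The space of smooth sections of a Lie algebroid. -/
abbrev Sections (A : LieAlgebroid I M r) : Type _ := Cₛ^∞⟮I; EuclideanSpace ℝ (Fin r), A.Fib⟯

/-- The anchor identifies the sections of `A`, with their bracket, with the vector fields in `𝔛`,
with the Lie bracket of vector fields. -/
def IsAlgebroidOf (A : LieAlgebroid I M r) (𝔛 : Set (SmoothVectorField I M)) : Prop :=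
  (∀ X : SmoothVectorField I M, X ∈ 𝔛 ↔ ∃ a : A.Sections, ∀ x, A.anchor x (a x) = X x) ∧
  (∀ a b : A.Sections, (∀ x, A.anchor x (a x) = A.anchor x (b x)) → a = b) ∧
  (∀ (a b : A.Sections) (x : M), A.anchor x (A.bracket a b x) =
    VectorField.mlieBracket I (fun y => A.anchor y (a y)) (fun y => A.anchor y (b y)) x)

/-- `A` is (via its anchor) the subbundle `F` of the tangent bundle, with the Lie bracket of
vector fields tangent to `F`. -/
def IsTangentAlgebroid (A : LieAlgebroid I M r)
    (F : ∀ x : M, Submodule ℝ (TangentSpace I x)) : Prop :=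
  (∀ x, Function.Injective (A.anchor x)) ∧
  (∀ x, LinearMap.range (A.anchor x) = F x) ∧
  (∀ (a b : A.Sections) (x : M), A.anchor x (A.bracket a b x) =
    VectorField.mlieBracket I (fun y => A.anchor y (a y)) (fun y => A.anchor y (b y)) x)

variable {E' : Type*} [NormedAddCommGroup E'] [NormedSpace ℝ E'] {H' : Type*} [TopologicalSpace H']
  {J : ModelWithCorners ℝ E' H'} {N : Type*} [TopologicalSpace N] [ChartedSpace H' N]
  [IsManifold J ∞ N] {r' : ℕ}

/-- A morphism of Lie algebroids over `φ : N → M`: a smooth bundle map commuting with the anchors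
and with the brackets. As sections of `B` need not map to sections of `A`, the latter is expressed
through decompositions of their images as combinations of pulled back sections of `A`. -/
structure Hom (B : LieAlgebroid J N r') (A : LieAlgebroid I M r) (φ : N → M) where
  map : ∀ p, B.Fib p →ₗ[ℝ] A.Fib (φ p)
  contMDiff_map : ContMDiff (J.prod 𝓘(ℝ, EuclideanSpace ℝ (Fin r')))
    (I.prod 𝓘(ℝ, EuclideanSpace ℝ (Fin r))) ∞
    (fun b : TotalSpace (EuclideanSpace ℝ (Fin r')) B.Fib =>
      (⟨φ b.1, map b.1 b.2⟩ : TotalSpace (EuclideanSpace ℝ (Fin r)) A.Fib))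
  anchor_map : ∀ p (b : B.Fib p), A.anchor (φ p) (map p b) = mfderiv J I φ p (B.anchor p b)
  bracket_map : ∀ (k l : ℕ) (u v : B.Sections)
    (f : Fin k → C^∞⟮J, N; ℝ⟯) (a : Fin k → A.Sections)
    (g : Fin l → C^∞⟮J, N; ℝ⟯) (b : Fin l → A.Sections),
    (∀ p, map p (u p) = ∑ i, f i p • a i (φ p)) →
    (∀ p, map p (v p) = ∑ j, g j p • b j (φ p)) →
    ∀ p, map p (B.bracket u v p) =
      ∑ i, ∑ j, (f i p * g j p) • A.bracket (a i) (b j) (φ p)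
      + ∑ j, dirDeriv (g j) (B.anchor p (u p)) • b j (φ p)
      - ∑ i, dirDeriv (f i) (B.anchor p (v p)) • a i (φ p)

/-- A Lie algebroid submersion: a fibrewise surjective morphism over a surjective submersion. -/
def Hom.IsSubmersion {B : LieAlgebroid J N r'} {A : LieAlgebroid I M r} {φ : N → M}
    (Ψ : B.Hom A φ) : Prop :=
  Function.Surjective φ ∧ (∀ p, Function.Surjective (mfderiv J I φ p)) ∧
    ∀ p, Function.Surjective (Ψ.map p)

/-- A morphism that is an isomorphism on every fibre. -/
def Hom.IsFibrewiseIso {B : LieAlgebroid J N r'} {A : LieAlgebroid I M r} {φ : N → M}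
    (Ψ : B.Hom A φ) : Prop :=
  ∀ p, Function.Bijective (Ψ.map p)

end LieAlgebroid

end LieAlgebroid

/-! ### Foliations -/

section Foliation

variable {E : Type*} [NormedAddCommGroup E] [NormedSpace ℝ E] {H : Type*} [TopologicalSpace H]
  (I : ModelWithCorners ℝ E H) {M : Type*} [TopologicalSpace M] [ChartedSpace H M]

/-- A foliation of codimension `q`, as an involutive smooth subbundle `F` of corank `q` of the
tangent bundle. -/
structure IsFoliation [IsManifold I ∞ M] (F : ∀ x : M, Submodule ℝ (TangentSpace I x)) (q : ℕ) :
    Prop where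
  codim : ∀ x, Module.finrank ℝ (TangentSpace I x ⧸ F x) = q
  smooth : ∀ x, ∀ v ∈ F x, ∃ X : SmoothVectorField I M, X x = v ∧ ∀ y, X y ∈ F y
  involutive : ∀ X Y : SmoothVectorField I M, (∀ y, X y ∈ F y) → (∀ y, Y y ∈ F y) →
    ∀ y, VectorField.mlieBracket I X Y y ∈ F y

/-- The tangent distribution of the level sets of `φ`. -/
def levelDistribution {V : Type*} [NormedAddCommGroup V] [NormedSpace ℝ V] (φ : M → V) (x : M) :
    Submodule ℝ (TangentSpace I x) :=
  LinearMap.ker (mfderiv I 𝓘(ℝ, V) φ x).toLinearMap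

/-- The leaf of `F` through `x`: all points that can be joined to `x` by finitely many smooth
curves tangent to `F`. -/
def leaf (F : ∀ x : M, Submodule ℝ (TangentSpace I x)) (x : M) : Set M :=
  {y | Relation.ReflTransGen (fun p q : M => ∃ γ : ℝ → M, ContMDiff 𝓘(ℝ, ℝ) I ∞ γ ∧
    (∀ t, mfderiv 𝓘(ℝ, ℝ) I γ t (1 : ℝ) ∈ F (γ t)) ∧ γ 0 = p ∧ γ 1 = q) x y}

/-- Invariance of a distribution under a diffeomorphism `g`. -/
def IsInvariantUnder (F : ∀ x : M, Submodule ℝ (TangentSpace I x)) (g : M → M) : Prop :=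
  ∀ x, (F x).map (mfderiv I I g x).toLinearMap = F (g x)

end Foliation

/-! ### Divisors -/

section Divisor

variable {E : Type*} [NormedAddCommGroup E] [NormedSpace ℝ E] {H : Type*} [TopologicalSpace H]
  {I : ModelWithCorners ℝ E H} {M : Type*} [TopologicalSpace M] [ChartedSpace H M]
  [IsManifold I ∞ M] {𝕂 : Type*} [RCLike 𝕂]

section One

variable {L : M → Type*}
  [∀ x, AddCommGroup (L x)] [∀ x, Module 𝕂 (L x)] [∀ x, TopologicalSpace (L x)]
  [TopologicalSpace (TotalSpace 𝕂 L)] [FiberBundle 𝕂 L] [VectorBundle 𝕂 𝕂 L]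

/-- The derivative at `x` of a section, read in a local trivialization around `x`. At the zeros of
the section it does not depend on the trivialization. -/
def verticalDeriv (σ : Cₛ^∞⟮I; 𝕂, L⟯) (x : M) : TangentSpace I x →L[ℝ] 𝕂 :=
  mfderiv I 𝓘(ℝ, 𝕂) (fun y => (trivializationAt 𝕂 L x ⟨y, σ y⟩).2) x

/-- A section that vanishes transversely. For `𝕂 = ℝ` this says that `(L, σ)` is the `b`-divisor of
the hypersurface `σ⁻¹(0)`; for `𝕂 = ℂ`, that `(L, σ)` is a complex log divisor. -/
def VanishesTransversely (σ : Cₛ^∞⟮I; 𝕂, L⟯) : Prop :=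
  ∀ x, σ x = 0 → Function.Surjective (verticalDeriv σ x)

/-- The tangent space at `x` of the zero locus of a transversely vanishing section. -/
def zeroLocusTangent (σ : Cₛ^∞⟮I; 𝕂, L⟯) (x : M) : Submodule ℝ (TangentSpace I x) :=
  LinearMap.ker (verticalDeriv σ x).toLinearMap

/-- The function `e_x ↦ ⟨σ(x), e_x⟩` on `L^* \ M`. -/
def pairing (σ : Cₛ^∞⟮I; 𝕂, L⟯) (e : PuncturedDual 𝕂 L) : 𝕂 := e.1.2 (σ e.1.1)

/-- The bundle projection `L^* \ M → M`. -/
def PuncturedDual.proj (e : PuncturedDual 𝕂 L) : M := e.1.1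

/-- The action of `𝕂^*` on `L^* \ M`. -/
def PuncturedDual.scale (c : 𝕂ˣ) (e : PuncturedDual 𝕂 L) : PuncturedDual 𝕂 L :=
  ⟨⟨e.1.1, (c : 𝕂) • e.1.2⟩, smul_ne_zero c.ne_zero e.2⟩

/-- `S ⊆ L^* \ M` is the graph of a smooth section over `C ⊆ M`; in particular, the bundle projection
is a diffeomorphism from `S` to `C` if `C` is open. -/
def IsGraphOver (I : ModelWithCorners ℝ E H) (S : Set (PuncturedDual 𝕂 L)) (C : Set M) : Prop :=
  ∃ τ : M → TotalSpace 𝕂 (DualBundle 𝕂 L), ContMDiffOn I (I.prod 𝓘(ℝ, 𝕂)) ∞ τ C ∧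
    (∀ x ∈ C, (τ x).proj = x) ∧ Subtype.val '' S = τ '' C

end One

section Several

variable {ι : Type*} [Fintype ι] {L : ι → M → Type*}
  [∀ i x, AddCommGroup (L i x)] [∀ i x, Module 𝕂 (L i x)] [∀ i x, TopologicalSpace (L i x)]
  [∀ i, TopologicalSpace (TotalSpace 𝕂 (L i))] [∀ i, FiberBundle 𝕂 (L i)]
  [∀ i, VectorBundle 𝕂 𝕂 (L i)]

open Classical in
/-- The zero loci of the sections `σ i` intersect transversely: at every point, the codimension of
the intersection of the tangent spaces of those loci that contain it is the sum of the
codimensions. -/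
def ZeroLociTransverse (σ : ∀ i, Cₛ^∞⟮I; 𝕂, L i⟯) : Prop :=
  ∀ x, Module.finrank ℝ (TangentSpace I x ⧸ ⨅ i : {i // σ i x = 0}, zeroLocusTangent (σ i) x) =
    ∑ i : {i // σ i x = 0}, Module.finrank ℝ (TangentSpace I x ⧸ zeroLocusTangent (σ i) x)

/-- The vector fields tangent to the union of the zero loci of the sections `σ i`, i.e. tangent to
each of them. -/
def tangentFields (σ : ∀ i, Cₛ^∞⟮I; 𝕂, L i⟯) : Set (SmoothVectorField I M) :=
  {X | ∀ i x, σ i x = 0 → X x ∈ zeroLocusTangent (σ i) x}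

/-- The bundle projection of the fibre product of the `L_i^* \ M`. -/
def PuncturedDualSum.proj (p : PuncturedDualSum 𝕂 L) : M := p.1.1

/-- The projection of the fibre product of the `L_i^* \ M` to its `i`-th factor. -/
def PuncturedDualSum.pr (i : ι) (p : PuncturedDualSum 𝕂 L) : PuncturedDual 𝕂 (L i) :=
  ⟨⟨p.1.1, DirectSumBundle.component i p.1.2⟩, p.2 i⟩

/-- The action of `(𝕂^*)^k` on the fibre product of the `L_i^* \ M`. -/
def PuncturedDualSum.scale (c : ι → 𝕂ˣ) (p : PuncturedDualSum 𝕂 L) : PuncturedDualSum 𝕂 L :=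
  ⟨⟨p.1.1, fun i => (c i : 𝕂) • DirectSumBundle.component i p.1.2⟩,
    fun i => smul_ne_zero (c i).ne_zero (p.2 i)⟩

/-- The fibre product `F_1 ×_M ⋯ ×_M F_k` of distributions `F_i ⊆ T(L_i^* \ M)`, inside the tangent
bundle of the fibre product of the `L_i^* \ M`: the vectors whose `i`-th component lies in `F_i` for
all `i`. -/
def fibreProduct
    (F : ∀ i, ∀ e : PuncturedDual 𝕂 (L i), Submodule ℝ (TangentSpace (I.prod 𝓘(ℝ, 𝕂)) e))
    (p : PuncturedDualSum 𝕂 L) : Submodule ℝ (TangentSpace (I.prod 𝓘(ℝ, ι → 𝕂)) p) :=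
  ⨅ i, (F i (PuncturedDualSum.pr i p)).comap
    (mfderiv (I.prod 𝓘(ℝ, ι → 𝕂)) (I.prod 𝓘(ℝ, 𝕂)) (PuncturedDualSum.pr i) p).toLinearMap

end Several

section Elliptic

variable {L : M → Type*}
  [∀ x, AddCommGroup (L x)] [∀ x, Module ℂ (L x)] [∀ x, TopologicalSpace (L x)]
  [TopologicalSpace (TotalSpace ℂ L)] [FiberBundle ℂ L] [VectorBundle ℂ ℂ L]

/-- A smooth family of Hermitian forms on the fibres of a complex line bundle `L`, i.e. a smooth
section of the dual `W^*` of the real line bundle `W` with `L ⊗ L̄ = W ⊗ ℂ`. Smoothness is that of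
the coefficient `h(u, u)` with respect to the local frames `u` of `L`. -/
structure IsSmoothHermitian (I : ModelWithCorners ℝ E H) (h : ∀ x, L x →ₗ⋆[ℂ] L x →ₗ[ℂ] ℂ) :
    Prop where
  conj_symm : ∀ x (u v : L x), (starRingEnd ℂ) (h x u v) = h x v u
  smooth : ∀ x₀ : M, ContMDiffOn I 𝓘(ℝ, ℝ) ∞
    (fun x => (h x ((trivializationAt ℂ L x₀).symm x 1) ((trivializationAt ℂ L x₀).symm x 1)).re)
    (trivializationAt ℂ L x₀).baseSet

/-- The ideal `I_s = s(Γ(W^*))` of the elliptic divisor `(W, s)` with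
`(L ⊗ L̄, σ ⊗ σ̄) = (W, s) ⊗ ℂ`: the functions `h(σ, σ)` with `h` a smooth section of `W^*`. -/
def ellipticIdeal (σ : Cₛ^∞⟮I; ℂ, L⟯) : Ideal C^∞⟮I, M; ℝ⟯ where
  carrier := {f | ∃ h : ∀ x, L x →ₗ⋆[ℂ] L x →ₗ[ℂ] ℂ,
    IsSmoothHermitian I h ∧ ∀ x, f x = (h x (σ x) (σ x)).re}
  zero_mem' := ⟨fun _ => 0, ⟨fun _ _ _ => by simp, fun _ => by simpa using contMDiffOn_const⟩,
    fun _ => by simp⟩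
  add_mem' := by
    rintro f f' ⟨h, hh, hf⟩ ⟨h', hh', hf'⟩
    refine ⟨fun x => h x + h' x, ⟨fun x u v => ?_, fun x₀ => ?_⟩, fun x => ?_⟩
    · simp [hh.conj_symm, hh'.conj_symm]
    · exact (hh.smooth x₀).add (hh'.smooth x₀)
    · simp [hf, hf']
  smul_mem' := by
    rintro g f ⟨h, hh, hf⟩
    refine ⟨fun x => ((g x : ℝ) : ℂ) • h x, ⟨fun x u v => ?_, fun x₀ => ?_⟩, fun x => ?_⟩
    · simp [hh.conj_symm]
    · simpa [Pi.mul_def] using (g.contMDiff.contMDiffOn).mul (hh.smooth x₀)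
    · simp [hf]

/-- The vector fields `X` preserving an ideal of functions, `𝓛_X (𝔞) ⊆ 𝔞`. -/
def preservingFields (𝔞 : Ideal C^∞⟮I, M; ℝ⟯) : Set (SmoothVectorField I M) :=
  {X | ∀ f ∈ 𝔞, ∃ g ∈ 𝔞, ∀ x, g x = dirDeriv f (X x)}

end Elliptic

end Divisor

/-- The vector fields in `𝔛` are the sections of a Lie algebroid `A` over the `n`-dimensional
manifold `M`, the distribution `F` on `N` is a Lie algebroid `B`, and there is a Lie algebroid
submersion `B → A` over `φ` that is an isomorphism on every fibre. -/
def SubmersesIsomorphically {n : ℕ} {M : Type*} [TopologicalSpace M]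
    [ChartedSpace (EuclideanSpace ℝ (Fin n)) M] [IsManifold (𝓡 n) ∞ M]
    {E H : Type*} [NormedAddCommGroup E] [NormedSpace ℝ E] [TopologicalSpace H]
    (J : ModelWithCorners ℝ E H) {N : Type*} [TopologicalSpace N] [ChartedSpace H N]
    [IsManifold J ∞ N] (φ : N → M) (F : ∀ p : N, Submodule ℝ (TangentSpace J p))
    (𝔛 : Set (SmoothVectorField (𝓡 n) M)) : Prop :=
  ∃ (A : LieAlgebroid (𝓡 n) M n) (B : LieAlgebroid J N n) (Ψ : B.Hom A φ),
    A.IsAlgebroidOf 𝔛 ∧ B.IsTangentAlgebroid F ∧ Ψ.IsSubmersion ∧ Ψ.IsFibrewiseIso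

end Regularisation
end

open Regularisation

noncomputable section

namespace Regularisation

set_option linter.unusedSectionVars false

/-! ### Division of smooth functions -/

section Division

universe u

theorem contDiff_parametric_integral_nat {P : Type u} [NormedAddCommGroup P] [NormedSpace ℝ P]
    [FiniteDimensional ℝ P] (k : ℕ) : ∀ {V : Type u} [NormedAddCommGroup V] [NormedSpace ℝ V]
    {F : P × ℝ → V}, ContDiff ℝ k F →
    ContDiff ℝ k (fun p => ∫ s in (0 : ℝ)..1, F (p, s)) := by
  induction k with
  | zero =>
    intro V _ _ F hF
    rw [Nat.cast_zero, contDiff_zero] at hF ⊢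
    exact intervalIntegral.continuous_parametric_intervalIntegral_of_continuous'
      (f := fun p s => F (p, s)) hF 0 1
  | succ k ih =>
    intro V _ _ F hF
    have hF1 : ContDiff ℝ 1 F := hF.of_le (by norm_cast; omega)
    have hd : ContDiff ℝ k (fun q : P × ℝ => (fderiv ℝ F q).comp (ContinuousLinearMap.inl ℝ P ℝ)) :=
      (hF.fderiv_right (m := k) (by norm_cast)).clm_comp contDiff_const
    rw [Nat.cast_add, Nat.cast_one, contDiff_succ_iff_hasFDerivAt]
    refine ⟨_, ih hd, fun p => ?_⟩
    obtain ⟨C, hC⟩ := ((isCompact_closedBall p 1).prod (isCompact_Icc (a := (0 : ℝ)) (b := 1))).exists_bound_of_continuousOn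
      (hd.continuous.continuousOn)
    refine intervalIntegral.hasFDerivAt_integral_of_dominated_of_fderiv_le (𝕜 := ℝ)
      (μ := MeasureTheory.volume)
      (F := fun p s => F (p, s)) (bound := fun _ => C) (a := 0) (b := 1)
      (F' := fun p s => (fderiv ℝ F (p, s)).comp (ContinuousLinearMap.inl ℝ P ℝ))
      (Metric.closedBall_mem_nhds p one_pos) (.of_forall fun x => ?_) ?_ ?_ ?_
      intervalIntegrable_const ?_
    · exact (hF.continuous.comp (by fun_prop : Continuous fun s : ℝ => (x, s))).aestronglyMeasurable
    · exact (hF.continuous.comp (by fun_prop : Continuous fun s : ℝ => (p, s))).intervalIntegrable _ _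
    · exact (hd.continuous.comp (by fun_prop : Continuous fun s : ℝ => (p, s))).aestronglyMeasurable
    · refine .of_forall fun t ht x hx => hC (x, t) ⟨hx, ?_⟩
      rw [uIoc_of_le zero_le_one] at ht
      exact ⟨ht.1.le, ht.2⟩
    · refine .of_forall fun t ht x hx => ?_
      have h1 : HasFDerivAt F (fderiv ℝ F (x, t)) (x, t) :=
        (hF1.differentiable one_ne_zero (x, t)).hasFDerivAt
      exact h1.comp x (hasFDerivAt_prodMk_left x t)

theorem contDiff_parametric_integral {P V : Type u} [NormedAddCommGroup P] [NormedSpace ℝ P]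
    [FiniteDimensional ℝ P] [NormedAddCommGroup V] [NormedSpace ℝ V]
    {F : P × ℝ → V} (hF : ContDiff ℝ ∞ F) :
    ContDiff ℝ ∞ (fun p => ∫ s in (0 : ℝ)..1, F (p, s)) :=
  contDiff_infty.2 fun k => contDiff_parametric_integral_nat k (contDiff_infty.1 hF k)

/-- Hadamard's lemma. -/
theorem exists_eq_smul_of_eq_zero {K V : Type} [NormedAddCommGroup K] [NormedSpace ℝ K]
    [FiniteDimensional ℝ K] [NormedAddCommGroup V] [NormedSpace ℝ V] [CompleteSpace V]
    {f : ℝ × K → V} (hf : ContDiff ℝ ∞ f) (h0 : ∀ w, f (0, w) = 0) :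
    ∃ g : ℝ × K → V, ContDiff ℝ ∞ g ∧ ∀ p, f p = p.1 • g p := by
  refine ⟨fun p => ∫ s in (0 : ℝ)..1, fderiv ℝ f (s * p.1, p.2) (1, 0), ?_, fun p => ?_⟩
  · refine contDiff_parametric_integral
      (F := fun q : (ℝ × K) × ℝ => fderiv ℝ f (q.2 * q.1.1, q.1.2) (1, 0)) ?_
    have := hf.fderiv_right (m := ∞) (by simp)
    have h2 : ContDiff ℝ ∞ (fun q : (ℝ × K) × ℝ => (q.2 * q.1.1, q.1.2)) := by fun_prop
    exact (this.comp h2).clm_apply contDiff_const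
  · have hd : ∀ s : ℝ, HasDerivAt (fun s : ℝ => f (s * p.1, p.2))
        (p.1 • fderiv ℝ f (s * p.1, p.2) (1, 0)) s := by
      intro s
      have h1 : HasFDerivAt f (fderiv ℝ f (s * p.1, p.2)) (s * p.1, p.2) :=
        (hf.differentiable (by simp) _).hasFDerivAt
      have h2 : HasDerivAt (fun s : ℝ => (s * p.1, p.2)) (p.1, (0 : K)) s :=
        (by simpa using (hasDerivAt_id s).mul_const p.1 : HasDerivAt (fun s : ℝ => s * p.1) p.1 s).prodMk
          (hasDerivAt_const s p.2)
      have h3 := h1.comp_hasDerivAt s h2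
      rwa [show (p.1, (0 : K)) = p.1 • ((1 : ℝ), (0 : K)) by simp, map_smul] at h3
    have hc : Continuous fun s : ℝ => p.1 • fderiv ℝ f (s * p.1, p.2) (1, 0) := by
      have := (hf.fderiv_right (m := ∞) (by simp)).continuous
      exact continuous_const.smul
        ((this.comp (by fun_prop : Continuous fun s : ℝ => (s * p.1, p.2))).clm_apply continuous_const)
    have := intervalIntegral.integral_eq_sub_of_hasDerivAt (fun s _ => hd s)
      (hc.intervalIntegrable 0 1)
    rw [intervalIntegral.integral_smul] at this
    rw [this]
    simp [h0]

theorem eq_zero_of_eq_zero_off {P V : Type*} [NormedAddCommGroup P] [NormedSpace ℝ P]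
    [TopologicalSpace V] [T2Space V] [Zero V] {f : P → V} (hf : Continuous f) (ℓ : P →ₗ[ℝ] ℝ)
    (hℓ : ∃ v, ℓ v ≠ 0) (h : ∀ p, ℓ p ≠ 0 → f p = 0) (p : P) : f p = 0 := by
  by_cases hp : ℓ p = 0
  · obtain ⟨v, hv⟩ := hℓ
    have hc : Continuous fun t : ℝ => f (p + t • v) := hf.comp (by fun_prop)
    have h1 : EqOn (fun t : ℝ => f (p + t • v)) (fun _ => 0) {0}ᶜ := by
      intro t ht
      apply h
      simpa [hp, hv] using ht
    simpa using congrFun (Continuous.ext_on (dense_compl_singleton (0 : ℝ)) hc continuous_const h1) 0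
  · exact h p hp

/-- If `Re (z̄ h)` is divisible by `|z|²`, then `h` is divisible by `z`. -/
theorem exists_eq_mul_of_re_eq {K : Type} [NormedAddCommGroup K] [NormedSpace ℝ K]
    [FiniteDimensional ℝ K] {h : ℂ × K → ℂ} {g : ℂ × K → ℝ}
    (hh : ContDiff ℝ ∞ h) (hg : ContDiff ℝ ∞ g)
    (H : ∀ p, p.1.re * (h p).re + p.1.im * (h p).im = (p.1.re ^ 2 + p.1.im ^ 2) * g p) :
    ∃ l : ℂ × K → ℂ, ContDiff ℝ ∞ l ∧ ∀ p, h p = p.1 * l p := by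
  have hre : ContDiff ℝ ∞ (Complex.re) := Complex.reCLM.contDiff
  have him : ContDiff ℝ ∞ (Complex.im) := Complex.imCLM.contDiff
  have hofr : ContDiff ℝ ∞ (fun x : ℝ => (x : ℂ)) := Complex.ofRealCLM.contDiff
  let a : ℂ × K → ℝ := fun p => (h p).re - p.1.re * g p
  let b : ℂ × K → ℝ := fun p => (h p).im - p.1.im * g p
  have ha : ContDiff ℝ ∞ a := (hre.comp hh).sub ((hre.comp contDiff_fst).mul hg)
  have hb : ContDiff ℝ ∞ b := (him.comp hh).sub ((him.comp contDiff_fst).mul hg)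
  have hab : ∀ p : ℂ × K, p.1.re * a p + p.1.im * b p = 0 := fun p => by
    simp only [a, b]; linear_combination H p
  let cp : ℝ × (ℝ × K) → ℂ × K := fun q => ((q.2.1 : ℂ) + (q.1 : ℂ) * Complex.I, q.2.2)
  have hcp : ContDiff ℝ ∞ cp :=
    ((hofr.comp (contDiff_fst.comp contDiff_snd)).add
      ((hofr.comp contDiff_fst).mul contDiff_const)).prodMk (contDiff_snd.comp contDiff_snd)
  have hzero : ∀ w : ℝ × K, a (cp (0, w)) = 0 := by
    intro w
    refine eq_zero_of_eq_zero_off (f := fun w : ℝ × K => a (cp (0, w)))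
      (ha.continuous.comp (hcp.continuous.comp (by fun_prop))) (LinearMap.fst ℝ ℝ K)
      ⟨(1, 0), by simp⟩ (fun w hw => ?_) w
    have := hab (cp (0, w))
    simp only [cp] at this ⊢
    simp at this hw
    simpa using this.resolve_left hw
  obtain ⟨β, hβ, hβe⟩ := exists_eq_smul_of_eq_zero (ha.comp hcp) hzero
  let dp : ℂ × K → ℝ × (ℝ × K) := fun p => (p.1.im, (p.1.re, p.2))
  have hdp : ContDiff ℝ ∞ dp :=
    (him.comp contDiff_fst).prodMk ((hre.comp contDiff_fst).prodMk contDiff_snd)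
  have hcd : ∀ p, cp (dp p) = p := fun p => Prod.ext (Complex.re_add_im p.1) rfl
  have ha' : ∀ p, a p = p.1.im * β (dp p) := fun p => by
    have := hβe (dp p)
    simpa only [Function.comp_apply, hcd, smul_eq_mul] using this
  have hb' : ∀ p, b p = - p.1.re * β (dp p) := by
    intro p
    have := eq_zero_of_eq_zero_off (f := fun p => b p + p.1.re * β (dp p))
      (hb.continuous.add ((hre.comp contDiff_fst).continuous.mul (hβ.comp hdp).continuous))
      (Complex.imLm.comp (LinearMap.fst ℝ ℂ K)) ⟨(Complex.I, 0), by simp⟩ (fun p hp => ?_) p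
    · linarith
    · have h1 := hab p
      rw [ha' p] at h1
      have hp' : p.1.im ≠ 0 := hp
      refine (mul_eq_zero.1 (?_ : p.1.im * (b p + p.1.re * β (dp p)) = 0)).resolve_left hp'
      linear_combination h1
  refine ⟨fun p => (g p : ℂ) - Complex.I * (β (dp p) : ℂ), (hofr.comp hg).sub
    (contDiff_const.mul (hofr.comp (hβ.comp hdp))), fun p => ?_⟩
  have h1 := ha' p
  have h2 := hb' p
  simp only [a, b] at h1 h2
  apply Complex.ext <;> simp <;> linarith

section ComplexDivision

variable {K : Type} [NormedAddCommGroup K] [NormedSpace ℝ K]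
  {V : Type} [NormedAddCommGroup V] [NormedSpace ℝ V] [NormedSpace ℂ V] [IsScalarTower ℝ ℂ V]

/-- On a dense subset of `{z = 0}`, the germ of `f` is divisible by `z ^ m`. -/
def DenselyDivisible (f : ℂ × K → V) (m : ℕ) : Prop :=
  ∀ w : K, w ∈ closure {w : K | ∃ g : ℂ × K → V, ContDiffAt ℝ ∞ g (0, w) ∧
    ∀ᶠ q in 𝓝 ((0 : ℂ), w), f q = q.1 ^ m • g q}

theorem tendsto_polar (e : ℂ) (w : K) :
    Filter.Tendsto (fun t : ℝ => ((t : ℂ) * e, w)) (𝓝[≠] 0) (𝓝 ((0 : ℂ), w)) := by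
  have : Continuous fun t : ℝ => ((t : ℂ) * e, w) := by fun_prop
  simpa using (this.tendsto 0).mono_left nhdsWithin_le_nhds

theorem DenselyDivisible.polar_eq {f : ℂ × K → V} {m : ℕ} {j : ℕ} (hj : j ≤ m)
    {U : ℝ × (ℂ × K) → V} (hU : Continuous U)
    (hUf : ∀ (t : ℝ) (e : ℂ) (w : K), f ((t : ℂ) * e, w) = t ^ j • U (t, (e, w)))
    {w : K} {g : ℂ × K → V} (hg : ContinuousAt g (0, w))
    (hfg : ∀ᶠ q in 𝓝 ((0 : ℂ), w), f q = q.1 ^ m • g q) (e : ℂ) :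
    U (0, (e, w)) = (0 : ℂ) ^ (m - j) • e ^ m • g (0, w) := by
  have h1 : Filter.Tendsto (fun t : ℝ => U (t, (e, w))) (𝓝[≠] 0) (𝓝 (U (0, (e, w)))) :=
    ((hU.comp (by fun_prop : Continuous fun t : ℝ => (t, (e, w)))).tendsto 0).mono_left
      nhdsWithin_le_nhds
  have h2 : Filter.Tendsto (fun t : ℝ => (t : ℂ) ^ (m - j) • e ^ m • g ((t : ℂ) * e, w)) (𝓝[≠] 0)
      (𝓝 ((0 : ℂ) ^ (m - j) • e ^ m • g (0, w))) := by
    refine Filter.Tendsto.smul ?_ (Filter.Tendsto.const_smul (hg.tendsto.comp (tendsto_polar e w)) _)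
    have : Continuous fun t : ℝ => (t : ℂ) ^ (m - j) := by fun_prop
    simpa using (this.tendsto 0).mono_left nhdsWithin_le_nhds
  refine tendsto_nhds_unique (h1.congr' ?_) h2
  filter_upwards [(tendsto_polar e w).eventually hfg, self_mem_nhdsWithin] with t ht ht0
  have ht0' : (t : ℂ) ≠ 0 := by exact_mod_cast ht0
  rw [hUf, mul_pow, ← IsScalarTower.algebraMap_smul ℂ (t ^ j)] at ht
  simp only [Complex.coe_algebraMap, Complex.ofReal_pow] at ht
  rw [← Nat.sub_add_cancel hj, pow_add, Nat.sub_add_cancel hj] at ht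
  refine smul_right_injective V (pow_ne_zero j ht0') ?_
  simp only [ht, smul_smul]
  congr 1
  ring

variable [FiniteDimensional ℝ K] [CompleteSpace V]

theorem DenselyDivisible.exists_polar {f : ℂ × K → V} {m : ℕ} (hf : ContDiff ℝ ∞ f)
    (h : DenselyDivisible f m) : ∀ j ≤ m, ∃ U : ℝ × (ℂ × K) → V, ContDiff ℝ ∞ U ∧
      ∀ (t : ℝ) (e : ℂ) (w : K), f ((t : ℂ) * e, w) = t ^ j • U (t, (e, w)) := by
  intro j
  induction j with
  | zero =>
    intro _
    refine ⟨fun q => f ((q.1 : ℂ) * q.2.1, q.2.2), hf.comp ?_, fun t e w => by simp⟩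
    have hofr : ContDiff ℝ ∞ (fun x : ℝ => (x : ℂ)) := Complex.ofRealCLM.contDiff
    exact ((hofr.comp contDiff_fst).mul (contDiff_fst.comp contDiff_snd)).prodMk
      (contDiff_snd.comp contDiff_snd)
  | succ j ih =>
    intro hj
    obtain ⟨U, hU, hUf⟩ := ih (by omega)
    obtain ⟨U', hU', hUU'⟩ := exists_eq_smul_of_eq_zero hU (fun q => by
      obtain ⟨e, w⟩ := q
      have hc : IsClosed {w : K | U (0, (e, w)) = 0} :=
        isClosed_eq (hU.continuous.comp (by fun_prop)) continuous_const
      refine hc.closure_subset_iff.2 ?_ (h w)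
      rintro w ⟨g, hg, hfg⟩
      have := DenselyDivisible.polar_eq (by omega) hU.continuous hUf hg.continuousAt hfg e
      rw [mem_ofPred_eq, this, zero_pow (by omega), zero_smul])
    refine ⟨U', hU', fun t e w => ?_⟩
    rw [hUf, hUU', smul_smul, pow_succ]

theorem DenselyDivisible.exists_continuous {f : ℂ × K → V} {m : ℕ} (hf : ContDiff ℝ ∞ f)
    (h : DenselyDivisible f m) :
    ∃ g : ℂ × K → V, Continuous g ∧ ∀ p, f p = p.1 ^ m • g p := by
  obtain ⟨U, hU, hUf⟩ := h.exists_polar hf m le_rfl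
  have hU0 : ∀ (e : ℂ) (w : K), U (0, (e, w)) = e ^ m • U (0, (1, w)) := by
    intro e w
    have hc : IsClosed {w : K | U (0, (e, w)) = e ^ m • U (0, (1, w))} :=
      isClosed_eq (hU.continuous.comp (by fun_prop))
        (continuous_const.smul (hU.continuous.comp (by fun_prop)))
    refine hc.closure_subset_iff.2 ?_ (h w)
    rintro w ⟨g, hg, hfg⟩
    have := DenselyDivisible.polar_eq le_rfl hU.continuous hUf hg.continuousAt hfg
    rw [mem_ofPred_eq, this, this]
    simp
  let g : ℂ × K → V := fun p => if p.1 = 0 then U (0, (1, p.2)) else (p.1 ^ m)⁻¹ • f p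
  have hUg : ∀ (t : ℝ) (e : ℂ) (w : K), e ≠ 0 → U (t, (e, w)) = e ^ m • g ((t : ℂ) * e, w) := by
    intro t e w he
    by_cases ht : t = 0
    · simp [g, ht, hU0 e w]
    · have ht' : (t : ℂ) ≠ 0 := by exact_mod_cast ht
      simp only [g, mul_eq_zero, ht', he, or_self, if_false, hUf]
      rw [← IsScalarTower.algebraMap_smul ℂ (t ^ m), smul_smul, smul_smul]
      simp only [Complex.coe_algebraMap, Complex.ofReal_pow]
      rw [mul_pow, show e ^ m * ((t : ℂ) ^ m * e ^ m)⁻¹ * (t : ℂ) ^ m = 1 by field_simp, one_smul]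
  have hgf : ∀ p, f p = p.1 ^ m • g p := by
    rintro ⟨z, w⟩
    by_cases hz : z = 0
    · have h1 := hUf 0 1 w
      subst hz
      simp only [Complex.ofReal_zero, zero_mul] at h1
      simp only [g, if_true, h1]
      rw [← IsScalarTower.algebraMap_smul ℂ ((0 : ℝ) ^ m)]
      simp
    · simp [g, hz]
  refine ⟨g, continuous_iff_continuousAt.2 ?_, hgf⟩
  rintro ⟨z, w⟩
  by_cases hz : z = 0
  · subst hz
    let G : (ℝ × K) × Metric.sphere (0 : ℂ) 1 → V := fun q =>
      ((q.2 : ℂ) ^ m)⁻¹ • U (q.1.1, ((q.2 : ℂ), q.1.2))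
    have hne : ∀ e : Metric.sphere (0 : ℂ) 1, (e : ℂ) ≠ 0 := fun e => by
      have := e.2
      rw [mem_sphere_zero_iff_norm] at this
      exact norm_ne_zero_iff.1 (by rw [this]; exact one_ne_zero)
    have hG : Continuous G := by
      refine Continuous.smul (Continuous.inv₀ (by fun_prop) fun q => pow_ne_zero _ (hne q.2)) ?_
      exact hU.continuous.comp (by fun_prop)
    have hGg : ∀ t w e, G ((t, w), e) = g ((t : ℂ) * e, w) := by
      intro t w e
      simp only [G, hUg t e w (hne e), smul_smul]
      rw [inv_mul_cancel₀ (pow_ne_zero _ (hne e)), one_smul]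
    rw [ContinuousAt, (nhds_basis_opens (g (0, w))).tendsto_right_iff]
    rintro O ⟨hO, hOo⟩
    obtain ⟨u, v, hu, hv, hsu, htv, huv⟩ := generalized_tube_lemma (s := {((0 : ℝ), w)})
      (t := (univ : Set (Metric.sphere (0 : ℂ) 1))) isCompact_singleton isCompact_univ
      (hOo.preimage hG) (by
        rintro ⟨q, e⟩ ⟨hq, -⟩
        obtain rfl : q = (0, w) := hq
        rw [mem_preimage, hGg]
        simpa using hO)
    have hcont : Continuous fun q : ℂ × K => (‖q.1‖, q.2) := by fun_prop
    have : ∀ᶠ q in 𝓝 ((0 : ℂ), w), (‖q.1‖, q.2) ∈ u :=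
      hcont.continuousAt.eventually (hu.mem_nhds (by simpa using hsu rfl))
    filter_upwards [this] with q hq
    obtain ⟨z, w'⟩ := q
    obtain ⟨e, he⟩ : ∃ e : Metric.sphere (0 : ℂ) 1, (‖z‖ : ℂ) * e = z := by
      by_cases hz : z = 0
      · exact ⟨⟨1, by simp⟩, by simp [hz]⟩
      · have hz' : (‖z‖ : ℂ) ≠ 0 := by simpa using hz
        refine ⟨⟨z / ‖z‖, by simp [hz]⟩, by field_simp⟩
    have := huv (show (((‖z‖ : ℝ), w'), e) ∈ u ×ˢ v from ⟨hq, htv (mem_univ _)⟩)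
    rw [mem_preimage, hGg, he] at this
    exact this
  · have : g =ᶠ[𝓝 (z, w)] fun p => (p.1 ^ m)⁻¹ • f p := by
      filter_upwards [(isOpen_compl_singleton.preimage continuous_fst).mem_nhds
        (show (z, w) ∈ Prod.fst ⁻¹' {(0 : ℂ)}ᶜ from hz)] with p hp
      exact if_neg hp
    rw [continuousAt_congr this]
    exact ((continuousAt_fst.pow m).inv₀ (pow_ne_zero _ hz)).smul hf.continuous.continuousAt

/-- `z • D f - m • dz ⊗ f`, the numerator of the derivative of `z⁻ᵐ f`. -/
def quotientNumerator (f : ℂ × K → V) (m : ℕ) (p : ℂ × K) : ℂ × K →L[ℝ] V :=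
  p.1 • fderiv ℝ f p -
    (m : ℂ) • ((ContinuousLinearMap.lsmul ℝ ℂ).flip (f p)).comp (ContinuousLinearMap.fst ℝ ℂ K)

theorem quotientNumerator_eq {f g : ℂ × K → V} {m : ℕ} {p : ℂ × K} (hg : DifferentiableAt ℝ g p)
    (h : ∀ᶠ q in 𝓝 p, f q = q.1 ^ m • g q) :
    quotientNumerator f m p = p.1 ^ (m + 1) • fderiv ℝ g p := by
  have h1 : HasFDerivAt (fun q : ℂ × K => q.1 ^ m)
      (((m : ℂ) * p.1 ^ (m - 1)) • ContinuousLinearMap.fst ℝ ℂ K) p :=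
    (hasDerivAt_pow m p.1).complexToReal_fderiv.comp p hasFDerivAt_fst |>.congr_fderiv (by
      ext <;> simp)
  have h2 := (h1.smul hg.hasFDerivAt).congr_of_eventuallyEq h
  refine ContinuousLinearMap.ext fun x => ?_
  simp only [quotientNumerator, h2.fderiv, h.self_of_nhds]
  simp only [sub_apply, smul_apply, add_apply, ContinuousLinearMap.comp_apply, ContinuousLinearMap.flip_apply,
    ContinuousLinearMap.lsmul_apply, ContinuousLinearMap.smulRight_apply,
    ContinuousLinearMap.coe_fst']
  cases m with
  | zero => simp
  | succ m =>
    simp only [Nat.add_sub_cancel, smul_eq_mul]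
    module

theorem DenselyDivisible.quotientNumerator {f : ℂ × K → V} {m : ℕ} (h : DenselyDivisible f m) :
    DenselyDivisible (quotientNumerator f m) (m + 1) := by
  intro w
  refine closure_mono ?_ (h w)
  rintro w ⟨g, hg, hfg⟩
  refine ⟨fderiv ℝ g, hg.fderiv_right (by simp), ?_⟩
  have hg1 : ∀ᶠ q in 𝓝 ((0 : ℂ), w), ContDiffAt ℝ 1 g q :=
    (hg.of_le (by simp : (1 : ℕ∞ω) ≤ ∞)).eventually (by simp)
  filter_upwards [hg1, hfg.eventually_nhds] with q hq1 hq2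
  exact quotientNumerator_eq (hq1.differentiableAt one_ne_zero) hq2

end ComplexDivision

theorem eq_of_pow_smul_eq {K V : Type} [NormedAddCommGroup K] [NormedSpace ℝ K]
    [NormedAddCommGroup V] [NormedSpace ℂ V] {g g' : ℂ × K → V} (hg : Continuous g)
    (hg' : Continuous g') {m : ℕ} (h : ∀ p : ℂ × K, p.1 ^ m • g p = p.1 ^ m • g' p) : g = g' := by
  have hd : Dense (Prod.fst ⁻¹' {(0 : ℂ)}ᶜ : Set (ℂ × K)) :=
    (dense_compl_singleton (0 : ℂ)).preimage isOpenMap_fst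
  exact Continuous.ext_on hd hg hg' fun p hp => smul_right_injective V (pow_ne_zero m hp) (h p)

theorem DenselyDivisible.exists_contDiff_nat {K : Type} [NormedAddCommGroup K] [NormedSpace ℝ K]
    [FiniteDimensional ℝ K] (k : ℕ) : ∀ {V : Type} [NormedAddCommGroup V] [NormedSpace ℝ V]
    [NormedSpace ℂ V] [IsScalarTower ℝ ℂ V] [CompleteSpace V] {f : ℂ × K → V} {m : ℕ}
    (_ : ContDiff ℝ ∞ f) (_ : DenselyDivisible f m),
    ∃ g : ℂ × K → V, ContDiff ℝ k g ∧ ∀ p, f p = p.1 ^ m • g p := by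
  induction k with
  | zero =>
    intro V _ _ _ _ _ f m hf h
    simpa [contDiff_zero] using h.exists_continuous hf
  | succ k ih =>
    intro V _ _ _ _ _ f m hf h
    obtain ⟨g, hg, hgf⟩ := h.exists_continuous hf
    have hnum : ContDiff ℝ ∞ (Regularisation.quotientNumerator f m) := by
      unfold Regularisation.quotientNumerator
      refine (contDiff_fst.smul (hf.fderiv_right (by simp))).sub (ContDiff.const_smul (m : ℂ) ?_)
      exact (((ContinuousLinearMap.lsmul ℝ ℂ).flip : V →L[ℝ] ℂ →L[ℝ] V).contDiff.comp hf).clm_comp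
        contDiff_const
    obtain ⟨g', hg', hgf'⟩ := ih hnum h.quotientNumerator
    have hoff : ∀ p : ℂ × K, p.1 ≠ 0 → HasFDerivAt g (g' p) p := by
      intro p hp
      have hd : DifferentiableAt ℝ g p := by
        have : g =ᶠ[𝓝 p] fun p => (p.1 ^ m)⁻¹ • f p := by
          filter_upwards [(isOpen_compl_singleton.preimage continuous_fst).mem_nhds
            (show p ∈ Prod.fst ⁻¹' {(0 : ℂ)}ᶜ from hp)] with q hq
          rw [hgf q, smul_smul, inv_mul_cancel₀ (pow_ne_zero m hq), one_smul]
        refine DifferentiableAt.congr_of_eventuallyEq ?_ this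
        exact ((differentiableAt_fst.pow m).inv (pow_ne_zero m hp)).smul
          (hf.differentiable (by simp) p)
      have h1 := quotientNumerator_eq hd (.of_forall hgf)
      rw [hgf'] at h1
      rw [smul_right_injective _ (pow_ne_zero (m + 1) hp) h1]
      exact hd.hasFDerivAt
    have hhalf : ∀ (ε : ℝ), ε ≠ 0 → ∀ p : ℂ × K,
        HasFDerivWithinAt g (g' p) (closure {p : ℂ × K | 0 < ε * p.1.re}) p := by
      intro ε hε p
      have hne : ∀ q ∈ {p : ℂ × K | 0 < ε * p.1.re}, q.1 ≠ 0 := by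
        intro q hq h0
        simp [h0] at hq
      refine hasFDerivWithinAt_closure_of_tendsto_fderiv
        (fun q hq => (hoff q (hne q hq)).differentiableAt.differentiableWithinAt) ?_ ?_
        (fun y _ => hg.continuousWithinAt) ?_
      · exact (convex_Ioi (0 : ℝ)).linear_preimage
          (ε • (Complex.reLm.comp (LinearMap.fst ℝ ℂ K)))
      · exact isOpen_lt continuous_const (by fun_prop)
      · refine ((hg'.continuous.tendsto p).mono_left nhdsWithin_le_nhds).congr' ?_
        filter_upwards [self_mem_nhdsWithin] with q hq
        exact (hoff q (hne q hq)).fderiv.symm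
    have hcov : closure {p : ℂ × K | 0 < (1 : ℝ) * p.1.re} ∪ closure {p : ℂ × K | 0 < (-1 : ℝ) * p.1.re}
        = univ := by
      rw [← closure_union]
      have hd : Dense ((fun p : ℂ × K => p.1.re) ⁻¹' {(0 : ℝ)}ᶜ) :=
        (dense_compl_singleton (0 : ℝ)).preimage (Complex.isOpenMap_re.comp isOpenMap_fst)
      refine (hd.mono ?_).closure_eq
      intro p hp
      rcases lt_or_gt_of_ne (show p.1.re ≠ 0 from hp) with h | h
      · right; simpa using h
      · left; simpa using h
    refine ⟨g, ?_, hgf⟩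
    rw [Nat.cast_add, Nat.cast_one, contDiff_succ_iff_hasFDerivAt]
    refine ⟨g', hg', fun p => ?_⟩
    have := (hhalf 1 one_ne_zero p).union (hhalf (-1) (by norm_num) p)
    rwa [hcov, hasFDerivWithinAt_univ] at this

/-- Smooth divisibility by `z ^ m` at a dense set of points of `{z = 0}` implies smooth
divisibility. -/
theorem DenselyDivisible.exists_contDiff {K V : Type} [NormedAddCommGroup K] [NormedSpace ℝ K]
    [FiniteDimensional ℝ K] [NormedAddCommGroup V] [NormedSpace ℝ V] [NormedSpace ℂ V]
    [IsScalarTower ℝ ℂ V] [CompleteSpace V] {f : ℂ × K → V} {m : ℕ}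
    (hf : ContDiff ℝ ∞ f) (h : DenselyDivisible f m) :
    ∃ g : ℂ × K → V, ContDiff ℝ ∞ g ∧ ∀ p, f p = p.1 ^ m • g p := by
  obtain ⟨g, hg, hgf⟩ := h.exists_continuous hf
  refine ⟨g, contDiff_infty.2 fun k => ?_, hgf⟩
  obtain ⟨g', hg', hgf'⟩ := h.exists_contDiff_nat k hf
  rwa [eq_of_pow_smul_eq hg hg'.continuous fun p => (hgf p).symm.trans (hgf' p)]

end Division

/-! ### Derivatives along vector fields -/

section DerivAlong

variable {E : Type*} [NormedAddCommGroup E] [NormedSpace ℝ E] [FiniteDimensional ℝ E]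
  {H : Type*} [TopologicalSpace H]
  {I : ModelWithCorners ℝ E H} [I.Boundaryless] {M : Type*} [TopologicalSpace M] [ChartedSpace H M]
  [IsManifold I ∞ M] {V : Type*} [NormedAddCommGroup V] [NormedSpace ℝ V]

variable (I) in
/-- The derivative of a vector valued function. -/
def dAt (f : M → V) (x : M) : TangentSpace I x →L[ℝ] V := mfderiv I 𝓘(ℝ, V) f x

variable (I) in
/-- The derivative of a vector valued function along a vector field. -/
def derivAlong (X : ∀ x : M, TangentSpace I x) (f : M → V) (x : M) : V :=
  dAt I f x (X x)

variable (I) in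
theorem contMDiffAt_extChartAt_symm' {x : M} {y : E} (hy : y ∈ (extChartAt I x).target) :
    ContMDiffAt 𝓘(ℝ, E) I ∞ (extChartAt I x).symm y :=
  (contMDiffOn_extChartAt_symm x).contMDiffAt ((isOpen_extChartAt_target x).mem_nhds hy)

variable (I) in
theorem isInvertible_mfderiv_extChartAt_symm' {x : M} {y : E} (hy : y ∈ (extChartAt I x).target) :
    (mfderiv 𝓘(ℝ, E) I (extChartAt I x).symm y).IsInvertible := by
  have := isInvertible_mfderivWithin_extChartAt_symm hy
  rwa [I.range_eq_univ, mfderivWithin_univ] at this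

/-- A vector field in the chart at `x`. -/
def chartField (I : ModelWithCorners ℝ E H) (x : M) (X : ∀ x : M, TangentSpace I x) : E → E :=
  VectorField.mpullback 𝓘(ℝ, E) I (extChartAt I x).symm X

theorem mfderiv_chartField {x : M} (X : ∀ x : M, TangentSpace I x) {y : E}
    (hy : y ∈ (extChartAt I x).target) :
    mfderiv 𝓘(ℝ, E) I (extChartAt I x).symm y (chartField (E := E) I x X y) =
      X ((extChartAt I x).symm y) := by
  exact (isInvertible_mfderiv_extChartAt_symm' I hy).self_apply_inverse _

theorem contDiffAt_chartField {x : M} {X : ∀ x : M, TangentSpace I x} {y : E}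
    (hy : y ∈ (extChartAt I x).target)
    (hX : ContMDiffAt I I.tangent ∞ (T% X) ((extChartAt I x).symm y)) :
    ContDiffAt ℝ ∞ (chartField I x X) y := by
  refine contMDiffAt_vectorSpace_iff_contDiffAt.1 ?_
  exact ContMDiffAt.mpullback_vectorField_preimage (n := ∞) hX (contMDiffAt_extChartAt_symm' I hy)
    (isInvertible_mfderiv_extChartAt_symm' I hy) (by simp)

theorem derivAlong_symm {x : M} (X : ∀ x : M, TangentSpace I x) {f : M → V} {y : E}
    (hy : y ∈ (extChartAt I x).target)
    (hf : MDifferentiableAt I 𝓘(ℝ, V) f ((extChartAt I x).symm y)) :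
    derivAlong I X f ((extChartAt I x).symm y) =
      fderiv ℝ (f ∘ (extChartAt I x).symm) y (chartField I x X y) := by
  have h1 := mfderiv_comp (I'' := 𝓘(ℝ, V)) y hf
    ((contMDiffAt_extChartAt_symm' I hy).mdifferentiableAt (by simp))
  have h2 := congrArg (fun A : E →L[ℝ] V => A (chartField I x X y)) (mfderiv_eq_fderiv.symm.trans h1)
  refine Eq.trans ?_ h2.symm
  exact congrArg (dAt I f _) (mfderiv_chartField X hy).symm

theorem contMDiffAt_derivAlong {x : M} {X : ∀ x : M, TangentSpace I x} {f : M → V}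
    (hX : ContMDiffAt I I.tangent ∞ (T% X) x) (hf : ContMDiffAt I 𝓘(ℝ, V) ∞ f x) :
    ContMDiffAt I 𝓘(ℝ, V) ∞ (derivAlong I X f) x := by
  have hx := mem_extChartAt_source (I := I) x
  have hy : extChartAt I x x ∈ (extChartAt I x).target := (extChartAt I x).map_source hx
  have hxy : (extChartAt I x).symm (extChartAt I x x) = x := (extChartAt I x).left_inv hx
  have h1 : ContDiffAt ℝ ∞ (f ∘ (extChartAt I x).symm) (extChartAt I x x) :=
    (ContMDiffAt.comp (extChartAt I x x) (by rwa [hxy])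
      (contMDiffAt_extChartAt_symm' I hy)).contDiffAt
  have h2 : ContDiffAt ℝ ∞ (fun y => fderiv ℝ (f ∘ (extChartAt I x).symm) y (chartField I x X y))
      (extChartAt I x x) :=
    (h1.fderiv_right (m := ∞) (by simp)).clm_apply (contDiffAt_chartField hy (by rwa [hxy]))
  refine (h2.contMDiffAt.comp x (contMDiffAt_extChartAt (I := I))).congr_of_eventuallyEq ?_
  have hf1 : ∀ᶠ y in 𝓝 x, MDifferentiableAt I 𝓘(ℝ, V) f y := by
    have : ContMDiffAt I 𝓘(ℝ, V) 1 f x := hf.of_le (by simp)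
    filter_upwards [(contMDiffAt_iff_contMDiffAt_nhds (by simp)).1 this] with z hz
      using hz.mdifferentiableAt one_ne_zero
  filter_upwards [extChartAt_source_mem_nhds (I := I) x, hf1] with y hys hfy
  have hy' := (extChartAt I x).left_inv hys
  have := derivAlong_symm X ((extChartAt I x).map_source hys) (f := f) (by rwa [hy'])
  rw [hy'] at this
  exact this

/-- The derivative along a Lie bracket is the commutator of the derivatives. -/
theorem mfderiv_mlieBracket {x : M} {X Y : ∀ x : M, TangentSpace I x} {f : M → V}
    (hX : ContMDiffAt I I.tangent ∞ (T% X) x) (hY : ContMDiffAt I I.tangent ∞ (T% Y) x)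
    (hf : ContMDiffAt I 𝓘(ℝ, V) ∞ f x) :
    derivAlong I (VectorField.mlieBracket I X Y) f x =
      derivAlong I X (derivAlong I Y f) x - derivAlong I Y (derivAlong I X f) x := by
  have : IsManifold I (minSmoothness ℝ 3) M := IsManifold.of_le (n := ∞) (by
    rw [minSmoothness_of_isRCLikeNormedField]; exact ENat.LEInfty.out)
  have hx := mem_extChartAt_source (I := I) x
  set y := extChartAt I x x with hydef
  have hy : y ∈ (extChartAt I x).target := (extChartAt I x).map_source hx
  have hxy : (extChartAt I x).symm y = x := (extChartAt I x).left_inv hx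
  have hfe : ContDiffAt ℝ ∞ (f ∘ (extChartAt I x).symm) y :=
    (ContMDiffAt.comp y (by rwa [hxy]) (contMDiffAt_extChartAt_symm' I hy)).contDiffAt
  have key : ∀ (Z : ∀ x : M, TangentSpace I x) (g : M → V), ContMDiffAt I 𝓘(ℝ, V) ∞ g x →
      derivAlong I Z g x = fderiv ℝ (g ∘ (extChartAt I x).symm) y (chartField I x Z y) := by
    intro Z g hg
    have := derivAlong_symm Z hy (f := g) (by rw [hxy]; exact hg.mdifferentiableAt (by simp))
    rwa [hxy] at this
  have hf1 : ∀ᶠ z in 𝓝 x, MDifferentiableAt I 𝓘(ℝ, V) f z := by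
    have : ContMDiffAt I 𝓘(ℝ, V) 1 f x := hf.of_le (by simp)
    filter_upwards [(contMDiffAt_iff_contMDiffAt_nhds (by simp)).1 this] with z hz
      using hz.mdifferentiableAt one_ne_zero
  have hcont : Filter.Tendsto (extChartAt I x).symm (𝓝 y) (𝓝 x) := by
    have := (contMDiffAt_extChartAt_symm' I hy).continuousAt
    rwa [ContinuousAt, hxy] at this
  have hev : ∀ Z : ∀ x : M, TangentSpace I x,
      derivAlong I Z f ∘ (extChartAt I x).symm =ᶠ[𝓝 y]
      fun z => fderiv ℝ (f ∘ (extChartAt I x).symm) z (chartField I x Z z) := by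
    intro Z
    filter_upwards [hcont.eventually hf1, (isOpen_extChartAt_target x).mem_nhds hy] with z hz hzt
    exact derivAlong_symm Z hzt hz
  rw [key _ _ hf, key _ _ (contMDiffAt_derivAlong hY hf), key _ _ (contMDiffAt_derivAlong hX hf),
    (hev Y).fderiv_eq, (hev X).fderiv_eq]
  have hXc : ContDiffAt ℝ ∞ (chartField I x X) y := contDiffAt_chartField hy (by rwa [hxy])
  have hYc : ContDiffAt ℝ ∞ (chartField I x Y) y := contDiffAt_chartField hy (by rwa [hxy])
  have hb : chartField I x (VectorField.mlieBracket I X Y) y =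
      VectorField.lieBracket ℝ (chartField I x X) (chartField I x Y) y := by
    rw [chartField, VectorField.mpullback_mlieBracket (n := ∞)
      (by rw [hxy]; exact hX.mdifferentiableAt (by simp))
      (by rw [hxy]; exact hY.mdifferentiableAt (by simp))
      (contMDiffAt_extChartAt_symm' I hy)
      (by rw [minSmoothness_of_isRCLikeNormedField]; exact ENat.LEInfty.out)]
    rw [← VectorField.mlieBracketWithin_univ, VectorField.mlieBracketWithin_eq_lieBracketWithin]
    exact congrFun VectorField.lieBracketWithin_univ y
  rw [hb]
  exact VectorField.fderiv_apply_lieBracket hfe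
    (by rw [minSmoothness_of_isRCLikeNormedField]; exact ENat.LEInfty.out) (hYc.differentiableAt (by simp))
    (hXc.differentiableAt (by simp))

/-- The vector field with given derivative of a local diffeomorphism to a vector space is
smooth. -/
theorem contMDiffAt_inverse_mfderiv [FiniteDimensional ℝ V] {x : M} {g W : M → V}
    (hg : ContMDiffAt I 𝓘(ℝ, V) ∞ g x) (hinv : (mfderiv I 𝓘(ℝ, V) g x).IsInvertible)
    (hW : ContMDiffAt I 𝓘(ℝ, V) ∞ W x) :
    ContMDiffAt I I.tangent ∞
      (fun y => (⟨y, (mfderiv I 𝓘(ℝ, V) g y).inverse (W y)⟩ : TangentBundle I M)) x := by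
  let b := Module.finBasis ℝ V
  have h1 : ∀ i, ContMDiffAt I I.tangent ∞
      (T% fun y => b.coord i (W y) • VectorField.mpullback I 𝓘(ℝ, V) g (fun _ => b i) y) x := by
    intro i
    refine ContMDiffAt.smul_section ?_ ?_
    · exact ((b.coord i).toContinuousLinearMap.contMDiff.contMDiffAt).comp x hW
    · refine ContMDiffAt.mpullback_vectorField_preimage (n := ∞) ?_ hg hinv (by simp)
      exact contMDiffAt_vectorSpace_iff_contDiffAt.2 contDiffAt_const
  have h2 := ContMDiffAt.sum_section (s := Finset.univ) (fun i _ => h1 i)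
  refine h2.congr_of_eventuallyEq (.of_forall fun y => ?_)
  refine congrArg (TotalSpace.mk y) ?_
  let A : V →L[ℝ] TangentSpace I y := (mfderiv I 𝓘(ℝ, V) g y).inverse
  change A (W y) = ∑ i, b.coord i (W y) • A (b i)
  conv_lhs => rw [← b.sum_repr (W y)]
  simp only [map_sum, map_smul, Module.Basis.coord_apply]

end DerivAlong

section DAt

variable {E : Type*} [NormedAddCommGroup E] [NormedSpace ℝ E] {H : Type*} [TopologicalSpace H]
  {I : ModelWithCorners ℝ E H} {M : Type*} [TopologicalSpace M] [ChartedSpace H M]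
  {E' : Type*} [NormedAddCommGroup E'] [NormedSpace ℝ E'] {H' : Type*} [TopologicalSpace H']
  {J : ModelWithCorners ℝ E' H'} {N : Type*} [TopologicalSpace N] [ChartedSpace H' N]
  {V : Type*} [NormedAddCommGroup V] [NormedSpace ℝ V]
  {W : Type*} [NormedAddCommGroup W] [NormedSpace ℝ W]
  {f g : M → V} {x : M}

theorem dAt_congr (h : f =ᶠ[𝓝 x] g) (v : TangentSpace I x) : dAt I f x v = dAt I g x v :=
  congrArg (fun A : E →L[ℝ] V => A v) h.mfderiv_eq

theorem dAt_const (c : V) (v : TangentSpace I x) : dAt I (fun _ : M => c) x v = 0 :=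
  congrArg (fun A : E →L[ℝ] V => A v) mfderiv_const

theorem dAt_comp {φ : N → M} {p : N} (hf : MDifferentiableAt I 𝓘(ℝ, V) f (φ p))
    (hφ : MDifferentiableAt J I φ p) (v : TangentSpace J p) :
    dAt J (fun q => f (φ q)) p v = dAt I f (φ p) (mfderiv J I φ p v) :=
  mfderiv_comp_apply p hf hφ v

theorem dAt_fderiv_comp {h : V → W} (hh : DifferentiableAt ℝ h (f x))
    (hf : MDifferentiableAt I 𝓘(ℝ, V) f x) (v : TangentSpace I x) :
    dAt I (fun y => h (f y)) x v = fderiv ℝ h (f x) (dAt I f x v) := by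
  have h1 := mfderiv_comp_apply (I'' := 𝓘(ℝ, W)) x hh.mdifferentiableAt hf v
  refine h1.trans ?_
  exact congrArg (fun A : V →L[ℝ] W => A (dAt I f x v)) mfderiv_eq_fderiv

theorem dAt_clm_comp (L : V →L[ℝ] W) (hf : MDifferentiableAt I 𝓘(ℝ, V) f x)
    (v : TangentSpace I x) : dAt I (fun y => L (f y)) x v = L (dAt I f x v) := by
  rw [dAt_fderiv_comp L.differentiableAt hf, L.fderiv]

theorem mdifferentiableAt_prodMk {h : M → W} (hf : MDifferentiableAt I 𝓘(ℝ, V) f x)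
    (hh : MDifferentiableAt I 𝓘(ℝ, W) h x) :
    MDifferentiableAt I 𝓘(ℝ, V × W) (fun y => (f y, h y)) x :=
  hf.prodMk_space hh

theorem dAt_prodMk {h : M → W} (hf : MDifferentiableAt I 𝓘(ℝ, V) f x)
    (hh : MDifferentiableAt I 𝓘(ℝ, W) h x) (v : TangentSpace I x) :
    dAt I (fun y => (f y, h y)) x v = (dAt I f x v, dAt I h x v) :=
  Prod.ext
    (dAt_clm_comp (ContinuousLinearMap.fst ℝ V W) (mdifferentiableAt_prodMk hf hh) v).symm
    (dAt_clm_comp (ContinuousLinearMap.snd ℝ V W) (mdifferentiableAt_prodMk hf hh) v).symm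

theorem dAt_fderiv_comp₂ {U : Type*} [NormedAddCommGroup U] [NormedSpace ℝ U] {h : M → W}
    (hf : MDifferentiableAt I 𝓘(ℝ, V) f x) (hh : MDifferentiableAt I 𝓘(ℝ, W) h x)
    (B : V →L[ℝ] W →L[ℝ] U) (v : TangentSpace I x) :
    dAt I (fun y => B (f y) (h y)) x v = B (dAt I f x v) (h x) + B (f x) (dAt I h x v) := by
  have h1 := dAt_fderiv_comp (h := fun q : V × W => B q.1 q.2) (f := fun y => (f y, h y)) (x := x)
    (B.isBoundedBilinearMap.differentiableAt _) (mdifferentiableAt_prodMk hf hh) v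
  rw [h1, dAt_prodMk hf hh, B.isBoundedBilinearMap.fderiv]
  simp [add_comm]

theorem dAt_add (hf : MDifferentiableAt I 𝓘(ℝ, V) f x) (hg : MDifferentiableAt I 𝓘(ℝ, V) g x)
    (v : TangentSpace I x) : dAt I (fun y => f y + g y) x v = dAt I f x v + dAt I g x v := by
  have h := dAt_clm_comp (ContinuousLinearMap.fst ℝ V V + ContinuousLinearMap.snd ℝ V V)
    (mdifferentiableAt_prodMk hf hg) v
  rw [dAt_prodMk hf hg] at h
  exact h

theorem dAt_mul {A : Type*} [NormedCommRing A] [NormedAlgebra ℝ A] {f g : M → A}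
    (hf : MDifferentiableAt I 𝓘(ℝ, A) f x) (hg : MDifferentiableAt I 𝓘(ℝ, A) g x)
    (v : TangentSpace I x) :
    dAt I (fun y => f y * g y) x v = dAt I f x v * g x + f x * dAt I g x v :=
  dAt_fderiv_comp₂ hf hg (ContinuousLinearMap.mul ℝ A) v

theorem dAt_pi {ι : Type*} [Fintype ι] {f : M → ι → V}
    (hf : MDifferentiableAt I 𝓘(ℝ, ι → V) f x) (v : TangentSpace I x) (i : ι) :
    dAt I f x v i = dAt I (fun y => f y i) x v :=
  (dAt_clm_comp (ContinuousLinearMap.proj i) hf v).symm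

end DAt

/-! ### Local normal forms of submersions -/

section Straightening

variable {E : Type*} [NormedAddCommGroup E] [NormedSpace ℝ E] [FiniteDimensional ℝ E]
  {H : Type*} [TopologicalSpace H]
  {I : ModelWithCorners ℝ E H} [I.Boundaryless] {M : Type*} [TopologicalSpace M] [ChartedSpace H M]
  [IsManifold I ∞ M] {V : Type*} [NormedAddCommGroup V] [NormedSpace ℝ V] [FiniteDimensional ℝ V]

/-- The inverse function theorem on a manifold. -/
theorem exists_localDiffeo {O : Set M} (hO : IsOpen O) {p₀ : M} (hp : p₀ ∈ O) {g : M → V}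
    (hg : ContMDiffOn I 𝓘(ℝ, V) ∞ g O) (hinv : (mfderiv I 𝓘(ℝ, V) g p₀).IsInvertible) :
    ∃ ψ : OpenPartialHomeomorph M V, p₀ ∈ ψ.source ∧ ψ.source ⊆ O ∧
      ContMDiffOn I 𝓘(ℝ, V) ∞ ψ ψ.source ∧ ContMDiffOn 𝓘(ℝ, V) I ∞ ψ.symm ψ.target ∧
      ∀ p ∈ ψ.source, ψ p = g p := by
  have : CompleteSpace E := FiniteDimensional.complete ℝ E
  have : CompleteSpace V := FiniteDimensional.complete ℝ V
  let e : OpenPartialHomeomorph M E := (chartAt H p₀).transHomeomorph I.toHomeomorph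
  have hes : e.source = (extChartAt I p₀).source := (extChartAt_source I p₀).symm
  have het : e.target = (extChartAt I p₀).target := by
    have h1 := e.toPartialEquiv.image_source_eq_target
    have h2 := (extChartAt I p₀).image_source_eq_target
    rw [← hes] at h2
    exact h1.symm.trans h2
  have hesm : ContMDiffOn I 𝓘(ℝ, E) ∞ e e.source := by
    rw [hes, extChartAt_source]
    exact contMDiffOn_extChartAt
  have hesy : ContMDiffOn 𝓘(ℝ, E) I ∞ e.symm e.target := by
    rw [het]
    exact contMDiffOn_extChartAt_symm p₀
  have hp0 : p₀ ∈ e.source := by rw [hes]; exact mem_extChartAt_source p₀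
  set U := e.target ∩ e.symm ⁻¹' O with hU
  have hUo : IsOpen U := e.isOpen_inter_preimage_symm hO
  set G : E → V := g ∘ e.symm with hGdef
  have hG : ContDiffOn ℝ ∞ G U := by
    refine contMDiffOn_iff_contDiffOn.1 ?_
    exact hg.comp (hesy.mono inter_subset_left) fun y hy => hy.2
  set y₀ := e p₀
  have hy0 : y₀ ∈ U := ⟨e.map_source hp0, by
    change e.symm (e p₀) ∈ O
    rwa [e.left_inv hp0]⟩
  have hGinv : (fderiv ℝ G y₀).IsInvertible := by
    have h2 : MDifferentiableAt 𝓘(ℝ, E) I e.symm y₀ :=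
      ((hesy.contMDiffAt (e.open_target.mem_nhds hy0.1)).mdifferentiableAt (by simp))
    have h1 : MDifferentiableAt I 𝓘(ℝ, V) g (e.symm y₀) :=
      (hg.contMDiffAt (hO.mem_nhds hy0.2)).mdifferentiableAt (by simp)
    have h3 : fderiv ℝ G y₀ =
      (mfderiv I 𝓘(ℝ, V) g (e.symm y₀)).comp (mfderiv 𝓘(ℝ, E) I e.symm y₀) :=
      mfderiv_eq_fderiv.symm.trans (mfderiv_comp y₀ h1 h2)
    rw [h3]
    have h4 : (mfderiv 𝓘(ℝ, E) I e.symm y₀).IsInvertible :=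
      isInvertible_mfderiv_extChartAt_symm' I (by rw [← het]; exact hy0.1)
    have h5 : e.symm y₀ = p₀ := e.left_inv hp0
    have h6 : (mfderiv I 𝓘(ℝ, V) g (e.symm y₀)).IsInvertible := by rw [h5]; exact hinv
    exact h6.comp h4
  obtain ⟨A, hA⟩ := hGinv
  have hGat : ContDiffAt ℝ ∞ G y₀ := hG.contDiffAt (hUo.mem_nhds hy0)
  have hd : HasFDerivAt G (A : E →L[ℝ] V) y₀ := by
    rw [hA]; exact (hGat.differentiableAt (by simp)).hasFDerivAt
  let h := hGat.toOpenPartialHomeomorph G hd (by simp)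
  have hh : ∀ y, h y = G y := fun y => rfl
  set S := U ∩ (fderiv ℝ G) ⁻¹' (range ((↑) : (E ≃L[ℝ] V) → E →L[ℝ] V))
  have hS : IsOpen S := (hG.continuousOn_fderiv_of_isOpen hUo (by simp)).isOpen_inter_preimage hUo
    (ContinuousLinearEquiv.isOpen)
  have hyS : y₀ ∈ S := ⟨hy0, A, hA⟩
  let k := h.restrOpen S hS
  have hks : k.source = h.source ∩ S := rfl
  refine ⟨e.trans k, ?_, ?_, ?_, ?_, ?_⟩
  · rw [OpenPartialHomeomorph.trans_source]
    exact ⟨hp0, hGat.mem_toOpenPartialHomeomorph_source hd (by simp), hyS⟩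
  · rw [OpenPartialHomeomorph.trans_source]
    rintro p ⟨hp1, hp2, hp3⟩
    have := hp3.1.2
    change e.symm (e p) ∈ O at this
    rwa [e.left_inv hp1] at this
  · rw [OpenPartialHomeomorph.trans_source]
    have h1 : ContMDiffOn 𝓘(ℝ, E) 𝓘(ℝ, V) ∞ G U := hG.contMDiffOn
    exact h1.comp (hesm.mono inter_subset_left) fun p hp => hp.2.2.1
  · rw [OpenPartialHomeomorph.trans_target]
    refine (hesy.comp (s := k.target ∩ k.symm ⁻¹' e.target) (f := k.symm) ?_ fun z hz => hz.2)
    rintro z ⟨hz1, hz2⟩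
    have hz3 := k.map_target hz1
    obtain ⟨A', hA'⟩ := hz3.2.2
    have h1 : ContDiffAt ℝ ∞ h.symm z := by
      have hzt : z ∈ h.target := by
        have h1 := h.map_source hz3.1
        have h2 : k (k.symm z) = z := k.right_inv hz1
        have h3 : h (k.symm z) = z := h2
        rwa [h3] at h1
      have h4 : ContDiffAt ℝ ∞ G (h.symm z) := hG.contDiffAt (hUo.mem_nhds hz3.2.1)
      refine h.contDiffAt_symm hzt (f₀' := A') ?_ h4
      rw [hA']
      exact (h4.differentiableAt (by simp)).hasFDerivAt
    exact (contMDiffAt_iff_contDiffAt.2 h1).contMDiffWithinAt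
  · intro p hp
    rw [OpenPartialHomeomorph.trans_source] at hp
    change g (e.symm (e p)) = g p
    rw [e.left_inv hp.1]

theorem isInvertible_of_injective_of_finrank_eq {V W : Type*} [NormedAddCommGroup V]
    [NormedSpace ℝ V] [FiniteDimensional ℝ V] [NormedAddCommGroup W] [NormedSpace ℝ W]
    [FiniteDimensional ℝ W] {A : V →L[ℝ] W} (hi : Function.Injective A)
    (h : Module.finrank ℝ V = Module.finrank ℝ W) : A.IsInvertible :=
  ⟨(LinearEquiv.ofInjectiveOfFinrankEq A.toLinearMap hi h).toContinuousLinearEquiv, by ext; rfl⟩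

/-- A submersion to a vector space is locally a projection. -/
theorem exists_straightening {O : Set M} (hO : IsOpen O) {p₀ : M} (hp : p₀ ∈ O) {Φ : M → V}
    (hΦ : ContMDiffOn I 𝓘(ℝ, V) ∞ Φ O) (hs : Function.Surjective (dAt I Φ p₀)) :
    ∃ (K : Submodule ℝ E) (ψ : OpenPartialHomeomorph M (V × K)), p₀ ∈ ψ.source ∧ ψ.source ⊆ O ∧
      ContMDiffOn I 𝓘(ℝ, V × K) ∞ ψ ψ.source ∧ ContMDiffOn 𝓘(ℝ, V × K) I ∞ ψ.symm ψ.target ∧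
      ∀ p ∈ ψ.source, (ψ p).1 = Φ p := by
  let D : E →L[ℝ] V := dAt I Φ p₀
  let K : Submodule ℝ E := LinearMap.ker D.toLinearMap
  obtain ⟨P, hP⟩ := K.exists_isCompl
  let pr : E →L[ℝ] K := (K.projectionOnto P hP).toContinuousLinearMap
  let Q : M → K := fun p => pr (extChartAt I p₀ p)
  have hO' : IsOpen (O ∩ (chartAt H p₀).source) := hO.inter (chartAt H p₀).open_source
  have hp' : p₀ ∈ O ∩ (chartAt H p₀).source := ⟨hp, mem_chart_source H p₀⟩
  have hQ : ContMDiffOn I 𝓘(ℝ, K) ∞ Q (O ∩ (chartAt H p₀).source) :=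
    pr.contMDiff.comp_contMDiffOn (contMDiffOn_extChartAt.mono inter_subset_right)
  have hg : ContMDiffOn I 𝓘(ℝ, V × K) ∞ (fun p => (Φ p, Q p)) (O ∩ (chartAt H p₀).source) :=
    (hΦ.mono inter_subset_left).prodMk_space hQ
  have hΦd : MDifferentiableAt I 𝓘(ℝ, V) Φ p₀ :=
    (hΦ.contMDiffAt (hO.mem_nhds hp)).mdifferentiableAt (by simp)
  have hQd : MDifferentiableAt I 𝓘(ℝ, K) Q p₀ :=
    (hQ.contMDiffAt (hO'.mem_nhds hp')).mdifferentiableAt (by simp)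
  have hed : MDifferentiableAt I 𝓘(ℝ, E) (extChartAt I p₀) p₀ :=
    (contMDiffAt_extChartAt' (n := ∞) (mem_chart_source H p₀)).mdifferentiableAt (by simp)
  have hfr : Module.finrank ℝ E = Module.finrank ℝ (V × K) := by
    have h1 := LinearMap.finrank_range_add_finrank_ker D.toLinearMap
    have h2 : Module.finrank ℝ (LinearMap.range D.toLinearMap) = Module.finrank ℝ V := by
      have h3 : LinearMap.range D.toLinearMap = ⊤ := LinearMap.range_eq_top.2 hs
      rw [h3, finrank_top]
    rw [Module.finrank_prod, ← h1, h2]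
  have hinj : Function.Injective (dAt I (fun p => (Φ p, Q p)) p₀ : E →L[ℝ] V × K) := by
    rw [injective_iff_map_eq_zero]
    intro v hv
    have h1 := (dAt_prodMk hΦd hQd v).symm.trans hv
    have h2 : D v = 0 := congrArg Prod.fst h1
    have h3 : dAt I Q p₀ v = 0 := congrArg Prod.snd h1
    have h4 : dAt I Q p₀ v = pr (dAt I (extChartAt I p₀) p₀ v) := dAt_clm_comp pr hed v
    have h5 : dAt I (extChartAt I p₀) p₀ v = v :=
      congrArg (fun A : E →L[ℝ] E => A v) (mfderiv_extChartAt_self (I := I) (x := p₀))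
    rw [h5] at h4
    have hvK : v ∈ K := h2
    have h6 : pr v = ⟨v, hvK⟩ := K.projectionOnto_apply_left hP ⟨v, hvK⟩
    have h7 := h6.symm.trans (h4.symm.trans h3)
    exact congrArg Subtype.val h7
  obtain ⟨ψ, h1, h2, h3, h4, h5⟩ := exists_localDiffeo hO' hp' hg
    (isInvertible_of_injective_of_finrank_eq (V := E) hinj hfr)
  exact ⟨K, ψ, h1, h2.trans inter_subset_left, h3, h4, fun p hp => by rw [h5 p hp]⟩

/-- A diffeomorphism onto an open subset of a vector space has invertible derivatives. -/
theorem isInvertible_mfderiv_of_contMDiffOn {ψ : OpenPartialHomeomorph M V}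
    (h : ContMDiffOn I 𝓘(ℝ, V) ∞ ψ ψ.source) (h' : ContMDiffOn 𝓘(ℝ, V) I ∞ ψ.symm ψ.target)
    {p : M} (hp : p ∈ ψ.source) : (mfderiv I 𝓘(ℝ, V) ψ p).IsInvertible := by
  have hd : ψ.MDifferentiable I 𝓘(ℝ, V) :=
    ⟨h.mdifferentiableOn (by simp), h'.mdifferentiableOn (by simp)⟩
  exact ⟨hd.mfderiv hp, rfl⟩

end Straightening

/-! ### Globalizing vector fields -/

section Bump

variable {E : Type*} [NormedAddCommGroup E] [NormedSpace ℝ E] [FiniteDimensional ℝ E]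
  {H : Type*} [TopologicalSpace H]
  {I : ModelWithCorners ℝ E H} {M : Type*} [TopologicalSpace M] [ChartedSpace H M]
  [IsManifold I ∞ M]

variable (I) in
theorem exists_bump [T2Space M] {x₀ : M} {U : Set M} (hU : U ∈ 𝓝 x₀) :
    ∃ χ : C^∞⟮I, M; ℝ⟯, (∀ᶠ y in 𝓝 x₀, χ y = 1) ∧ tsupport χ ⊆ U := by
  obtain ⟨f, -, hf⟩ := (SmoothBumpFunction.nhds_basis_tsupport (I := I) x₀).mem_iff.1 hU
  exact ⟨⟨f, f.contMDiff⟩, f.eventuallyEq_one, hf⟩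

/-- A vector field that is smooth on an open set, multiplied by a cut-off function. -/
theorem exists_smoothVectorField_smul {U : Set M} (hU : IsOpen U) {X : ∀ x : M, TangentSpace I x}
    (hX : ∀ x ∈ U, ContMDiffAt I I.tangent ∞ (T% X) x) {χ : C^∞⟮I, M; ℝ⟯} (hχ : tsupport χ ⊆ U) :
    ∃ Y : SmoothVectorField I M, ∀ y, Y y = χ y • X y :=
  ⟨⟨fun y => χ y • X y, ContMDiffOn.smul_section_of_tsupport χ.contMDiff.contMDiffOn hU hχ
    fun x hx => (hX x hx).contMDiffWithinAt⟩, fun _ => rfl⟩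

theorem SmoothVectorField.contMDiffAt (X : SmoothVectorField I M) (x : M) :
    ContMDiffAt I I.tangent ∞ (T% fun y => X y) x := X.contMDiff x

end Bump

/-! ### The foliation by the level sets of a submersion -/

section LevelSets

variable {E : Type*} [NormedAddCommGroup E] [NormedSpace ℝ E] [FiniteDimensional ℝ E]
  {H : Type*} [TopologicalSpace H]
  {I : ModelWithCorners ℝ E H} [I.Boundaryless] {M : Type*} [TopologicalSpace M] [ChartedSpace H M]
  [IsManifold I ∞ M] {V : Type*} [NormedAddCommGroup V] [NormedSpace ℝ V] [FiniteDimensional ℝ V]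
  {Φ : M → V}

theorem mem_levelDistribution {x : M} {v : TangentSpace I x} :
    v ∈ levelDistribution I Φ x ↔ dAt I Φ x v = 0 := Iff.rfl

theorem isFoliation_levelDistribution [T2Space M] (hΦ : ContMDiff I 𝓘(ℝ, V) ∞ Φ)
    (hs : ∀ x, Function.Surjective (dAt I Φ x)) :
    IsFoliation I (levelDistribution I Φ) (Module.finrank ℝ V) where
  codim x := ((dAt I Φ x).toLinearMap.quotKerEquivOfSurjective (hs x)).finrank_eq
  smooth x v hv := by
    obtain ⟨K, ψ, hx, -, hψ, hψ', h1⟩ :=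
      exists_straightening isOpen_univ (mem_univ x) hΦ.contMDiffOn (hs x)
    let w : V × K := dAt I ψ x v
    let X : ∀ y : M, TangentSpace I y := fun y => (mfderiv I 𝓘(ℝ, V × K) ψ y).inverse w
    have hinv := fun y (hy : y ∈ ψ.source) => isInvertible_mfderiv_of_contMDiffOn hψ hψ' hy
    have hat := fun y (hy : y ∈ ψ.source) => hψ.contMDiffAt (ψ.open_source.mem_nhds hy)
    have hX : ∀ y ∈ ψ.source, ContMDiffAt I I.tangent ∞ (T% X) y := fun y hy =>
      contMDiffAt_inverse_mfderiv (hat y hy) (hinv y hy) contMDiffAt_const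
    have hfst : ∀ y ∈ ψ.source, ∀ u : TangentSpace I y, dAt I Φ y u = (dAt I ψ y u).1 := by
      intro y hy u
      refine Eq.trans (dAt_congr ?_ u) (dAt_clm_comp (ContinuousLinearMap.fst ℝ V K)
        ((hat y hy).mdifferentiableAt (by simp)) u)
      filter_upwards [ψ.open_source.mem_nhds hy] with z hz
      exact (h1 z hz).symm
    have hXw : ∀ y ∈ ψ.source, dAt I ψ y (X y) = w := fun y hy =>
      (hinv y hy).self_apply_inverse w
    obtain ⟨χ, hχ1, hχ⟩ := exists_bump I (ψ.open_source.mem_nhds hx)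
    obtain ⟨Y, hY⟩ := exists_smoothVectorField_smul ψ.open_source hX hχ
    have hw : w.1 = 0 := (hfst x hx v).symm.trans hv
    refine ⟨Y, ?_, fun y => ?_⟩
    · rw [hY, hχ1.self_of_nhds, one_smul]
      exact (hinv x hx).inverse_apply_self v
    · rw [hY]
      by_cases hy : y ∈ ψ.source
      · refine Submodule.smul_mem _ _ ?_
        rw [mem_levelDistribution, hfst y hy, hXw y hy, hw]
      · rw [image_eq_zero_of_notMem_tsupport fun h => hy (hχ h), zero_smul]
        exact Submodule.zero_mem _
  involutive X Y hX hY y := by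
    rw [mem_levelDistribution]
    have h1 := mfderiv_mlieBracket (X.contMDiffAt y) (Y.contMDiffAt y) (hΦ y)
    refine h1.trans ?_
    have h2 : ∀ Z : SmoothVectorField I M, (∀ y, Z y ∈ levelDistribution I Φ y) →
        derivAlong I (fun y => Z y) Φ = fun _ => 0 := fun Z hZ => funext fun y => hZ y
    rw [h2 X hX, h2 Y hY]
    unfold derivAlong
    rw [dAt_const, dAt_const, sub_zero]

theorem comp_eq_of_tangent (hΦ : ContMDiff I 𝓘(ℝ, V) ∞ Φ) {γ : ℝ → M}
    (hγ : ContMDiff 𝓘(ℝ, ℝ) I ∞ γ)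
    (h : ∀ t, mfderiv 𝓘(ℝ, ℝ) I γ t (1 : ℝ) ∈ levelDistribution I Φ (γ t)) (s t : ℝ) :
    Φ (γ s) = Φ (γ t) := by
  have hd : ContDiff ℝ ∞ (Φ ∘ γ) := contMDiff_iff_contDiff.1 (hΦ.comp hγ)
  refine is_const_of_fderiv_eq_zero (𝕜 := ℝ) (f := Φ ∘ γ) (hd.differentiable (by simp)) ?_ s t
  intro u
  ext
  have h1 := mfderiv_comp_apply (I' := I) (I'' := 𝓘(ℝ, V)) u (hΦ.mdifferentiableAt (by simp))
    (hγ.mdifferentiableAt (by simp)) (1 : ℝ)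
  have h2 := congrArg (fun A : ℝ →L[ℝ] V => A 1) (mfderiv_eq_fderiv (f := Φ ∘ γ) (x := u))
  exact h2.symm.trans (h1.trans (h u))

theorem leaf_levelDistribution (hΦ : ContMDiff I 𝓘(ℝ, V) ∞ Φ)
    (hs : ∀ x, Function.Surjective (dAt I Φ x)) (e : M) :
    leaf I (levelDistribution I Φ) e = connectedComponentIn {e' | Φ e' = Φ e} e := by
  set S := {e' | Φ e' = Φ e}
  apply Subset.antisymm
  · intro y hy
    induction hy with
    | refl => exact mem_connectedComponentIn rfl
    | tail _ hq ih =>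
      obtain ⟨γ, hγ, hγF, h0, h1⟩ := hq
      rw [connectedComponentIn_eq ih]
      have hpS := connectedComponentIn_subset _ _ ih
      refine IsPreconnected.subset_connectedComponentIn (s := range γ)
        (isPreconnected_range hγ.continuous) ⟨0, h0⟩ ?_ ⟨1, h1⟩
      rintro _ ⟨t, rfl⟩
      have h2 := comp_eq_of_tangent hΦ hγ hγF t 0
      rw [h0] at h2
      exact h2.trans hpS
  · intro y hy
    refine isPreconnected_connectedComponentIn.induction₂ (s := connectedComponentIn S e)
      (fun a b => b ∈ leaf I (levelDistribution I Φ) a) ?_ (fun a b c _ _ _ h1 h2 => h1.trans h2)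
      ?_ (mem_connectedComponentIn rfl) hy
    · intro x hxC
      have hxS := connectedComponentIn_subset _ _ hxC
      obtain ⟨K, ψ, hx, -, hψ, hψ', h1⟩ :=
        exists_straightening isOpen_univ (mem_univ x) hΦ.contMDiffOn (hs x)
      obtain ⟨r, hr, hball⟩ := Metric.mem_nhds_iff.1 (ψ.open_target.mem_nhds (ψ.map_source hx))
      have h2 : ∀ᶠ y in 𝓝 x, y ∈ ψ.source ∧ ψ y ∈ Metric.ball (ψ x) r :=
        Filter.Eventually.and (ψ.open_source.mem_nhds hx)
          (ψ.continuousAt hx (Metric.ball_mem_nhds _ hr))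
      filter_upwards [h2.filter_mono nhdsWithin_le_nhds, self_mem_nhdsWithin] with y hy hyC
      have hyS := connectedComponentIn_subset _ _ hyC
      let c : ℝ → V × K := fun t => ψ x + Real.smoothTransition t • (ψ y - ψ x)
      have hc : ContDiff ℝ ∞ c :=
        contDiff_const.add (Real.smoothTransition.contDiff.smul contDiff_const)
      have hct : ∀ t, c t ∈ ψ.target := fun t => hball <|
        (convex_ball (ψ x) r).add_smul_sub_mem (Metric.mem_ball_self hr) hy.2
          ⟨Real.smoothTransition.nonneg t, Real.smoothTransition.le_one t⟩
      have hγ : ContMDiff 𝓘(ℝ, ℝ) I ∞ (fun t => ψ.symm (c t)) :=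
        hψ'.comp_contMDiff hc.contMDiff hct
      have hconst : ∀ t, Φ (ψ.symm (c t)) = Φ x := by
        intro t
        rw [← h1 _ (ψ.map_target (hct t)), ψ.right_inv (hct t)]
        change (ψ x).1 + Real.smoothTransition t • ((ψ y).1 - (ψ x).1) = Φ x
        rw [h1 x hx, h1 y hy.1]
        have : Φ y = Φ x := Eq.trans hyS (Eq.symm hxS)
        rw [this, sub_self, smul_zero, add_zero]
      refine Relation.ReflTransGen.single ⟨fun t => ψ.symm (c t), hγ, fun t => ?_, ?_, ?_⟩
      · have h3 := dAt_comp (J := 𝓘(ℝ, ℝ)) (f := Φ) (φ := fun t => ψ.symm (c t)) (p := t)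
          (hΦ.mdifferentiableAt (by simp)) (hγ.mdifferentiableAt (by simp)) (1 : ℝ)
        refine h3.symm.trans ?_
        rw [funext hconst]
        exact dAt_const _ _
      · simp [c, ψ.left_inv hx]
      · simp [c, ψ.left_inv hy.1]
    · intro a b _ _ hab
      refine (@Relation.ReflTransGen.stdSymm _ _ ⟨?_⟩).symm _ _ hab
      rintro p q ⟨γ, hγ, hγF, h0, h1⟩
      have hrev : ContMDiff 𝓘(ℝ, ℝ) 𝓘(ℝ, ℝ) ∞ (fun t : ℝ => 1 - t) :=
        (contDiff_const.sub contDiff_id).contMDiff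
      refine ⟨fun t => γ (1 - t), hγ.comp hrev, fun t => ?_, by simpa using h1, by simpa using h0⟩
      have h3 := dAt_comp (J := 𝓘(ℝ, ℝ)) (f := Φ) (φ := fun t => γ (1 - t)) (p := t)
          (hΦ.mdifferentiableAt (by simp)) ((hγ.comp hrev).mdifferentiableAt (by simp)) (1 : ℝ)
      refine h3.symm.trans ?_
      have h4 : (fun t => Φ (γ (1 - t))) = fun _ => Φ (γ 0) :=
        funext fun t => comp_eq_of_tangent hΦ hγ hγF _ _
      rw [h4]
      exact dAt_const _ _

theorem isInvariantUnder_levelDistribution (hΦ : ContMDiff I 𝓘(ℝ, V) ∞ Φ) {g g' : M → M}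
    (hg : ContMDiff I I ∞ g) (hg' : ContMDiff I I ∞ g') (hgg : ∀ x, g (g' x) = x)
    (hgg' : ∀ x, g' (g x) = x) (A A' : V →L[ℝ] V) (hA : ∀ x, Φ (g x) = A (Φ x))
    (hA' : ∀ x, Φ (g' x) = A' (Φ x)) :
    IsInvariantUnder I (levelDistribution I Φ) g := by
  have hd : ∀ x, MDifferentiableAt I 𝓘(ℝ, V) Φ x := fun x => hΦ.mdifferentiableAt (by simp)
  have key : ∀ {k : M → M} (_ : ContMDiff I I ∞ k) (B : V →L[ℝ] V) (_ : ∀ x, Φ (k x) = B (Φ x))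
      (x : M) (v : TangentSpace I x), dAt I Φ x v = 0 → dAt I Φ (k x) (mfderiv I I k x v) = 0 := by
    intro k hk B hB x v hv
    have h1 := dAt_comp (J := I) (f := Φ) (φ := k) (hd (k x)) (hk.mdifferentiableAt (by simp)) v
    refine h1.symm.trans ?_
    rw [funext hB, dAt_clm_comp B (hd x), hv, map_zero]
  intro x
  apply le_antisymm
  · rintro _ ⟨v, hv, rfl⟩
    exact key hg A hA x v hv
  · intro w hw
    have h1 := key hg' A' hA' (g x) w hw
    have h2 : mfderiv I I (g ∘ g') (g x) w = mfderiv I I g (g' (g x)) (mfderiv I I g' (g x) w) :=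
      mfderiv_comp_apply _ (hg.mdifferentiableAt (by simp)) (hg'.mdifferentiableAt (by simp)) w
    have h3 : g ∘ g' = id := funext hgg
    rw [h3, mfderiv_id] at h2
    obtain ⟨v, hv⟩ : ∃ v : E, v = mfderiv I I g' (g x) w := ⟨_, rfl⟩
    have h4 : dAt I Φ (g' (g x)) v = 0 ∧ mfderiv I I g (g' (g x)) v = w := by
      rw [hv]; exact ⟨h1, h2.symm⟩
    rw [hgg' x] at h4
    exact ⟨v, h4.1, h4.2⟩

end LevelSets

/-! ### Lie algebroids from anchors -/

section OfAnchor

variable {E : Type*} [NormedAddCommGroup E] [NormedSpace ℝ E] [FiniteDimensional ℝ E]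
  {H : Type*} [TopologicalSpace H]
  {I : ModelWithCorners ℝ E H} [I.Boundaryless] {M : Type*} [TopologicalSpace M] [ChartedSpace H M]
  [IsManifold I ∞ M] {r : ℕ}

theorem contMDiffAt_mlieBracket {X Y : ∀ x : M, TangentSpace I x} {x : M}
    (hX : ContMDiffAt I I.tangent ∞ (T% X) x) (hY : ContMDiffAt I I.tangent ∞ (T% Y) x) :
    ContMDiffAt I I.tangent ∞ (T% (VectorField.mlieBracket I X Y)) x := by
  have : CompleteSpace E := FiniteDimensional.complete ℝ E
  have : IsManifold I (minSmoothness ℝ 2) M := IsManifold.of_le (n := ∞) (by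
    rw [minSmoothness_of_isRCLikeNormedField]; exact ENat.LEInfty.out)
  have : IsManifold I (((⊤ : ℕ∞) : ℕ∞ω) + 1) M := inferInstanceAs (IsManifold I ∞ M)
  exact ContMDiffAt.mlieBracket_vectorField (m := ⊤) (n := ⊤) hX hY
    (by rw [minSmoothness_of_isRCLikeNormedField]; rfl)

variable (Fib : M → Type) [∀ x, AddCommGroup (Fib x)] [∀ x, Module ℝ (Fib x)]
  [∀ x, TopologicalSpace (Fib x)] [TopologicalSpace (TotalSpace (EuclideanSpace ℝ (Fin r)) Fib)]
  [FiberBundle (EuclideanSpace ℝ (Fin r)) Fib] [VectorBundle ℝ (EuclideanSpace ℝ (Fin r)) Fib]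
  [ContMDiffVectorBundle ∞ (EuclideanSpace ℝ (Fin r)) Fib I]

/-- A vector bundle with an anchor that is injective on sections and whose image on sections is
closed under the Lie bracket of vector fields is a Lie algebroid. -/
def LieAlgebroid.ofAnchor (ρ : ∀ x, Fib x →ₗ[ℝ] TangentSpace I x)
    (hρ : ContMDiff (I.prod 𝓘(ℝ, EuclideanSpace ℝ (Fin r))) I.tangent ∞
      (fun p : TotalSpace (EuclideanSpace ℝ (Fin r)) Fib => (⟨p.1, ρ p.1 p.2⟩ : TangentBundle I M)))
    (hinj : ∀ a b : Cₛ^∞⟮I; EuclideanSpace ℝ (Fin r), Fib⟯,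
      (∀ x, ρ x (a x) = ρ x (b x)) → a = b)
    (br : Cₛ^∞⟮I; EuclideanSpace ℝ (Fin r), Fib⟯ → Cₛ^∞⟮I; EuclideanSpace ℝ (Fin r), Fib⟯ →
      Cₛ^∞⟮I; EuclideanSpace ℝ (Fin r), Fib⟯)
    (hbr : ∀ a b x, ρ x (br a b x) =
        VectorField.mlieBracket I (fun y => ρ y (a y)) (fun y => ρ y (b y)) x) :
    LieAlgebroid I M r :=
  have hs : ∀ (a : Cₛ^∞⟮I; EuclideanSpace ℝ (Fin r), Fib⟯) (x : M),
      ContMDiffAt I I.tangent ∞ (T% fun y => ρ y (a y)) x := fun a =>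
    hρ.comp a.contMDiff
  have hm : ∀ (a : Cₛ^∞⟮I; EuclideanSpace ℝ (Fin r), Fib⟯) (x : M),
      MDifferentiableAt I I.tangent (T% fun y => ρ y (a y)) x := fun a x =>
    (hs a x).mdifferentiableAt (by simp)
  have hc : ∀ a b : Cₛ^∞⟮I; EuclideanSpace ℝ (Fin r), Fib⟯,
      (fun x => ρ x ((br a b) x)) =
        VectorField.mlieBracket I (fun y => ρ y (a y)) (fun y => ρ y (b y)) :=
    fun a b => funext (hbr a b)
  have hE : CompleteSpace E := FiniteDimensional.complete ℝ E
  have h3 : IsManifold I (minSmoothness ℝ 3) M := IsManifold.of_le (n := ∞) (by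
    rw [minSmoothness_of_isRCLikeNormedField]; exact ENat.LEInfty.out)
  have h2 : IsManifold I 2 M := IsManifold.of_le (n := ∞) ENat.LEInfty.out
  { Fib := Fib
    anchor := ρ
    contMDiff_anchor := hρ
    bracket := br
    bracket_add := fun a b c => hinj _ _ fun x => by
      refine (congrFun (hc a (b + c)) x).trans ?_
      have h1 : (fun y => ρ y ((b + c) y)) = (fun y => ρ y (b y)) + fun y => ρ y (c y) :=
        funext fun y => map_add _ _ _
      rw [h1, VectorField.mlieBracket_add_right (hm b x) (hm c x)]
      refine Eq.trans ?_ (map_add _ _ _).symm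
      rw [← congrFun (hc a b) x, ← congrFun (hc a c) x]
    bracket_smul := fun t a b => hinj _ _ fun x => by
      refine (congrFun (hc a (t • b)) x).trans ?_
      have h1 : (fun y => ρ y ((t • b) y)) = t • (fun y => ρ y (b y)) :=
        funext fun y => map_smul _ _ _
      rw [h1, VectorField.mlieBracket_const_smul_right (hm b x)]
      refine Eq.trans ?_ (map_smul _ _ _).symm
      rw [← congrFun (hc a b) x]
    bracket_antisymm := fun a b => hinj _ _ fun x => by
      refine (congrFun (hc a b) x).trans ?_
      rw [VectorField.mlieBracket_swap_apply, ← congrFun (hc b a) x]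
      exact (map_neg _ _).symm
    bracket_jacobi := fun a b c => hinj _ _ fun x => by
      refine (congrFun (hc _ _) x).trans ?_
      rw [hc b c, VectorField.leibniz_identity_mlieBracket_apply
        ((hs a x).of_le (by rw [minSmoothness_of_isRCLikeNormedField]; exact ENat.LEInfty.out))
        ((hs b x).of_le (by rw [minSmoothness_of_isRCLikeNormedField]; exact ENat.LEInfty.out))
        ((hs c x).of_le (by rw [minSmoothness_of_isRCLikeNormedField]; exact ENat.LEInfty.out)),
        ← hc a b, ← hc a c, ← congrFun (hc (br a b) c) x,
        ← congrFun (hc b (br a c)) x]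
      exact (map_add _ _ _).symm
    bracket_leibniz := fun f a b c h => by
      let d : Cₛ^∞⟮I; EuclideanSpace ℝ (Fin r), Fib⟯ :=
        ⟨fun x => dirDeriv f (ρ x (a x)) • b x, ContMDiff.smul_section
          (fun x => contMDiffAt_derivAlong (hs a x) (f.contMDiff x)) b.contMDiff⟩
      let d' : Cₛ^∞⟮I; EuclideanSpace ℝ (Fin r), Fib⟯ :=
        ⟨fun x => f x • (br a b) x, ContMDiff.smul_section
          f.contMDiff (br a b).contMDiff⟩
      have key : (br a c) = d' + d := hinj _ _ fun x => by
        refine (congrFun (hc a c) x).trans ?_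
        have h1 : (fun y => ρ y (c y)) = (f : M → ℝ) • (fun y => ρ y (b y)) :=
          funext fun y => by rw [h y]; exact map_smul _ _ _
        rw [h1, VectorField.mlieBracket_smul_right (f.contMDiff.mdifferentiableAt (by simp))
          (hm b x), ← congrFun (hc a b) x, add_comm]
        refine Eq.trans ?_ (map_add _ _ _).symm
        refine congrArg₂ (· + ·) (map_smul _ _ _).symm ?_
        exact (map_smul (ρ x) (dirDeriv f (ρ x (a x))) (b x)).symm
      intro x
      rw [key]
      rfl }

end OfAnchor

/-! ### Lie algebroids from atlases of frames -/

section FrameAtlas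

variable {E : Type*} [NormedAddCommGroup E] [NormedSpace ℝ E]
  {H : Type*} [TopologicalSpace H]
  {I : ModelWithCorners ℝ E H} {M : Type*} [TopologicalSpace M] [ChartedSpace H M]
  [IsManifold I ∞ M] {r : ℕ}
  {E' : Type*} [NormedAddCommGroup E'] [NormedSpace ℝ E']
  {H' : Type*} [TopologicalSpace H']
  {J : ModelWithCorners ℝ E' H'} {N : Type*} [TopologicalSpace N] [ChartedSpace H' N]

theorem contMDiffAt_sum_smul_comp {κ : Type*} [Fintype κ] {φ : N → M} {c : κ → N → ℝ}
    {X : κ → ∀ x : M, TangentSpace I x} {p : N} (hφ : ContMDiffAt J I ∞ φ p)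
    (hc : ∀ k, ContMDiffAt J 𝓘(ℝ, ℝ) ∞ (c k) p)
    (hX : ∀ k, ContMDiffAt I I.tangent ∞ (T% (X k)) (φ p)) :
    ContMDiffAt J I.tangent ∞
      (fun q => (⟨φ q, ∑ k, c k q • X k (φ q)⟩ : TangentBundle I M)) p := by
  have h := (contMDiffAt_totalSpace (IM := J) (IB := I) (F := E) (n := ∞)
    (E := (TangentSpace I : M → Type _))
    (f := fun q => (⟨φ q, ∑ k, c k q • X k (φ q)⟩ : TangentBundle I M)) (x₀ := p))
  refine h.2 ⟨hφ, ?_⟩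
  set e := trivializationAt E (TangentSpace I : M → Type _) (φ p)
  have hmem : ∀ᶠ q in 𝓝 p, φ q ∈ e.baseSet := hφ.continuousAt
    (e.open_baseSet.mem_nhds (mem_baseSet_trivializationAt E (TangentSpace I : M → Type _) (φ p)))
  have h1 : ContMDiffAt J 𝓘(ℝ, E) ∞ (fun q => ∑ k, c k q • (e ⟨φ q, X k (φ q)⟩).2) p := by
    refine ContMDiffAt.sum fun k _ => (hc k).smul ?_
    exact ((contMDiffAt_section (φ p)).1 (hX k)).comp p hφ
  refine h1.congr_of_eventuallyEq ?_
  filter_upwards [hmem] with q hq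
  have h2 : ∀ v : TangentSpace I (φ q), (e ⟨φ q, v⟩).2 = e.continuousLinearMapAt ℝ (φ q) v := by
    intro v
    rw [Trivialization.continuousLinearMapAt_apply, e.coe_linearMapAt_of_mem hq]
  simp only [h2, map_sum, map_smul]

theorem contMDiffAt_sum_smul {κ : Type*} [Fintype κ] {c : κ → M → ℝ}
    {X : κ → ∀ x : M, TangentSpace I x} {x : M} (hc : ∀ k, ContMDiffAt I 𝓘(ℝ, ℝ) ∞ (c k) x)
    (hX : ∀ k, ContMDiffAt I I.tangent ∞ (T% (X k)) x) :
    ContMDiffAt I I.tangent ∞ (T% fun y => ∑ k, c k y • X k y) x :=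
  contMDiffAt_sum_smul_comp contMDiffAt_id hc hX

/-- A cocycle together with local vector fields that transform like the corresponding frames. -/
structure FrameAtlas (I : ModelWithCorners ℝ E H) (M : Type*) [TopologicalSpace M]
    [ChartedSpace H M] [IsManifold I ∞ M] (r : ℕ) (ι : Type*) where
  core : VectorBundleCore ℝ M (EuclideanSpace ℝ (Fin r)) ι
  isContMDiff : core.IsContMDiff I ∞
  frame : ι → Fin r → ∀ x : M, TangentSpace I x
  contMDiffAt_frame : ∀ i k x, x ∈ core.baseSet i → ContMDiffAt I I.tangent ∞ (T% (frame i k)) x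
  frame_coordChange : ∀ i j x (v : EuclideanSpace ℝ (Fin r)),
    x ∈ core.baseSet i → x ∈ core.baseSet j →
      ∑ l, core.coordChange i j x v l • frame j l x = ∑ k, v k • frame i k x

namespace FrameAtlas

variable {ι : Type*} (Z : FrameAtlas I M r ι)

attribute [instance] isContMDiff

instance (i : ι) : MemTrivializationAtlas (Z.core.localTriv i) := ⟨⟨i, rfl⟩⟩

/-- The vector field with given coefficients in the frame `i`. -/
def combine (i : ι) (x : M) : EuclideanSpace ℝ (Fin r) →ₗ[ℝ] TangentSpace I x where
  toFun v := ∑ k, v k • Z.frame i k x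
  map_add' v w := by simp [add_smul, Finset.sum_add_distrib]
  map_smul' c v := by simp [mul_smul, Finset.smul_sum]

/-- The map to the tangent bundle given by the frames. -/
def anchor (x : M) : Z.core.Fiber x →ₗ[ℝ] TangentSpace I x :=
  Z.combine (Z.core.indexAt x) x

theorem anchor_eq {i : ι} (p : TotalSpace (EuclideanSpace ℝ (Fin r)) Z.core.Fiber)
    (hp : p.1 ∈ Z.core.baseSet i) :
    Z.anchor p.1 p.2 = Z.combine i p.1 (Z.core.localTriv i p).2 :=
  (Z.frame_coordChange (Z.core.indexAt p.1) i p.1 p.2 (Z.core.mem_baseSet_at p.1) hp).symm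

theorem contMDiff_anchor : ContMDiff (I.prod 𝓘(ℝ, EuclideanSpace ℝ (Fin r))) I.tangent ∞
    (fun p : TotalSpace (EuclideanSpace ℝ (Fin r)) Z.core.Fiber =>
      (⟨p.1, Z.anchor p.1 p.2⟩ : TangentBundle I M)) := by
  intro p
  set i := Z.core.indexAt p.1
  have hi : p.1 ∈ Z.core.baseSet i := Z.core.mem_baseSet_at p.1
  have hproj := Bundle.contMDiffAt_proj (IB := I) (F := EuclideanSpace ℝ (Fin r)) (n := ∞)
    Z.core.Fiber (p := p)
  have h1 : ContMDiffAt (I.prod 𝓘(ℝ, EuclideanSpace ℝ (Fin r))) 𝓘(ℝ, EuclideanSpace ℝ (Fin r)) ∞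
      (fun q => (Z.core.localTriv i q).2) p := by
    have h2 := (Z.core.localTriv i).contMDiffOn (IB := I) (n := ∞)
    exact (h2.contMDiffAt ((Z.core.localTriv i).open_source.mem_nhds
      ((Z.core.mem_localTriv_source i p).2 hi))).snd
  refine (contMDiffAt_sum_smul_comp hproj
    (fun k => ((EuclideanSpace.proj k : EuclideanSpace ℝ (Fin r) →L[ℝ] ℝ).contMDiff.contMDiffAt).comp
      p h1) (fun k => Z.contMDiffAt_frame i k p.1 hi)).congr_of_eventuallyEq ?_
  filter_upwards [hproj.continuousAt ((Z.core.isOpen_baseSet i).mem_nhds hi)] with q hq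
  rw [Z.anchor_eq q hq]
  rfl

/-- The sections of the vector bundle of an atlas of frames. -/
abbrev Sections : Type _ := Cₛ^∞⟮I; EuclideanSpace ℝ (Fin r), Z.core.Fiber⟯

theorem contMDiffAt_section_iff {a : ∀ x, Z.core.Fiber x} {i : ι} {x : M}
    (hx : x ∈ Z.core.baseSet i) :
    ContMDiffAt I (I.prod 𝓘(ℝ, EuclideanSpace ℝ (Fin r))) ∞
      (fun x => TotalSpace.mk' (EuclideanSpace ℝ (Fin r)) x (a x)) x ↔
    ContMDiffAt I 𝓘(ℝ, EuclideanSpace ℝ (Fin r)) ∞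
      (fun x => (Z.core.coordChange (Z.core.indexAt x) i x (a x) : EuclideanSpace ℝ (Fin r))) x :=
  (Z.core.localTriv i).contMDiffAt_section_iff hx

theorem exists_section {b : ι → M → EuclideanSpace ℝ (Fin r)}
    (hb : ∀ i, ∀ x ∈ Z.core.baseSet i, ContMDiffAt I 𝓘(ℝ, EuclideanSpace ℝ (Fin r)) ∞ (b i) x)
    (hc : ∀ i j x, x ∈ Z.core.baseSet i → x ∈ Z.core.baseSet j →
      Z.core.coordChange i j x (b i x) = b j x) :
    ∃ a : Z.Sections, ∀ x, a x = b (Z.core.indexAt x) x := by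
  refine ⟨⟨fun x => b (Z.core.indexAt x) x, fun x => ?_⟩, fun _ => rfl⟩
  have hx := Z.core.mem_baseSet_at x
  refine (Z.contMDiffAt_section_iff (a := fun x => b (Z.core.indexAt x) x) hx).2 ?_
  refine (hb _ x hx).congr_of_eventuallyEq ?_
  filter_upwards [(Z.core.isOpen_baseSet _).mem_nhds hx] with y hy
  exact hc _ _ y (Z.core.mem_baseSet_at y) hy

theorem contMDiffAt_anchor (a : Z.Sections) (x : M) :
    ContMDiffAt I I.tangent ∞ (T% fun y => Z.anchor y (a y)) x :=
  (Z.contMDiff_anchor.comp a.contMDiff) x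

/-- The vector field given by a section. -/
def field (a : Z.Sections) : SmoothVectorField I M :=
  ⟨fun x => Z.anchor x (a x), fun x => Z.contMDiffAt_anchor a x⟩

/-- The Lie algebroid of an atlas of frames. -/
def toLieAlgebroid [FiniteDimensional ℝ E] [I.Boundaryless]
    (hinj : ∀ a b : Z.Sections, (∀ x, Z.anchor x (a x) = Z.anchor x (b x)) → a = b)
    (br : Z.Sections → Z.Sections → Z.Sections)
    (hbr : ∀ a b x, Z.anchor x (br a b x) =
      VectorField.mlieBracket I (fun y => Z.anchor y (a y)) (fun y => Z.anchor y (b y)) x) :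
    LieAlgebroid I M r :=
  LieAlgebroid.ofAnchor Z.core.Fiber Z.anchor Z.contMDiff_anchor hinj br hbr

end FrameAtlas

end FrameAtlas

/-! ### Brackets of combinations of sections -/

section Bracket

variable {E : Type*} [NormedAddCommGroup E] [NormedSpace ℝ E]
  {H : Type*} [TopologicalSpace H]
  {I : ModelWithCorners ℝ E H} {M : Type*} [TopologicalSpace M] [ChartedSpace H M]
  [IsManifold I ∞ M] {r : ℕ}

namespace LieAlgebroid

variable (A : LieAlgebroid I M r)

/-- The product of a function and a section. -/
def smulSection (f : C^∞⟮I, M; ℝ⟯) (a : A.Sections) : A.Sections :=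
  ⟨fun x => f x • a x, ContMDiff.smul_section f.contMDiff a.contMDiff⟩

theorem sum_section_apply {κ : Type*} (s : Finset κ) (a : κ → A.Sections) (x : M) :
    (∑ i ∈ s, a i) x = ∑ i ∈ s, a i x := by
  have h := map_sum (ContMDiffSection.coeAddHom I (EuclideanSpace ℝ (Fin r)) ∞ A.Fib) a s
  have h1 := congrFun h x
  rw [Finset.sum_apply] at h1
  exact h1

theorem bracket_zero (a : A.Sections) : A.bracket a 0 = 0 := by
  have := A.bracket_smul 0 a 0
  rwa [zero_smul, zero_smul] at this

theorem bracket_sum_right (a : A.Sections) {κ : Type*} (s : Finset κ) (b : κ → A.Sections) :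
    A.bracket a (∑ i ∈ s, b i) = ∑ i ∈ s, A.bracket a (b i) := by
  classical
  induction s using Finset.induction_on with
  | empty => simp [A.bracket_zero]
  | insert i s hi ih => rw [Finset.sum_insert hi, Finset.sum_insert hi, A.bracket_add, ih]

theorem bracket_combination_right {l : ℕ} (u v : A.Sections) (g : Fin l → C^∞⟮I, M; ℝ⟯)
    (b : Fin l → A.Sections) (hv : ∀ p, v p = ∑ j, g j p • b j p) (p : M) :
    A.bracket u v p =
      ∑ j, (g j p • A.bracket u (b j) p + dirDeriv (g j) (A.anchor p (u p)) • b j p) := by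
  have h1 : v = ∑ j, A.smulSection (g j) (b j) := by
    ext p
    rw [hv, A.sum_section_apply]
    rfl
  rw [h1, A.bracket_sum_right, A.sum_section_apply]
  exact Finset.sum_congr rfl fun j _ => A.bracket_leibniz (g j) u (b j) _ (fun _ => rfl) p

theorem bracket_antisymm_apply (u v : A.Sections) (p : M) :
    A.bracket u v p = - A.bracket v u p := by
  rw [A.bracket_antisymm u v]
  rfl

theorem bracket_combination {k l : ℕ} (u v : A.Sections) (f : Fin k → C^∞⟮I, M; ℝ⟯)
    (a : Fin k → A.Sections) (g : Fin l → C^∞⟮I, M; ℝ⟯) (b : Fin l → A.Sections)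
    (hu : ∀ p, u p = ∑ i, f i p • a i p) (hv : ∀ p, v p = ∑ j, g j p • b j p) (p : M) :
    A.bracket u v p = ∑ i, ∑ j, (f i p * g j p) • A.bracket (a i) (b j) p
      + ∑ j, dirDeriv (g j) (A.anchor p (u p)) • b j p
      - ∑ i, dirDeriv (f i) (A.anchor p (v p)) • a i p := by
  have h1 : ∀ j, A.bracket u (b j) p = ∑ i, (f i p • A.bracket (a i) (b j) p
      - dirDeriv (f i) (A.anchor p (b j p)) • a i p) := by
    intro j
    rw [A.bracket_antisymm_apply, A.bracket_combination_right (b j) u f a hu, ← Finset.sum_neg_distrib]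
    refine Finset.sum_congr rfl fun i _ => ?_
    rw [A.bracket_antisymm_apply (a i) (b j), smul_neg]
    abel
  have h2 : ∀ i, dirDeriv (f i) (A.anchor p (v p)) =
      ∑ j, g j p * dirDeriv (f i) (A.anchor p (b j p)) := by
    intro i
    rw [hv, map_sum]
    have h3 : ∀ w : TangentSpace I p, dirDeriv (f i) w = dAt I (f i) p w := fun _ => rfl
    simp only [h3, map_sum, map_smul, smul_eq_mul]
  rw [A.bracket_combination_right u v g b hv, Finset.sum_add_distrib, add_sub_right_comm]
  congr 1
  simp only [h1, h2, Finset.smul_sum, Finset.sum_smul]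
  rw [Finset.sum_comm, ← Finset.sum_sub_distrib]
  refine Finset.sum_congr rfl fun i _ => ?_
  rw [← Finset.sum_sub_distrib]
  refine Finset.sum_congr rfl fun j _ => ?_
  rw [smul_sub, smul_smul, smul_smul, mul_comm (g j p)]

end LieAlgebroid

end Bracket

/-! ### Frames and continuity arguments -/

section Frames

variable {E : Type*} [NormedAddCommGroup E] [NormedSpace ℝ E] [FiniteDimensional ℝ E]
  {H : Type*} [TopologicalSpace H]
  {I : ModelWithCorners ℝ E H} {M : Type*} [TopologicalSpace M] [ChartedSpace H M]
  [IsManifold I ∞ M] {r : ℕ}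

theorem eq_of_frequently_eq {V W : ∀ x : M, TangentSpace I x} {x : M}
    (hV : ContMDiffAt I I.tangent ∞ (T% V) x) (hW : ContMDiffAt I I.tangent ∞ (T% W) x)
    (h : ∃ᶠ y in 𝓝 x, V y = W y) : V x = W x := by
  set e := trivializationAt E (TangentSpace I : M → Type _) x
  have h1 := ((contMDiffAt_section x).1 hV).continuousAt
  have h2 := ((contMDiffAt_section x).1 hW).continuousAt
  have h3 : (e ⟨x, V x⟩).2 = (e ⟨x, W x⟩).2 :=
    tendsto_nhds_unique_of_frequently_eq h1 h2 (h.mono fun y hy => by rw [hy])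
  have hx : x ∈ e.baseSet := mem_baseSet_trivializationAt E (TangentSpace I : M → Type _) x
  exact (e.continuousLinearEquivAt ℝ x hx).injective h3

/-- The coefficients of a smooth vector field in a smooth frame are smooth. -/
theorem contMDiffAt_coefficients {Y : Fin r → ∀ x : M, TangentSpace I x}
    {Z : ∀ x : M, TangentSpace I x} {b : M → EuclideanSpace ℝ (Fin r)} {x : M}
    (hY : ∀ k, ContMDiffAt I I.tangent ∞ (T% (Y k)) x) (hZ : ContMDiffAt I I.tangent ∞ (T% Z) x)
    (hli : LinearIndependent ℝ fun k => Y k x)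
    (hb : ∀ᶠ y in 𝓝 x, Z y = ∑ k, b y k • Y k y) :
    ContMDiffAt I 𝓘(ℝ, EuclideanSpace ℝ (Fin r)) ∞ b x := by
  set e := trivializationAt E (TangentSpace I : M → Type _) x
  have hx : x ∈ e.baseSet := mem_baseSet_trivializationAt E (TangentSpace I : M → Type _) x
  have hYe := fun k => (contMDiffAt_section x).1 (hY k)
  have hZe := (contMDiffAt_section x).1 hZ
  let A : M → EuclideanSpace ℝ (Fin r) →L[ℝ] E := fun y =>
    ∑ k, (EuclideanSpace.proj k : EuclideanSpace ℝ (Fin r) →L[ℝ] ℝ).smulRight (e ⟨y, Y k y⟩).2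
  have hAapp : ∀ y v, A y v = ∑ k, v k • (e ⟨y, Y k y⟩).2 := by
    intro y v
    simp [A]
  have hA : ContMDiffAt I 𝓘(ℝ, EuclideanSpace ℝ (Fin r) →L[ℝ] E) ∞ A x :=
    ContMDiffAt.sum fun k _ => ((ContinuousLinearMap.smulRightL ℝ (EuclideanSpace ℝ (Fin r)) E
      (EuclideanSpace.proj k)).contMDiff.contMDiffAt).comp x (hYe k)
  have hAinj : Function.Injective (A x) := by
    rw [injective_iff_map_eq_zero]
    intro v hv
    rw [hAapp] at hv
    have h1 : e.continuousLinearEquivAt ℝ x hx (∑ k, v k • Y k x) = 0 := by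
      rw [map_sum]
      simp only [map_smul]
      exact hv
    have h2 := (e.continuousLinearEquivAt ℝ x hx).map_eq_zero_iff.1 h1
    ext k
    exact Fintype.linearIndependent_iff.1 hli _ h2 k
  obtain ⟨P, hP⟩ := (A x).toLinearMap.exists_leftInverse_of_injective (LinearMap.ker_eq_bot.2 hAinj)
  let P' : E →L[ℝ] EuclideanSpace ℝ (Fin r) := P.toContinuousLinearMap
  let B : M → EuclideanSpace ℝ (Fin r) →L[ℝ] EuclideanSpace ℝ (Fin r) := fun y => P'.comp (A y)
  have hB : ContMDiffAt I 𝓘(ℝ, EuclideanSpace ℝ (Fin r) →L[ℝ] EuclideanSpace ℝ (Fin r)) ∞ B x :=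
    contMDiffAt_const.clm_comp hA
  have hBx : B x = (ContinuousLinearEquiv.refl ℝ (EuclideanSpace ℝ (Fin r)) :
      EuclideanSpace ℝ (Fin r) →L[ℝ] EuclideanSpace ℝ (Fin r)) := by
    ext1 v
    exact congrArg (fun L : EuclideanSpace ℝ (Fin r) →ₗ[ℝ] EuclideanSpace ℝ (Fin r) => L v) hP
  have hinv : ContMDiffAt I 𝓘(ℝ, EuclideanSpace ℝ (Fin r) →L[ℝ] EuclideanSpace ℝ (Fin r)) ∞
      (fun y => (B y).inverse) x := by
    have h1 : ContDiffAt ℝ ∞ (ContinuousLinearMap.inverse :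
        (EuclideanSpace ℝ (Fin r) →L[ℝ] EuclideanSpace ℝ (Fin r)) → _) (B x) := by
      rw [hBx]
      exact contDiffAt_map_inverse _
    exact h1.contMDiffAt.comp x hB
  have hBo : ∀ᶠ y in 𝓝 x, (B y).IsInvertible := hB.continuousAt
    ((ContinuousLinearEquiv.isOpen (𝕜 := ℝ) (E := EuclideanSpace ℝ (Fin r))
      (F := EuclideanSpace ℝ (Fin r))).mem_nhds ⟨ContinuousLinearEquiv.refl ℝ _, hBx.symm⟩)
  refine ContMDiffAt.congr_of_eventuallyEq (hinv.clm_apply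
    ((P'.contMDiff.contMDiffAt).comp x hZe)) ?_
  filter_upwards [hb, hBo, e.open_baseSet.mem_nhds hx] with y hy hyi hye
  have h1 : A y (b y) = (e ⟨y, Z y⟩).2 := by
    have h2 : ∀ v : TangentSpace I y, (e ⟨y, v⟩).2 = e.continuousLinearMapAt ℝ y v := by
      intro v
      rw [Trivialization.continuousLinearMapAt_apply, e.coe_linearMapAt_of_mem hye]
    rw [hAapp, hy]
    simp only [h2, map_sum, map_smul]
  change b y = (B y).inverse (P' (e ⟨y, Z y⟩).2)
  rw [← h1]
  exact (hyi.inverse_apply_self (b y)).symm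

end Frames

/-! ### Related vector fields -/

section Related

variable {E : Type*} [NormedAddCommGroup E] [NormedSpace ℝ E] [FiniteDimensional ℝ E]
  {H : Type*} [TopologicalSpace H]
  {I : ModelWithCorners ℝ E H} [I.Boundaryless] {M : Type*} [TopologicalSpace M] [ChartedSpace H M]
  [IsManifold I ∞ M]
  {E' : Type*} [NormedAddCommGroup E'] [NormedSpace ℝ E'] [FiniteDimensional ℝ E']
  {H' : Type*} [TopologicalSpace H']
  {J : ModelWithCorners ℝ E' H'} [J.Boundaryless] {N : Type*} [TopologicalSpace N]
  [ChartedSpace H' N] [IsManifold J ∞ N]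

/-- Brackets of related vector fields are related. -/
theorem mfderiv_mlieBracket_of_related {φ : N → M} (hφ : ContMDiff J I ∞ φ)
    {V W : SmoothVectorField J N} {X Y : SmoothVectorField I M}
    (hV : ∀ p, mfderiv J I φ p (V p) = X (φ p)) (hW : ∀ p, mfderiv J I φ p (W p) = Y (φ p)) (p : N) :
    mfderiv J I φ p (VectorField.mlieBracket J V W p) = VectorField.mlieBracket I X Y (φ p) := by
  have hc : ContMDiffOn I 𝓘(ℝ, E) ∞ (extChartAt I (φ p)) (chartAt H (φ p)).source :=
    contMDiffOn_extChartAt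
  have hso := (chartAt H (φ p)).open_source
  have hs := mem_chart_source H (φ p)
  have hd : ∀ᶠ q in 𝓝 p, ContMDiffAt I 𝓘(ℝ, E) ∞ (extChartAt I (φ p)) (φ q) := by
    filter_upwards [hφ.continuous.continuousAt (hso.mem_nhds hs)] with q hq
    exact hc.contMDiffAt (hso.mem_nhds hq)
  have hfd := hd.self_of_nhds
  have rel : ∀ {Q : SmoothVectorField J N} {R : SmoothVectorField I M}
      (_ : ∀ p, mfderiv J I φ p (Q p) = R (φ p)) {g : M → E} {q : N}
      (_ : MDifferentiableAt I 𝓘(ℝ, E) g (φ q)),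
      derivAlong J (fun q => Q q) (fun q => g (φ q)) q = derivAlong I (fun x => R x) g (φ q) := by
    intro Q R h g q hg
    refine (dAt_comp hg (hφ.mdifferentiableAt (by simp)) _).trans ?_
    rw [h q]
    rfl
  have hfφ : ContMDiffAt J 𝓘(ℝ, E) ∞ (fun q => extChartAt I (φ p) (φ q)) p := hfd.comp p (hφ p)
  have h1 := mfderiv_mlieBracket (V.contMDiffAt p) (W.contMDiffAt p) hfφ
  have h2 := mfderiv_mlieBracket (X.contMDiffAt (φ p)) (Y.contMDiffAt (φ p)) hfd
  have step : ∀ {Q Q' : SmoothVectorField J N} {R R' : SmoothVectorField I M}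
      (_ : ∀ p, mfderiv J I φ p (Q p) = R (φ p)) (_ : ∀ p, mfderiv J I φ p (Q' p) = R' (φ p)),
      derivAlong J (fun q => Q q) (derivAlong J (fun q => Q' q)
        (fun q => extChartAt I (φ p) (φ q))) p =
      derivAlong I (fun q => R q) (derivAlong I (fun q => R' q) (extChartAt I (φ p))) (φ p) := by
    intro Q Q' R R' h h'
    refine (dAt_congr ?_ _).trans (rel (g := derivAlong I (fun q => R' q) (extChartAt I (φ p))) h
      ((contMDiffAt_derivAlong (R'.contMDiffAt (φ p)) hfd).mdifferentiableAt (by simp)))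
    filter_upwards [hd] with q hq
    exact rel h' (hq.mdifferentiableAt (by simp))
  rw [step hV hW, step hW hV, ← h2] at h1
  have h3 := (dAt_comp (hfd.mdifferentiableAt (by simp)) (hφ.mdifferentiableAt (by simp))
    (VectorField.mlieBracket J V W p)).symm.trans h1
  exact (isInvertible_mfderiv_extChartAt (mem_extChartAt_source (I := I) (φ p))).injective h3

end Related

/-! ### Regularisation of a module of vector fields by a distribution -/

section Regularisation

variable {E : Type*} [NormedAddCommGroup E] [NormedSpace ℝ E] [FiniteDimensional ℝ E]
  {H : Type*} [TopologicalSpace H]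
  {I : ModelWithCorners ℝ E H} [I.Boundaryless] {M : Type*} [TopologicalSpace M] [ChartedSpace H M]
  [IsManifold I ∞ M]
  {E' : Type*} [NormedAddCommGroup E'] [NormedSpace ℝ E'] [FiniteDimensional ℝ E']
  {H' : Type*} [TopologicalSpace H']
  {J : ModelWithCorners ℝ E' H'} [J.Boundaryless] {N : Type*} [TopologicalSpace N]
  [ChartedSpace H' N] [IsManifold J ∞ N] {r : ℕ}

/-- `Y` is tangent to `F` and `φ`-related to `X`. -/
def IsLift (φ : N → M) (F : ∀ p : N, Submodule ℝ (TangentSpace J p)) (Y : SmoothVectorField J N)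
    (X : SmoothVectorField I M) : Prop :=
  ∀ p, Y p ∈ F p ∧ mfderiv J I φ p (Y p) = X (φ p)

variable (I J) in
/-- The vector fields in `𝔛` are the sections of a vector bundle whose pull-back along `φ` is the
distribution `F`. -/
structure IsRegularisation (φ : N → M) (F : ∀ p : N, Submodule ℝ (TangentSpace J p))
    (𝔛 : Set (SmoothVectorField I M)) (r : ℕ) : Prop where
  contMDiff : ContMDiff J I ∞ φ
  surjective : Function.Surjective φ
  surjective_mfderiv : ∀ p, Function.Surjective (mfderiv J I φ p)
  finrank_eq : ∀ p, Module.finrank ℝ (F p) = r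
  involutive : ∀ X Y : SmoothVectorField J N, (∀ y, X y ∈ F y) → (∀ y, Y y ∈ F y) →
    ∀ y, VectorField.mlieBracket J X Y y ∈ F y
  dense : Dense {p | ∀ v ∈ F p, mfderiv J I φ p v = 0 → v = 0}
  exists_isLift : ∀ X ∈ 𝔛, ∃ Y : SmoothVectorField J N, IsLift φ F Y X
  exists_frame : ∀ x₀ : M, ∃ U : Set M, IsOpen U ∧ x₀ ∈ U ∧ ∃ X : Fin r → SmoothVectorField I M,
    (∀ k, X k ∈ 𝔛) ∧
    (∀ Z ∈ 𝔛, ∃ a : M → EuclideanSpace ℝ (Fin r),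
      (∀ x ∈ U, ContMDiffAt I 𝓘(ℝ, EuclideanSpace ℝ (Fin r)) ∞ a x) ∧
      ∀ x ∈ U, Z x = ∑ k, a x k • X k x) ∧
    ∀ Y : Fin r → SmoothVectorField J N, (∀ k, IsLift φ F (Y k) (X k)) →
      ∀ p, φ p ∈ U → LinearIndependent ℝ fun k => Y k p
  mem_of_locally : ∀ Z : SmoothVectorField I M, (∀ x₀, ∃ X : Fin r → SmoothVectorField I M,
    (∀ k, X k ∈ 𝔛) ∧ ∃ a : M → EuclideanSpace ℝ (Fin r),
      ContMDiffAt I 𝓘(ℝ, EuclideanSpace ℝ (Fin r)) ∞ a x₀ ∧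
      ∀ᶠ x in 𝓝 x₀, Z x = ∑ k, a x k • X k x) → Z ∈ 𝔛
  bracket_mem : ∀ X ∈ 𝔛, ∀ Y ∈ 𝔛, ∀ Z : SmoothVectorField I M,
    (∀ x, Z x = VectorField.mlieBracket I X Y x) → Z ∈ 𝔛

variable (r) in
/-- The linear endomorphism with a given matrix. -/
def matrixCLM (c : Fin r → EuclideanSpace ℝ (Fin r)) :
    EuclideanSpace ℝ (Fin r) →L[ℝ] EuclideanSpace ℝ (Fin r) :=
  ∑ k, (EuclideanSpace.proj k : EuclideanSpace ℝ (Fin r) →L[ℝ] ℝ).smulRight (c k)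

theorem matrixCLM_apply (c : Fin r → EuclideanSpace ℝ (Fin r)) (v : EuclideanSpace ℝ (Fin r)) :
    matrixCLM r c v = ∑ k, v k • c k := by
  simp [matrixCLM]

theorem contMDiffAt_matrixCLM {c : Fin r → M → EuclideanSpace ℝ (Fin r)} {x : M}
    (hc : ∀ k, ContMDiffAt I 𝓘(ℝ, EuclideanSpace ℝ (Fin r)) ∞ (c k) x) :
    ContMDiffAt I 𝓘(ℝ, EuclideanSpace ℝ (Fin r) →L[ℝ] EuclideanSpace ℝ (Fin r)) ∞
      (fun y => matrixCLM r fun k => c k y) x :=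
  ContMDiffAt.sum fun k _ =>
    ((ContinuousLinearMap.smulRightL ℝ (EuclideanSpace ℝ (Fin r)) (EuclideanSpace ℝ (Fin r))
      (EuclideanSpace.proj k)).contMDiff.contMDiffAt).comp x (hc k)

theorem sum_matrixCLM_smul {V : Type*} [AddCommGroup V] [Module ℝ V]
    (c : Fin r → EuclideanSpace ℝ (Fin r)) (v : EuclideanSpace ℝ (Fin r)) (Y : Fin r → V) :
    ∑ l, matrixCLM r c v l • Y l = ∑ k, v k • ∑ l, c k l • Y l := by
  simp only [matrixCLM_apply, Finset.smul_sum, smul_smul]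
  rw [Finset.sum_comm]
  refine Finset.sum_congr rfl fun l _ => ?_
  rw [← Finset.sum_smul]
  congr 1
  simp

theorem contMDiffAt_euclidean_apply {b : M → EuclideanSpace ℝ (Fin r)} {x : M}
    (hb : ContMDiffAt I 𝓘(ℝ, EuclideanSpace ℝ (Fin r)) ∞ b x) (k : Fin r) :
    ContMDiffAt I 𝓘(ℝ, ℝ) ∞ (fun y => b y k) x :=
  ((EuclideanSpace.proj k : EuclideanSpace ℝ (Fin r) →L[ℝ] ℝ).contMDiff.contMDiffAt).comp x hb

/-- Vector fields tangent to `F` with the same image agree, if `F` is generically transverse to the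
fibres. -/
theorem eq_of_mfderiv_eq_of_dense {φ : N → M} {F : ∀ p : N, Submodule ℝ (TangentSpace J p)}
    (hd : Dense {p | ∀ v ∈ F p, mfderiv J I φ p v = 0 → v = 0}) {V W : ∀ p : N, TangentSpace J p}
    {p : N} (hV : ContMDiffAt J J.tangent ∞ (T% V) p) (hW : ContMDiffAt J J.tangent ∞ (T% W) p)
    (he : ∀ᶠ q in 𝓝 p, V q ∈ F q ∧ W q ∈ F q ∧
      (mfderiv J I φ q (V q) : TangentSpace I (φ q)) = mfderiv J I φ q (W q)) : V p = W p := by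
  refine eq_of_frequently_eq hV hW ?_
  refine ((mem_closure_iff_frequently.1 (hd p)).and_eventually he).mono ?_
  rintro q ⟨hq, h1, h2, h3⟩
  refine sub_eq_zero.1 (hq _ ((F q).sub_mem h1 h2) ?_)
  rw [map_sub, h3, sub_self]

namespace IsRegularisation

variable {φ : N → M} {F : ∀ p : N, Submodule ℝ (TangentSpace J p)}
  {𝔛 : Set (SmoothVectorField I M)} (h : IsRegularisation I J φ F 𝔛 r)

include h

theorem coefficients_unique {x : M} {X : Fin r → SmoothVectorField I M}
    {Y : Fin r → SmoothVectorField J N} {U : Set M} (hU : IsOpen U) (hx : x ∈ U)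
    (hY : ∀ k, IsLift φ F (Y k) (X k))
    (hli : ∀ p, φ p ∈ U → LinearIndependent ℝ fun k => Y k p)
    {b b' : M → EuclideanSpace ℝ (Fin r)} (hb : ContinuousAt b x) (hb' : ContinuousAt b' x)
    (he : ∀ᶠ y in 𝓝 x, ∑ k, b y k • X k y = ∑ k, b' y k • X k y) : b x = b' x := by
  have hd : Dense (φ '' {p | ∀ v ∈ F p, mfderiv J I φ p v = 0 → v = 0}) :=
    h.surjective.denseRange.dense_image h.contMDiff.continuous h.dense
  refine tendsto_nhds_unique_of_frequently_eq hb hb'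
    (((mem_closure_iff_frequently.1 (hd x)).and_eventually
      (he.and (hU.mem_nhds hx))).mono ?_)
  rintro _ ⟨⟨p, hp, rfl⟩, h1, h2⟩
  have h3 : ∑ k, (b (φ p) k - b' (φ p) k) • Y k p = 0 := by
    refine hp _ (Submodule.sum_mem _ fun k _ => Submodule.smul_mem _ _ (hY k p).1) ?_
    rw [map_sum]
    simp only [map_smul, (hY _ p).2]
    simp only [sub_smul, Finset.sum_sub_distrib, h1, sub_self]
  ext k
  exact sub_eq_zero.1 (Fintype.linearIndependent_iff.1 (hli p h2) _ h3 k)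

end IsRegularisation

/-- Frames of `𝔛` over the sets of an open cover, with lifts. -/
structure RegularisationFrames (φ : N → M) (F : ∀ p : N, Submodule ℝ (TangentSpace J p))
    (𝔛 : Set (SmoothVectorField I M)) (r : ℕ) where
  isReg : IsRegularisation I J φ F 𝔛 r
  U : M → Set M
  isOpen_U : ∀ i, IsOpen (U i)
  mem_U : ∀ i, i ∈ U i
  X : M → Fin r → SmoothVectorField I M
  X_mem : ∀ i k, X i k ∈ 𝔛
  Y : M → Fin r → SmoothVectorField J N
  isLift : ∀ i k, IsLift φ F (Y i k) (X i k)
  coeff : M → SmoothVectorField I M → M → EuclideanSpace ℝ (Fin r)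
  contMDiffAt_coeff : ∀ i, ∀ Z ∈ 𝔛, ∀ x ∈ U i,
    ContMDiffAt I 𝓘(ℝ, EuclideanSpace ℝ (Fin r)) ∞ (coeff i Z) x
  eq_sum : ∀ i, ∀ Z ∈ 𝔛, ∀ x ∈ U i, Z x = ∑ k, coeff i Z x k • X i k x
  linearIndependent : ∀ i p, φ p ∈ U i → LinearIndependent ℝ fun k => Y i k p

theorem IsRegularisation.nonempty_frames {φ : N → M} {F : ∀ p : N, Submodule ℝ (TangentSpace J p)}
    {𝔛 : Set (SmoothVectorField I M)} (h : IsRegularisation I J φ F 𝔛 r) :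
    Nonempty (RegularisationFrames φ F 𝔛 r) := by
  classical
  choose U hUo hU X hX hZ hli using h.exists_frame
  choose Y hY using fun i k => h.exists_isLift (X i k) (hX i k)
  choose a ha ha' using hZ
  refine ⟨⟨h, U, hUo, hU, X, hX, Y, hY, fun i Z => if hZ : Z ∈ 𝔛 then a i Z hZ else 0, ?_, ?_,
    fun i p hp => hli i (Y i) (hY i) p hp⟩⟩
  · intro i Z hZ x hx
    rw [dif_pos hZ]
    exact ha i Z hZ x hx
  · intro i Z hZ x hx
    rw [dif_pos hZ]
    exact ha' i Z hZ x hx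

namespace RegularisationFrames

variable {φ : N → M} {F : ∀ p : N, Submodule ℝ (TangentSpace J p)}
  {𝔛 : Set (SmoothVectorField I M)} (R : RegularisationFrames φ F 𝔛 r)

/-- The change of frames. -/
def change (i j x : M) : EuclideanSpace ℝ (Fin r) →L[ℝ] EuclideanSpace ℝ (Fin r) :=
  matrixCLM r fun k => R.coeff j (R.X i k) x

theorem contMDiffAt_change {i j x : M} (hj : x ∈ R.U j) :
    ContMDiffAt I 𝓘(ℝ, EuclideanSpace ℝ (Fin r) →L[ℝ] EuclideanSpace ℝ (Fin r)) ∞ (R.change i j) x :=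
  contMDiffAt_matrixCLM fun k => R.contMDiffAt_coeff j _ (R.X_mem i k) x hj

theorem sum_change {i j x : M} (hj : x ∈ R.U j) (v : EuclideanSpace ℝ (Fin r)) :
    ∑ l, R.change i j x v l • R.X j l x = ∑ k, v k • R.X i k x := by
  unfold change
  rw [sum_matrixCLM_smul]
  refine Finset.sum_congr rfl fun k _ => ?_
  rw [← R.eq_sum j _ (R.X_mem i k) x hj]

theorem unique {i x : M} (hx : x ∈ R.U i) {b b' : M → EuclideanSpace ℝ (Fin r)}
    (hb : ContinuousAt b x) (hb' : ContinuousAt b' x)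
    (he : ∀ᶠ y in 𝓝 x, ∑ k, b y k • R.X i k y = ∑ k, b' y k • R.X i k y) : b x = b' x :=
  R.isReg.coefficients_unique (R.isOpen_U i) hx (R.isLift i) (R.linearIndependent i) hb hb' he

theorem change_self {i x : M} (hx : x ∈ R.U i) (v : EuclideanSpace ℝ (Fin r)) :
    R.change i i x v = v := by
  refine R.unique hx (b := fun y => R.change i i y v) (b' := fun _ => v)
    ((R.contMDiffAt_change hx).continuousAt.clm_apply continuousAt_const) continuousAt_const ?_
  filter_upwards [(R.isOpen_U i).mem_nhds hx] with y hy
  exact R.sum_change hy v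

theorem change_comp {i j k x : M} (hj : x ∈ R.U j) (hk : x ∈ R.U k)
    (v : EuclideanSpace ℝ (Fin r)) :
    R.change j k x (R.change i j x v) = R.change i k x v := by
  refine R.unique hk (b := fun y => R.change j k y (R.change i j y v))
    (b' := fun y => R.change i k y v)
    ((R.contMDiffAt_change hk).continuousAt.clm_apply
      ((R.contMDiffAt_change hj).continuousAt.clm_apply continuousAt_const))
    ((R.contMDiffAt_change hk).continuousAt.clm_apply continuousAt_const) ?_
  filter_upwards [(R.isOpen_U j).mem_nhds hj, (R.isOpen_U k).mem_nhds hk] with y hy hy'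
  rw [R.sum_change hy', R.sum_change hy, R.sum_change hy']

/-- The atlas of frames over the base. -/
def base : FrameAtlas I M r M where
  core :=
    { baseSet := R.U
      isOpen_baseSet := R.isOpen_U
      indexAt := id
      mem_baseSet_at := R.mem_U
      coordChange := R.change
      coordChange_self := fun _ _ hx v => R.change_self hx v
      continuousOn_coordChange := fun _ _ _ hx =>
        (R.contMDiffAt_change hx.2).continuousAt.continuousWithinAt
      coordChange_comp := fun _ _ _ _ hx v => R.change_comp hx.1.2 hx.2 v }
  isContMDiff := ⟨fun _ _ _ hx => (R.contMDiffAt_change hx.2).contMDiffWithinAt⟩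
  frame i k := R.X i k
  contMDiffAt_frame i k x _ := (R.X i k).contMDiffAt x
  frame_coordChange _ _ _ v _ hj := R.sum_change hj v

theorem sum_change_lift {i j : M} {p : N} (hj : φ p ∈ R.U j)
    (v : EuclideanSpace ℝ (Fin r)) :
    ∑ l, R.change i j (φ p) v l • R.Y j l p = ∑ k, v k • R.Y i k p := by
  have hφ := R.isReg.contMDiff
  refine eq_of_mfderiv_eq_of_dense R.isReg.dense (V := fun q => ∑ l, R.change i j (φ q) v l • R.Y j l q)
    (W := fun q => ∑ k, v k • R.Y i k q)
    (contMDiffAt_sum_smul (c := fun l q => R.change i j (φ q) v l) (fun l => ?_)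
      fun l => (R.Y j l).contMDiffAt p)
    (contMDiffAt_sum_smul (c := fun k _ => v k) (fun k => contMDiffAt_const)
      fun k => (R.Y i k).contMDiffAt p) ?_
  · exact contMDiffAt_euclidean_apply
      (((R.contMDiffAt_change hj).comp p (hφ p)).clm_apply contMDiffAt_const) l
  · filter_upwards [hφ.continuous.continuousAt ((R.isOpen_U j).mem_nhds hj)] with q hq
    refine ⟨Submodule.sum_mem _ fun k _ => Submodule.smul_mem _ _ (R.isLift j k q).1,
      Submodule.sum_mem _ fun k _ => Submodule.smul_mem _ _ (R.isLift i k q).1, ?_⟩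
    rw [map_sum, map_sum]
    simp only [map_smul, (R.isLift _ _ q).2]
    exact R.sum_change hq v

/-- The atlas of lifted frames. -/
def lifted : FrameAtlas J N r M where
  core :=
    { baseSet := fun i => φ ⁻¹' R.U i
      isOpen_baseSet := fun i => (R.isOpen_U i).preimage R.isReg.contMDiff.continuous
      indexAt := φ
      mem_baseSet_at := fun p => R.mem_U (φ p)
      coordChange := fun i j p => R.change i j (φ p)
      coordChange_self := fun _ _ hx v => R.change_self hx v
      continuousOn_coordChange := fun _ _ p hp =>
        ((R.contMDiffAt_change hp.2).comp p (R.isReg.contMDiff p)).continuousAt.continuousWithinAt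
      coordChange_comp := fun _ _ _ _ hx v => R.change_comp hx.1.2 hx.2 v }
  isContMDiff := ⟨fun _ _ p hp =>
    ((R.contMDiffAt_change hp.2).comp p (R.isReg.contMDiff p)).contMDiffWithinAt⟩
  frame i k := R.Y i k
  contMDiffAt_frame i k x _ := (R.Y i k).contMDiffAt x
  frame_coordChange _ _ _ v _ hj := R.sum_change_lift hj v

theorem base_anchor (x : M) (v : EuclideanSpace ℝ (Fin r)) :
    R.base.anchor x v = ∑ k, v k • R.X x k x := rfl

theorem lifted_anchor (p : N) (v : EuclideanSpace ℝ (Fin r)) :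
    R.lifted.anchor p v = ∑ k, v k • R.Y (φ p) k p := rfl

theorem mfderiv_lifted_anchor (p : N) (v : EuclideanSpace ℝ (Fin r)) :
    mfderiv J I φ p (R.lifted.anchor p v) = R.base.anchor (φ p) v := by
  rw [lifted_anchor, base_anchor, map_sum]
  simp only [map_smul, (R.isLift _ _ p).2]

theorem lifted_anchor_mem (p : N) (v : EuclideanSpace ℝ (Fin r)) : R.lifted.anchor p v ∈ F p := by
  rw [lifted_anchor]
  exact Submodule.sum_mem _ fun k _ => Submodule.smul_mem _ _ (R.isLift (φ p) k p).1

theorem base_injective (a b : R.base.Sections)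
    (hab : ∀ x, R.base.anchor x (a x) = R.base.anchor x (b x)) : a = b := by
  ext x
  have hx := R.mem_U x
  have h1 : ∀ c : R.base.Sections, ContinuousAt
      (fun y => R.change y x y (c y) : M → EuclideanSpace ℝ (Fin r)) x := fun c =>
    ((R.base.contMDiffAt_section_iff hx).1 (c.contMDiff x)).continuousAt
  have h2 := R.unique hx (h1 a) (h1 b) (by
    filter_upwards [(R.isOpen_U x).mem_nhds hx] with y hy
    exact (R.sum_change hy (a y)).trans ((hab y).trans (R.sum_change hy (b y)).symm))
  exact (R.change_self hx (a x)).symm.trans (h2.trans (R.change_self hx (b x)))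

theorem base_field_mem (a : R.base.Sections) : R.base.field a ∈ 𝔛 := by
  refine R.isReg.mem_of_locally _ fun x => ⟨R.X x, R.X_mem x,
    fun y => R.change y x y (a y), ?_, ?_⟩
  · exact (R.base.contMDiffAt_section_iff (R.mem_U x)).1 (a.contMDiff x)
  · filter_upwards [(R.isOpen_U x).mem_nhds (R.mem_U x)] with y hy
    exact (R.sum_change hy (a y)).symm

theorem exists_base_section {Z : SmoothVectorField I M} (hZ : Z ∈ 𝔛) :
    ∃ a : R.base.Sections, ∀ x, R.base.anchor x (a x) = Z x := by
  obtain ⟨a, ha⟩ := R.base.exists_section (b := fun i => R.coeff i Z)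
    (fun i x hx => R.contMDiffAt_coeff i Z hZ x hx) (by
      intro i j x hi hj
      refine R.unique hj (b := fun y => R.change i j y (R.coeff i Z y)) (b' := R.coeff j Z)
        ((R.contMDiffAt_change hj).continuousAt.clm_apply
          (R.contMDiffAt_coeff i Z hZ x hi).continuousAt)
        (R.contMDiffAt_coeff j Z hZ x hj).continuousAt ?_
      filter_upwards [(R.isOpen_U i).mem_nhds hi, (R.isOpen_U j).mem_nhds hj] with y hy hy'
      rw [R.sum_change hy', ← R.eq_sum i Z hZ y hy, ← R.eq_sum j Z hZ y hy'])
  refine ⟨a, fun x => ?_⟩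
  rw [ha, R.eq_sum x Z hZ x (R.mem_U x)]
  rfl

theorem lifted_anchor_injective (p : N) : Function.Injective (R.lifted.anchor p) := by
  rw [injective_iff_map_eq_zero]
  intro v hv
  have h1 := Fintype.linearIndependent_iff.1 (R.linearIndependent (φ p) p (R.mem_U _)) _ hv
  exact PiLp.ext h1

theorem lifted_range (p : N) : LinearMap.range (R.lifted.anchor p) = F p := by
  have : FiniteDimensional ℝ (TangentSpace J p) := inferInstanceAs (FiniteDimensional ℝ E')
  refine Submodule.eq_of_le_of_finrank_eq ?_ ?_
  · rintro _ ⟨v, rfl⟩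
    exact R.lifted_anchor_mem p v
  · rw [LinearMap.finrank_range_of_inj (R.lifted_anchor_injective p), R.isReg.finrank_eq]
    exact finrank_euclideanSpace_fin

theorem exists_lifted_section {Z : SmoothVectorField J N} (hZ : ∀ p, Z p ∈ F p) :
    ∃ a : R.lifted.Sections, ∀ p, R.lifted.anchor p (a p) = Z p := by
  have hex : ∀ i p, ∃ v : EuclideanSpace ℝ (Fin r), φ p ∈ R.U i → Z p = ∑ k, v k • R.Y i k p := by
    intro i p
    have h1 := hZ p
    rw [← R.lifted_range p] at h1
    obtain ⟨v, hv⟩ := h1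
    refine ⟨R.change (φ p) i (φ p) v, fun hp => ?_⟩
    exact hv.symm.trans (R.sum_change_lift hp v).symm
  choose b hb using hex
  obtain ⟨a, ha⟩ := R.lifted.exists_section (b := b) (by
      intro i p hp
      refine contMDiffAt_coefficients (fun k => (R.Y i k).contMDiffAt p) (Z.contMDiffAt p)
        (R.linearIndependent i p hp) ?_
      filter_upwards [R.isReg.contMDiff.continuous.continuousAt ((R.isOpen_U i).mem_nhds hp)]
        with q hq
      exact hb i q hq) (by
      intro i j p hi hj
      have h1 : ∑ k, (R.change i j (φ p) (b i p) k - b j p k) • R.Y j k p = 0 := by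
        simp only [sub_smul, Finset.sum_sub_distrib]
        rw [R.sum_change_lift hj, ← hb i p hi, ← hb j p hj, sub_self]
      ext k
      exact sub_eq_zero.1 (Fintype.linearIndependent_iff.1 (R.linearIndependent j p hj) _ h1 k))
  refine ⟨a, fun p => ?_⟩
  rw [ha, hb (φ p) p (R.mem_U _)]
  rfl

theorem exists_base_bracket (a b : R.base.Sections) : ∃ c : R.base.Sections,
    ∀ x, R.base.anchor x (c x) = VectorField.mlieBracket I (fun y => R.base.anchor y (a y))
      (fun y => R.base.anchor y (b y)) x :=
  R.exists_base_section (R.isReg.bracket_mem _ (R.base_field_mem a) _ (R.base_field_mem b)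
    ⟨_, fun x => contMDiffAt_mlieBracket (R.base.contMDiffAt_anchor a x)
      (R.base.contMDiffAt_anchor b x)⟩ fun _ => rfl)

theorem exists_lifted_bracket (a b : R.lifted.Sections) : ∃ c : R.lifted.Sections,
    ∀ x, R.lifted.anchor x (c x) = VectorField.mlieBracket J (fun y => R.lifted.anchor y (a y))
      (fun y => R.lifted.anchor y (b y)) x :=
  R.exists_lifted_section (Z := ⟨_, fun x => contMDiffAt_mlieBracket
    (R.lifted.contMDiffAt_anchor a x) (R.lifted.contMDiffAt_anchor b x)⟩)
    (R.isReg.involutive (R.lifted.field a) (R.lifted.field b)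
      (fun p => R.lifted_anchor_mem p (a p)) (fun p => R.lifted_anchor_mem p (b p)))

/-- The Lie algebroid on the base. -/
def baseAlgebroid : LieAlgebroid I M r :=
  R.base.toLieAlgebroid R.base_injective (fun a b => (R.exists_base_bracket a b).choose)
    fun a b => (R.exists_base_bracket a b).choose_spec

/-- The Lie algebroid given by the distribution. -/
def liftedAlgebroid : LieAlgebroid J N r :=
  R.lifted.toLieAlgebroid (fun _ _ hab => ContMDiffSection.ext fun p =>
      R.lifted_anchor_injective p (hab p))
    (fun a b => (R.exists_lifted_bracket a b).choose)
    fun a b => (R.exists_lifted_bracket a b).choose_spec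

/-- The pull-back of a section. -/
def pullback (a : R.baseAlgebroid.Sections) : R.liftedAlgebroid.Sections :=
  ⟨fun p => (a (φ p) : EuclideanSpace ℝ (Fin r)), fun p =>
    (R.lifted.contMDiffAt_section_iff (a := fun p => (a (φ p) : EuclideanSpace ℝ (Fin r)))
      (i := φ p) (R.mem_U (φ p))).2
      (ContMDiffAt.comp p ((R.base.contMDiffAt_section_iff (i := φ p) (R.mem_U (φ p))).1
        (a.contMDiff (φ p))) (R.isReg.contMDiff p))⟩

theorem bracket_pullback (a b : R.baseAlgebroid.Sections) (p : N) :
    R.liftedAlgebroid.bracket (R.pullback a) (R.pullback b) p =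
      (R.baseAlgebroid.bracket a b (φ p) : EuclideanSpace ℝ (Fin r)) := by
  have key : R.liftedAlgebroid.bracket (R.pullback a) (R.pullback b) =
      R.pullback (R.baseAlgebroid.bracket a b) := by
    ext q
    apply R.lifted_anchor_injective q
    refine eq_of_mfderiv_eq_of_dense R.isReg.dense (V := fun q => R.lifted.anchor q
      (R.liftedAlgebroid.bracket (R.pullback a) (R.pullback b) q))
      (W := fun q => R.lifted.anchor q (R.pullback (R.baseAlgebroid.bracket a b) q))
      (R.lifted.contMDiffAt_anchor _ q) (R.lifted.contMDiffAt_anchor _ q)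
      (Filter.Eventually.of_forall fun q => ⟨R.lifted_anchor_mem q _, R.lifted_anchor_mem q _, ?_⟩)
    have h1 : R.lifted.anchor q (R.liftedAlgebroid.bracket (R.pullback a) (R.pullback b) q) =
      VectorField.mlieBracket J (R.lifted.field (R.pullback a)) (R.lifted.field (R.pullback b)) q :=
      (R.exists_lifted_bracket (R.pullback a) (R.pullback b)).choose_spec q
    have h2 : R.base.anchor (φ q) (R.baseAlgebroid.bracket a b (φ q)) =
      VectorField.mlieBracket I (R.base.field a) (R.base.field b) (φ q) :=
      (R.exists_base_bracket a b).choose_spec (φ q)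
    rw [h1, mfderiv_mlieBracket_of_related R.isReg.contMDiff (X := R.base.field a)
      (Y := R.base.field b) (fun p => R.mfderiv_lifted_anchor p _)
      (fun p => R.mfderiv_lifted_anchor p _), ← h2]
    exact (R.mfderiv_lifted_anchor q _).symm
  rw [key]
  rfl

/-- The fibrewise isomorphism from the distribution to the Lie algebroid on the base. -/
def hom : R.liftedAlgebroid.Hom R.baseAlgebroid φ where
  map p := (LinearMap.id : EuclideanSpace ℝ (Fin r) →ₗ[ℝ] EuclideanSpace ℝ (Fin r))
  contMDiff_map := by
    intro p
    refine (contMDiffAt_totalSpace (E := R.base.core.Fiber)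
      (f := fun b : TotalSpace (EuclideanSpace ℝ (Fin r)) R.lifted.core.Fiber =>
        (⟨φ b.1, b.2⟩ : TotalSpace (EuclideanSpace ℝ (Fin r)) R.base.core.Fiber))).2 ⟨?_, ?_⟩
    · exact (R.isReg.contMDiff p.1).comp p (Bundle.contMDiffAt_proj (IB := J)
        (F := EuclideanSpace ℝ (Fin r)) (n := ∞) R.lifted.core.Fiber (p := p))
    · exact ((R.lifted.core.localTriv (φ p.1)).contMDiffOn (IB := J) (n := ∞)).contMDiffAt
        ((R.lifted.core.localTriv (φ p.1)).open_source.mem_nhds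
          ((R.lifted.core.mem_localTriv_source (φ p.1) p).2 (R.mem_U (φ p.1)))) |>.snd
  anchor_map p b := (R.mfderiv_lifted_anchor p b).symm
  bracket_map k l u v f a g b hu hv p := by
    have h1 := R.liftedAlgebroid.bracket_combination u v f (fun i => R.pullback (a i)) g
      (fun j => R.pullback (b j)) hu hv p
    simp only [bracket_pullback] at h1
    exact h1

end RegularisationFrames

end Regularisation

theorem IsRegularisation.submersesIsomorphically {n : ℕ} {M : Type*} [TopologicalSpace M]
    [ChartedSpace (EuclideanSpace ℝ (Fin n)) M] [IsManifold (𝓡 n) ∞ M]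
    {E' : Type*} [NormedAddCommGroup E'] [NormedSpace ℝ E'] [FiniteDimensional ℝ E']
    {H' : Type*} [TopologicalSpace H']
    {J : ModelWithCorners ℝ E' H'} [J.Boundaryless] {N : Type*} [TopologicalSpace N]
    [ChartedSpace H' N] [IsManifold J ∞ N] {φ : N → M}
    {F : ∀ p : N, Submodule ℝ (TangentSpace J p)} {𝔛 : Set (SmoothVectorField (𝓡 n) M)}
    (h : IsRegularisation (𝓡 n) J φ F 𝔛 n) : SubmersesIsomorphically J φ F 𝔛 := by
  obtain ⟨R⟩ := h.nonempty_frames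
  refine ⟨R.baseAlgebroid, R.liftedAlgebroid, R.hom, ⟨fun X => ⟨fun hX => R.exists_base_section hX,
    ?_⟩, R.base_injective, fun a b => (R.exists_base_bracket a b).choose_spec⟩,
    ⟨R.lifted_anchor_injective, R.lifted_range, fun a b => (R.exists_lifted_bracket a b).choose_spec⟩,
    ⟨h.surjective, h.surjective_mfderiv, fun p => Function.surjective_id⟩,
    fun p => Function.bijective_id⟩
  rintro ⟨a, ha⟩
  have h1 : R.base.field a = X := ContMDiffSection.ext ha
  exact h1 ▸ R.base_field_mem a

/-! ### Logarithmic vector fields -/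

section Logarithmic

variable {E : Type*} [NormedAddCommGroup E] [NormedSpace ℝ E] [FiniteDimensional ℝ E]
  {H : Type*} [TopologicalSpace H]
  {I : ModelWithCorners ℝ E H} [I.Boundaryless] {M : Type*} [TopologicalSpace M] [ChartedSpace H M]
  [IsManifold I ∞ M] {V : Type*} [NormedAddCommGroup V] [NormedSpace ℝ V] [FiniteDimensional ℝ V]

/-- Submersions are open. -/
theorem map_nhds_of_surjective_dAt {O : Set M} (hO : IsOpen O) {p₀ : M} (hp : p₀ ∈ O) {Φ : M → V}
    (hΦ : ContMDiffOn I 𝓘(ℝ, V) ∞ Φ O) (hs : Function.Surjective (dAt I Φ p₀)) :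
    Filter.map Φ (𝓝 p₀) = 𝓝 (Φ p₀) := by
  obtain ⟨K, ψ, hx, -, -, -, h1⟩ := exists_straightening hO hp hΦ hs
  have h2 : Φ =ᶠ[𝓝 p₀] fun q => (ψ q).1 := by
    filter_upwards [ψ.open_source.mem_nhds hx] with q hq using (h1 q hq).symm
  rw [Filter.map_congr h2, ← h1 p₀ hx]
  have h3 : Filter.map (fun q => (ψ q).1) (𝓝 p₀) = Filter.map Prod.fst (Filter.map ψ (𝓝 p₀)) :=
    Filter.map_map.symm
  rw [h3, ψ.map_nhds_eq hx, map_fst_nhds]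

theorem contMDiffAt_mul_of_algebra {A : Type*} [NormedRing A] [NormedAlgebra ℝ A] {f g : M → A}
    {x : M} (hf : ContMDiffAt I 𝓘(ℝ, A) ∞ f x) (hg : ContMDiffAt I 𝓘(ℝ, A) ∞ g x) :
    ContMDiffAt I 𝓘(ℝ, A) ∞ (fun y => f y * g y) x :=
  (((ContinuousLinearMap.mul ℝ A).contMDiff.contMDiffAt).comp x hf).clm_apply hg

variable {ι : Type*} [Fintype ι] {𝕂 : Type*} [RCLike 𝕂]

variable (I M ι 𝕂) in
/-- Local equations of a family of transverse divisors. -/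
structure LocalEquations where
  f : ι → M → M → 𝕂
  U : M → Set M
  isOpen_U : ∀ x, IsOpen (U x)
  mem_U : ∀ x, x ∈ U x
  contMDiffOn : ∀ i x, ContMDiffOn I 𝓘(ℝ, 𝕂) ∞ (f i x) (U x)
  transition : ∀ i x y, ∃ u : M → 𝕂, ContMDiffOn I 𝓘(ℝ, 𝕂) ∞ u (U x ∩ U y) ∧
    ∀ z ∈ U x ∩ U y, u z ≠ 0 ∧ f i x z = u z * f i y z
  transverse : ∀ x, ∀ w : ι → 𝕂, ∃ v : TangentSpace I x,
    ∀ i, f i x x = 0 → dAt I (f i x) x v = w i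

namespace LocalEquations

variable (S : LocalEquations I M ι 𝕂)

theorem contMDiffAt (i : ι) {x y : M} (hy : y ∈ S.U x) : ContMDiffAt I 𝓘(ℝ, 𝕂) ∞ (S.f i x) y :=
  (S.contMDiffOn i x).contMDiffAt ((S.isOpen_U x).mem_nhds hy)

theorem mdifferentiableAt (i : ι) {x y : M} (hy : y ∈ S.U x) :
    MDifferentiableAt I 𝓘(ℝ, 𝕂) (S.f i x) y :=
  (S.contMDiffAt i hy).mdifferentiableAt (by simp)

/-- A vector field along which each local equation is differentiated to a multiple of itself. -/
def IsLogarithmic (X : SmoothVectorField I M) : Prop :=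
  ∀ i x, ∃ l : M → 𝕂, ContMDiffOn I 𝓘(ℝ, 𝕂) ∞ l (S.U x) ∧
    ∀ y ∈ S.U x, dAt I (S.f i x) y (X y) = l y * S.f i x y

theorem transverse_of_mem {x y : M} (hy : y ∈ S.U x) (w : ι → 𝕂) : ∃ v : TangentSpace I y,
    ∀ i, S.f i x y = 0 → dAt I (S.f i x) y v = w i := by
  choose u hu hu' using fun i => S.transition i x y
  have hmem : y ∈ S.U x ∩ S.U y := ⟨hy, S.mem_U y⟩
  have hmem' := ((S.isOpen_U x).inter (S.isOpen_U y)).mem_nhds hmem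
  obtain ⟨v, hv⟩ := S.transverse y fun i => (u i y)⁻¹ * w i
  refine ⟨v, fun i hi => ?_⟩
  have h0 : S.f i y y = 0 := by
    have h1 := (hu' i y hmem)
    rw [hi] at h1
    exact (mul_eq_zero.1 h1.2.symm).resolve_left h1.1
  have h1 : S.f i x =ᶠ[𝓝 y] fun z => u i z * S.f i y z := by
    filter_upwards [hmem'] with z hz using (hu' i z hz).2
  rw [dAt_congr h1, dAt_mul (((hu i).contMDiffAt hmem').mdifferentiableAt (by simp))
    (S.mdifferentiableAt i (S.mem_U y)), h0, hv i h0, mul_zero, zero_add,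
    mul_inv_cancel_left₀ (hu' i y hmem).1]

theorem surjective_dAt (i : ι) {x y : M} (hy : y ∈ S.U x) (h0 : S.f i x y = 0) :
    Function.Surjective (dAt I (S.f i x) y) := fun w => by
  obtain ⟨v, hv⟩ := S.transverse_of_mem hy fun _ => w
  exact ⟨v, hv i h0⟩

theorem frequently_ne_zero (i : ι) {x y : M} (hy : y ∈ S.U x) : ∃ᶠ z in 𝓝 y, S.f i x z ≠ 0 := by
  by_cases h0 : S.f i x y = 0
  · have h1 := map_nhds_of_surjective_dAt (S.isOpen_U x) hy (S.contMDiffOn i x)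
      (S.surjective_dAt i hy h0)
    have h2 : ∃ᶠ w in 𝓝 (S.f i x y), w ≠ 0 :=
      mem_closure_iff_frequently.1 (dense_compl_singleton (0 : 𝕂) (S.f i x y))
    rw [← h1] at h2
    exact Filter.frequently_map.1 h2
  · exact ((S.contMDiffAt i hy).continuousAt.eventually_ne h0).frequently

theorem multiplier_unique (i : ι) {x y : M} (hy : y ∈ S.U x) {l l' : M → 𝕂} (hl : ContinuousAt l y)
    (hl' : ContinuousAt l' y) (h : ∀ᶠ z in 𝓝 y, l z * S.f i x z = l' z * S.f i x z) :
    l y = l' y :=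
  tendsto_nhds_unique_of_frequently_eq hl hl'
    (((S.frequently_ne_zero i hy).and_eventually h).mono fun _ hz => mul_right_cancel₀ hz.1 hz.2)

/-- Being logarithmic can be checked locally. -/
theorem isLogarithmic_of_locally {X : SmoothVectorField I M} (h : ∀ i x, ∃ x', x ∈ S.U x' ∧ ∃ l : M → 𝕂,
    ContMDiffAt I 𝓘(ℝ, 𝕂) ∞ l x ∧ ∀ᶠ y in 𝓝 x, dAt I (S.f i x') y (X y) = l y * S.f i x' y) :
    S.IsLogarithmic X := by
  intro i x
  have key : ∀ y ∈ S.U x, ∃ l : M → 𝕂, ContMDiffAt I 𝓘(ℝ, 𝕂) ∞ l y ∧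
      ∀ᶠ z in 𝓝 y, dAt I (S.f i x) z (X z) = l z * S.f i x z := by
    intro y hy
    obtain ⟨y', hy', l, hl, hl'⟩ := h i y
    obtain ⟨u, hu, hu'⟩ := S.transition i x y'
    have hmem : y ∈ S.U x ∩ S.U y' := ⟨hy, hy'⟩
    have hopen := (S.isOpen_U x).inter (S.isOpen_U y')
    have huy := hu.contMDiffAt (hopen.mem_nhds hmem)
    have hdu : ContMDiffAt I 𝓘(ℝ, 𝕂) ∞ (derivAlong I (fun z => X z) u) y :=
      contMDiffAt_derivAlong (X.contMDiffAt y) huy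
    have hinv : ContMDiffAt I 𝓘(ℝ, 𝕂) ∞ (fun z => (u z)⁻¹) y :=
      ((contDiffAt_inv ℝ (hu' y hmem).1).contMDiffAt).comp y huy
    refine ⟨fun z => derivAlong I (fun z => X z) u z * (u z)⁻¹ + l z, (contMDiffAt_mul_of_algebra hdu hinv).add hl, ?_⟩
    filter_upwards [hl', hopen.mem_nhds hmem] with z hz hzm
    have h1 : S.f i x =ᶠ[𝓝 z] fun z => u z * S.f i y' z := by
      filter_upwards [hopen.mem_nhds hzm] with t ht using (hu' t ht).2
    rw [dAt_congr h1, dAt_mul ((hu.contMDiffAt (hopen.mem_nhds hzm)).mdifferentiableAt (by simp))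
      (S.mdifferentiableAt i hzm.2), hz, (hu' z hzm).2]
    have hne := (hu' z hzm).1
    change _ = (dAt I u z (X z) * (u z)⁻¹ + l z) * (u z * S.f i y' z)
    field_simp
  choose! L hL hL' using key
  refine ⟨fun y => L y y, fun y hy => ContMDiffAt.contMDiffWithinAt ?_, fun y hy =>
    (hL' y hy).self_of_nhds⟩
  refine (hL y hy).congr_of_eventuallyEq ?_
  have hc : ∀ᶠ z in 𝓝 y, ContinuousAt (L y) z := by
    have h1 : ContMDiffAt I 𝓘(ℝ, 𝕂) 1 (L y) y := (hL y hy).of_le (by simp)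
    filter_upwards [(contMDiffAt_iff_contMDiffAt_nhds (by simp)).1 h1] with z hz
    exact hz.continuousAt
  filter_upwards [hc, (hL' y hy).eventually_nhds, (S.isOpen_U x).mem_nhds hy] with z hz hz' hzU
  refine S.multiplier_unique i hzU (hL z hzU).continuousAt hz ?_
  filter_upwards [hz', hL' z hzU] with t ht ht'
  rw [← ht, ht']

theorem mul_dAt_comm (i : ι) {X Y : SmoothVectorField I M} {x y : M} (hy : y ∈ S.U x) {l : M → 𝕂}
    (hl : ContMDiffOn I 𝓘(ℝ, 𝕂) ∞ l (S.U x))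
    (hX : ∀ y ∈ S.U x, dAt I (S.f i x) y (X y) = l y * S.f i x y) :
    derivAlong I (fun z => Y z) (derivAlong I (fun z => X z) (S.f i x)) y =
      dAt I l y (Y y) * S.f i x y + l y * dAt I (S.f i x) y (Y y) := by
  have hU := (S.isOpen_U x).mem_nhds hy
  refine Eq.trans (dAt_congr ?_ _) (dAt_mul ((hl.contMDiffAt hU).mdifferentiableAt (by simp))
    (S.mdifferentiableAt i hy) _)
  filter_upwards [hU] with z hz using hX z hz

theorem isLogarithmic_bracket {X Y Z : SmoothVectorField I M} (hX : S.IsLogarithmic X)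
    (hY : S.IsLogarithmic Y) (hZ : ∀ x, Z x = VectorField.mlieBracket I X Y x) :
    S.IsLogarithmic Z := by
  refine S.isLogarithmic_of_locally fun i x => ⟨x, S.mem_U x, ?_⟩
  obtain ⟨l, hl, hl'⟩ := hX i x
  obtain ⟨m, hm, hm'⟩ := hY i x
  have hU := (S.isOpen_U x).mem_nhds (S.mem_U x)
  refine ⟨fun y => dAt I m y (X y) - dAt I l y (Y y),
    (contMDiffAt_derivAlong (X.contMDiffAt x) (hm.contMDiffAt hU)).sub
      (contMDiffAt_derivAlong (Y.contMDiffAt x) (hl.contMDiffAt hU)), ?_⟩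
  filter_upwards [hU] with y hy
  have h1 := mfderiv_mlieBracket (X.contMDiffAt y) (Y.contMDiffAt y) (S.contMDiffAt i hy)
  rw [S.mul_dAt_comm i hy hm hm', S.mul_dAt_comm i hy hl hl', hl' y hy, hm' y hy] at h1
  rw [hZ y]
  refine h1.trans ?_
  ring

theorem isLogarithmic_of_combination {κ : Type*} [Fintype κ] {Z : SmoothVectorField I M}
    (h : ∀ x, ∃ X : κ → SmoothVectorField I M, (∀ k, S.IsLogarithmic (X k)) ∧ ∃ a : κ → M → ℝ,
      (∀ k, ContMDiffAt I 𝓘(ℝ, ℝ) ∞ (a k) x) ∧ ∀ᶠ y in 𝓝 x, Z y = ∑ k, a k y • X k y) :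
    S.IsLogarithmic Z := by
  refine S.isLogarithmic_of_locally fun i x => ⟨x, S.mem_U x, ?_⟩
  obtain ⟨X, hX, a, ha, hZ⟩ := h x
  choose l hl hl' using fun k => hX k i x
  have hU := (S.isOpen_U x).mem_nhds (S.mem_U x)
  refine ⟨fun y => ∑ k, a k y • l k y,
    ContMDiffAt.sum fun k _ => (ha k).smul ((hl k).contMDiffAt hU), ?_⟩
  filter_upwards [hU, hZ] with y hy hZy
  rw [hZy, map_sum, Finset.sum_mul]
  refine Finset.sum_congr rfl fun k _ => ?_
  rw [map_smul, hl' k y hy, smul_mul_assoc]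

end LocalEquations

theorem contMDiffAt_clm_of_apply {W W' : Type*} [NormedAddCommGroup W] [NormedSpace ℝ W]
    [FiniteDimensional ℝ W] [NormedAddCommGroup W'] [NormedSpace ℝ W'] {A : M → W →L[ℝ] W'} {x : M}
    (h : ∀ w, ContMDiffAt I 𝓘(ℝ, W') ∞ (fun y => A y w) x) :
    ContMDiffAt I 𝓘(ℝ, W →L[ℝ] W') ∞ A x := by
  let b := Module.finBasis ℝ W
  have h1 : A = fun y => ∑ k, (LinearMap.toContinuousLinearMap (b.coord k)).smulRight (A y (b k)) := by
    funext y
    ext w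
    rw [sum_apply]
    conv_lhs => rw [← b.sum_repr w, map_sum]
    simp
  rw [h1]
  exact ContMDiffAt.sum fun k _ => ((ContinuousLinearMap.smulRightL ℝ W W'
    (LinearMap.toContinuousLinearMap (b.coord k))).contMDiff.contMDiffAt).comp x (h (b k))

theorem contMDiffAt_inverse_apply {W W' : Type*} [NormedAddCommGroup W] [NormedSpace ℝ W]
    [FiniteDimensional ℝ W] [NormedAddCommGroup W'] [NormedSpace ℝ W'] {A : M → W →L[ℝ] W'} {x : M}
    (h : ContMDiffAt I 𝓘(ℝ, W →L[ℝ] W') ∞ A x) (hA : (A x).IsInvertible) (w : W') :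
    ContMDiffAt I 𝓘(ℝ, W) ∞ (fun y => (A y).inverse w) x := by
  have : CompleteSpace W := FiniteDimensional.complete ℝ W
  obtain ⟨e, he⟩ := hA
  have h1 : ContDiffAt ℝ ∞ (ContinuousLinearMap.inverse : (W →L[ℝ] W') → _) (A x) := by
    rw [← he]
    exact contDiffAt_map_inverse _
  exact (h1.contMDiffAt.comp x h).clm_apply contMDiffAt_const

namespace LocalEquations

variable (S : LocalEquations I M ι 𝕂)

/-- The map `(v, m) ↦ (df_i(v) - m_i f_i)_i` at the point `y`, in the coordinates around `x`. -/
def symbol (x y : M) : E × (ι → 𝕂) →L[ℝ] ι → 𝕂 :=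
  ContinuousLinearMap.pi fun i =>
    (((dAt I (S.f i x) y).comp (mfderiv I 𝓘(ℝ, E) (extChartAt I x) y).inverse : E →L[ℝ] 𝕂)).comp
      (ContinuousLinearMap.fst ℝ E (ι → 𝕂)) -
    ((ContinuousLinearMap.mul ℝ 𝕂 (S.f i x y)).comp
      ((ContinuousLinearMap.proj i : (ι → 𝕂) →L[ℝ] 𝕂).comp (ContinuousLinearMap.snd ℝ E (ι → 𝕂))))

theorem symbol_apply (x y : M) (w : E × (ι → 𝕂)) (i : ι) :
    S.symbol x y w i = dAt I (S.f i x) y ((mfderiv I 𝓘(ℝ, E) (extChartAt I x) y).inverse w.1) -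
      S.f i x y * w.2 i := rfl

theorem contMDiffAt_symbol {x y : M} (hy : y ∈ S.U x) (hy' : y ∈ (chartAt H x).source) :
    ContMDiffAt I 𝓘(ℝ, E × (ι → 𝕂) →L[ℝ] ι → 𝕂) ∞ (S.symbol x) y := by
  refine contMDiffAt_clm_of_apply fun w => contMDiffAt_pi_space.2 fun i => ?_
  have hinv : (mfderiv I 𝓘(ℝ, E) (extChartAt I x) y).IsInvertible :=
    isInvertible_mfderiv_extChartAt (by rwa [extChartAt_source])
  have h1 := contMDiffAt_inverse_mfderiv (contMDiffAt_extChartAt' hy') hinv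
    (contMDiffAt_const (c := w.1))
  exact (contMDiffAt_derivAlong h1 (S.contMDiffAt i hy)).sub
    (contMDiffAt_mul_of_algebra (S.contMDiffAt i hy) contMDiffAt_const)

theorem surjective_symbol {x y : M} (hy : y ∈ S.U x) (hy' : y ∈ (chartAt H x).source) :
    Function.Surjective (S.symbol x y) := by
  classical
  intro w
  obtain ⟨v, hv⟩ := S.transverse_of_mem hy w
  have hinv : (mfderiv I 𝓘(ℝ, E) (extChartAt I x) y).IsInvertible :=
    isInvertible_mfderiv_extChartAt (by rwa [extChartAt_source])
  refine ⟨(mfderiv I 𝓘(ℝ, E) (extChartAt I x) y v,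
    fun i => (S.f i x y)⁻¹ * (dAt I (S.f i x) y v - w i)), ?_⟩
  funext i
  rw [symbol_apply]
  have h1 : (mfderiv I 𝓘(ℝ, E) (extChartAt I x) y).inverse
    (mfderiv I 𝓘(ℝ, E) (extChartAt I x) y v) = v := hinv.inverse_apply_self v
  refine (congrArg (fun u : TangentSpace I y => dAt I (S.f i x) y u -
    S.f i x y * ((S.f i x y)⁻¹ * (dAt I (S.f i x) y v - w i))) h1).trans ?_
  by_cases h0 : S.f i x y = 0
  · rw [hv i h0, h0, zero_mul, sub_zero]
  · rw [mul_inv_cancel_left₀ h0, sub_sub_cancel]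

theorem exists_frame [T2Space M] (x₀ : M) : ∃ U : Set M, IsOpen U ∧ x₀ ∈ U ∧ U ⊆ S.U x₀ ∧
    U ⊆ (chartAt H x₀).source ∧
    ∃ X : Fin (Module.finrank ℝ E) → SmoothVectorField I M, (∀ k, S.IsLogarithmic (X k)) ∧
    (∀ Z, S.IsLogarithmic Z → ∃ a : M → EuclideanSpace ℝ (Fin (Module.finrank ℝ E)),
      (∀ x ∈ U, ContMDiffAt I 𝓘(ℝ, EuclideanSpace ℝ (Fin (Module.finrank ℝ E))) ∞ a x) ∧
      ∀ x ∈ U, Z x = ∑ k, a x k • X k x) ∧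
    ∃ m : Fin (Module.finrank ℝ E) → M → ι → 𝕂,
      (∀ k i, ∀ x ∈ U, dAt I (S.f i x₀) x (X k x) = m k x i * S.f i x₀ x) ∧
      (∀ k, ∀ x ∈ U, ContinuousAt (m k) x) ∧
      ∀ x ∈ U, LinearIndependent ℝ fun k =>
        ((dAt I (extChartAt I x₀) x (X k x), m k x) : E × (ι → 𝕂)) := by
  set O := S.U x₀ ∩ (chartAt H x₀).source
  have hO : IsOpen O := (S.isOpen_U x₀).inter (chartAt H x₀).open_source
  have hx₀ : x₀ ∈ O := ⟨S.mem_U x₀, mem_chart_source H x₀⟩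
  let g : M → E := extChartAt I x₀
  have hg : ∀ y ∈ O, ContMDiffAt I 𝓘(ℝ, E) ∞ g y := fun y hy => contMDiffAt_extChartAt' hy.2
  have hgi : ∀ y ∈ O, (mfderiv I 𝓘(ℝ, E) g y).IsInvertible := fun y hy =>
    isInvertible_mfderiv_extChartAt (by rw [extChartAt_source]; exact hy.2)
  let K : Submodule ℝ (E × (ι → 𝕂)) := LinearMap.ker (S.symbol x₀ x₀).toLinearMap
  obtain ⟨Q, hQ⟩ := K.exists_isCompl
  let P : E × (ι → 𝕂) →L[ℝ] K := (K.projectionOnto Q hQ).toContinuousLinearMap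
  have hsurj := S.surjective_symbol hx₀.1 hx₀.2
  have hrn := LinearMap.finrank_range_add_finrank_ker (S.symbol x₀ x₀).toLinearMap
  have htop : LinearMap.range (S.symbol x₀ x₀).toLinearMap = ⊤ := LinearMap.range_eq_top.2 hsurj
  rw [htop, finrank_top] at hrn
  have hK : Module.finrank ℝ K = Module.finrank ℝ E := by
    have h1 : Module.finrank ℝ (E × (ι → 𝕂)) = Module.finrank ℝ E + Module.finrank ℝ (ι → 𝕂) :=
      Module.finrank_prod
    have h2 : Module.finrank ℝ (ι → 𝕂) + Module.finrank ℝ K = Module.finrank ℝ (E × (ι → 𝕂)) := hrn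
    omega
  let κ : Module.Basis (Fin (Module.finrank ℝ E)) ℝ K := Module.finBasisOfFinrankEq ℝ K hK
  let T : M → E × (ι → 𝕂) →L[ℝ] (ι → 𝕂) × K := fun y => (S.symbol x₀ y).prod P
  have hT : ∀ y ∈ O, ContMDiffAt I 𝓘(ℝ, E × (ι → 𝕂) →L[ℝ] (ι → 𝕂) × K) ∞ T y := by
    intro y hy
    refine contMDiffAt_clm_of_apply fun w => ?_
    exact ((S.contMDiffAt_symbol hy.1 hy.2).clm_apply contMDiffAt_const).prodMk_space
      contMDiffAt_const
  have hT₀ : (T x₀).IsInvertible := by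
    refine isInvertible_of_injective_of_finrank_eq ?_ ?_
    · rw [injective_iff_map_eq_zero]
      intro w hw
      have h1 : w ∈ K := congrArg Prod.fst hw
      have h2 : P w = 0 := congrArg Prod.snd hw
      have h3 : P w = ⟨w, h1⟩ := K.projectionOnto_apply_left hQ ⟨w, h1⟩
      exact congrArg Subtype.val (h3.symm.trans h2)
    · rw [Module.finrank_prod (M := (ι → 𝕂))]
      exact hrn.symm
  have hinvo : IsOpen {A : E × (ι → 𝕂) →L[ℝ] (ι → 𝕂) × K | A.IsInvertible} :=
    ContinuousLinearEquiv.isOpen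
  let V₀ := O ∩ T ⁻¹' {A : E × (ι → 𝕂) →L[ℝ] (ι → 𝕂) × K | A.IsInvertible}
  have hV₀ : IsOpen V₀ :=
    ContinuousOn.isOpen_inter_preimage (fun y hy => (hT y hy).continuousAt.continuousWithinAt) hO
      hinvo
  have hx₀V : x₀ ∈ V₀ := ⟨hx₀, hT₀⟩
  let θ : Fin (Module.finrank ℝ E) → M → E × (ι → 𝕂) := fun k y => (T y).inverse (0, κ k)
  have hθ : ∀ k, ∀ y ∈ V₀, ContMDiffAt I 𝓘(ℝ, E × (ι → 𝕂)) ∞ (θ k) y := fun k y hy =>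
    contMDiffAt_inverse_apply (hT y hy.1) hy.2 _
  have hTθ : ∀ k, ∀ y ∈ V₀, T y (θ k y) = (0, κ k) := fun k y hy =>
    ContinuousLinearMap.IsInvertible.self_apply_inverse hy.2 _
  let X' : Fin (Module.finrank ℝ E) → ∀ y : M, TangentSpace I y := fun k y =>
    (mfderiv I 𝓘(ℝ, E) g y).inverse (θ k y).1
  have hX' : ∀ k, ∀ y ∈ V₀, ContMDiffAt I I.tangent ∞ (T% (X' k)) y := fun k y hy =>
    contMDiffAt_inverse_mfderiv (hg y hy.1) (hgi y hy.1)
      ((ContinuousLinearMap.fst ℝ E (ι → 𝕂)).contMDiff.contMDiffAt.comp y (hθ k y hy))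
  have hfX' : ∀ k i, ∀ y ∈ V₀, dAt I (S.f i x₀) y (X' k y) = (θ k y).2 i * S.f i x₀ y := by
    intro k i y hy
    have h1 : S.symbol x₀ y (θ k y) = 0 := congrArg Prod.fst (hTθ k y hy)
    have h2 := congrFun h1 i
    rw [symbol_apply] at h2
    rw [mul_comm]
    exact sub_eq_zero.1 h2
  have hθ2 : ∀ k, ∀ y ∈ V₀, ContMDiffAt I 𝓘(ℝ, ι → 𝕂) ∞ (fun y => (θ k y).2) y := fun k y hy =>
    (ContinuousLinearMap.snd ℝ E (ι → 𝕂)).contMDiff.contMDiffAt.comp y (hθ k y hy)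
  obtain ⟨χ, hχ1, hχ⟩ := exists_bump I (hV₀.mem_nhds hx₀V)
  choose X hX using fun k => exists_smoothVectorField_smul hV₀ (hX' k) hχ
  obtain ⟨V₁, hV₁, hV₁o, hxV₁⟩ := eventually_nhds_iff.1 hχ1
  have hXV : ∀ k, ∀ y ∈ V₁, X k y = X' k y := fun k y hy => by rw [hX, hV₁ y hy, one_smul]
  refine ⟨V₁ ∩ V₀, hV₁o.inter hV₀, ⟨hxV₁, hx₀V⟩, fun y hy => hy.2.1.1, fun y hy => hy.2.1.2, X,
    fun k => S.isLogarithmic_of_locally fun i x => ?_, fun Z hZ => ?_, fun k y => (θ k y).2,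
    fun k i x hx => ?_, fun k x hx => (hθ2 k x hx.2).continuousAt, fun x hx => ?_⟩
  · by_cases hx : x ∈ V₀
    · refine ⟨x₀, hx.1.1, fun y => χ y • (θ k y).2 i, (χ.contMDiff x).smul
        (contMDiffAt_pi_space.1 (hθ2 k x hx) i), ?_⟩
      filter_upwards [hV₀.mem_nhds hx] with y hy
      rw [hX, map_smul, hfX' k i y hy, smul_mul_assoc]
    · refine ⟨x, S.mem_U x, fun _ => 0, contMDiffAt_const, ?_⟩
      filter_upwards [(isClosed_tsupport χ).isOpen_compl.mem_nhds fun h => hx (hχ h)] with y hy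
      rw [hX, image_eq_zero_of_notMem_tsupport hy, zero_smul, map_zero, zero_mul]
  · choose l hl hl' using fun i => hZ i x₀
    let w : M → E × (ι → 𝕂) := fun y => (dAt I g y (Z y), fun i => l i y)
    have hw : ∀ y ∈ O, ContMDiffAt I 𝓘(ℝ, E × (ι → 𝕂)) ∞ w y := fun y hy =>
      (contMDiffAt_derivAlong (Z.contMDiffAt y) (hg y hy)).prodMk_space
        (contMDiffAt_pi_space.2 fun i => (hl i).contMDiffAt ((S.isOpen_U x₀).mem_nhds hy.1))
    have hZg : ∀ y ∈ O, (mfderiv I 𝓘(ℝ, E) g y).inverse (w y).1 = Z y := fun y hy =>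
      (hgi y hy).inverse_apply_self (Z y)
    have hsw : ∀ y ∈ O, S.symbol x₀ y (w y) = 0 := by
      intro y hy
      funext i
      rw [symbol_apply]
      refine (congrArg (fun u : TangentSpace I y => dAt I (S.f i x₀) y u - S.f i x₀ y * l i y)
        (hZg y hy)).trans ?_
      change dAt I (S.f i x₀) y (Z y) - S.f i x₀ y * l i y = 0
      rw [hl' i y hy.1, mul_comm, sub_self]
    let c : E × (ι → 𝕂) →L[ℝ] EuclideanSpace ℝ (Fin (Module.finrank ℝ E)) :=
      ((EuclideanSpace.equiv (Fin (Module.finrank ℝ E)) ℝ).symm.toContinuousLinearMap.comp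
        (κ.equivFunL.toContinuousLinearMap)).comp P
    refine ⟨fun y => c (w y), fun y hy => (c.contMDiff.contMDiffAt).comp y (hw y hy.2.1), ?_⟩
    intro y hy
    have h1 : T y (w y) = T y (∑ k, c (w y) k • θ k y) := by
      rw [map_sum]
      simp only [map_smul, hTθ _ y hy.2]
      refine Prod.ext ?_ ?_
      · rw [Prod.fst_sum]
        simp only [Prod.smul_fst, smul_zero, Finset.sum_const_zero]
        exact hsw y hy.2.1
      · rw [Prod.snd_sum]
        exact (κ.sum_repr (P (w y))).symm
    obtain ⟨e, he⟩ := hy.2.2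
    have h2 : w y = ∑ k, c (w y) k • θ k y := by
      rw [← he] at h1
      exact e.injective h1
    have h3 : (w y).1 = ∑ k, c (w y) k • (θ k y).1 := by
      conv_lhs => rw [h2]
      rw [Prod.fst_sum]
      rfl
    let B : E →L[ℝ] TangentSpace I y := (mfderiv I 𝓘(ℝ, E) g y).inverse
    have h4 : B (w y).1 = ∑ k, c (w y) k • B (θ k y).1 := by
      rw [h3, map_sum]
      simp only [map_smul]
    refine (hZg y hy.2.1).symm.trans (h4.trans (Finset.sum_congr rfl fun k _ => ?_))
    rw [hXV k y hy.1]
    rfl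
  · rw [hXV k x hx.1]
    exact hfX' k i x hx.2
  · have h1 : ∀ k, ((dAt I (extChartAt I x₀) x (X k x), (θ k x).2) : E × (ι → 𝕂)) = θ k x := by
      intro k
      rw [hXV k x hx.1]
      exact Prod.ext ((hgi x hx.2.1).self_apply_inverse (θ k x).1) rfl
    simp only [h1]
    obtain ⟨e, he⟩ := hx.2.2
    refine LinearIndependent.of_comp (T x).toLinearMap ?_
    have h2 : (T x).toLinearMap ∘ (fun k => θ k x) = LinearMap.inr ℝ (ι → 𝕂) K ∘ κ :=
      funext fun k => hTθ k x hx.2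
    rw [h2]
    exact κ.linearIndependent.map' _ (LinearMap.ker_eq_bot.2 LinearMap.inr_injective)

end LocalEquations

end Logarithmic

/-! ### Regularisation of logarithmic vector fields -/

section Cover

variable {E : Type*} [NormedAddCommGroup E] [NormedSpace ℝ E] [FiniteDimensional ℝ E]
  {H : Type*} [TopologicalSpace H]
  {I : ModelWithCorners ℝ E H} [I.Boundaryless] {M : Type*} [TopologicalSpace M] [ChartedSpace H M]
  [IsManifold I ∞ M]
  {E' : Type*} [NormedAddCommGroup E'] [NormedSpace ℝ E'] [FiniteDimensional ℝ E']
  {H' : Type*} [TopologicalSpace H']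
  {J : ModelWithCorners ℝ E' H'} [J.Boundaryless] {N : Type*} [TopologicalSpace N]
  [ChartedSpace H' N] [IsManifold J ∞ N]
  {ι : Type*} [Fintype ι] {𝕂 : Type*} [RCLike 𝕂]

variable (J) in
/-- The local equations become, after multiplication by fibre coordinates `c`, the components of a
global function `Φ`. -/
structure IsRegularisingCover (S : LocalEquations I M ι 𝕂) (φ : N → M) (Φ : N → ι → 𝕂)
    (c : M → N → ι → 𝕂) : Prop where
  contMDiff : ContMDiff J I ∞ φ
  surjective : Function.Surjective φ
  contMDiff_fun : ContMDiff J 𝓘(ℝ, ι → 𝕂) ∞ Φ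
  contMDiffOn_coord : ∀ x, ContMDiffOn J 𝓘(ℝ, ι → 𝕂) ∞ (c x) (φ ⁻¹' S.U x)
  coord_ne_zero : ∀ x p, φ p ∈ S.U x → ∀ i, c x p i ≠ 0
  fun_eq : ∀ x p, φ p ∈ S.U x → ∀ i, Φ p i = c x p i * S.f i x (φ p)
  bijective : ∀ x p, φ p ∈ S.U x → Function.Bijective
    (fun v : TangentSpace J p => ((mfderiv J I φ p v, dAt J (c x) p v) :
      TangentSpace I (φ p) × (ι → 𝕂)))

namespace IsRegularisingCover

variable {S : LocalEquations I M ι 𝕂} {φ : N → M} {Φ : N → ι → 𝕂} {c : M → N → ι → 𝕂}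
  (h : IsRegularisingCover J S φ Φ c)

include h

theorem isOpen_preimage (x : M) : IsOpen (φ ⁻¹' S.U x) :=
  (S.isOpen_U x).preimage h.contMDiff.continuous

theorem contMDiffAt_coord {x : M} {p : N} (hp : φ p ∈ S.U x) :
    ContMDiffAt J 𝓘(ℝ, ι → 𝕂) ∞ (c x) p :=
  (h.contMDiffOn_coord x).contMDiffAt ((h.isOpen_preimage x).mem_nhds hp)

theorem contMDiffAt_coord_apply {x : M} {p : N} (hp : φ p ∈ S.U x) (i : ι) :
    ContMDiffAt J 𝓘(ℝ, 𝕂) ∞ (fun q => c x q i) p :=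
  contMDiffAt_pi_space.1 (h.contMDiffAt_coord hp) i

theorem dAt_fun {x : M} {p : N} (hp : φ p ∈ S.U x) (v : TangentSpace J p) (i : ι) :
    dAt J Φ p v i = dAt J (c x) p v i * S.f i x (φ p) +
      c x p i * dAt I (S.f i x) (φ p) (mfderiv J I φ p v) := by
  have hφ : MDifferentiableAt J I φ p := h.contMDiff.mdifferentiableAt (by simp)
  have hc := (h.contMDiffAt_coord_apply hp i).mdifferentiableAt (by simp)
  rw [dAt_pi (h.contMDiff_fun.mdifferentiableAt (by simp)) v i,
    dAt_pi ((h.contMDiffAt_coord hp).mdifferentiableAt (by simp)) v i]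
  have h1 : (fun q => Φ q i) =ᶠ[𝓝 p] fun q => c x q i * S.f i x (φ q) := by
    filter_upwards [(h.isOpen_preimage x).mem_nhds hp] with q hq using h.fun_eq x q hq i
  have hf : MDifferentiableAt J 𝓘(ℝ, 𝕂) (fun q => S.f i x (φ q)) p :=
    (S.mdifferentiableAt i hp).comp p hφ
  rw [dAt_congr h1, dAt_mul hc hf]
  congr 2
  exact dAt_comp (S.mdifferentiableAt i hp) hφ v

theorem surjective_dAt (p : N) : Function.Surjective (dAt J Φ p) := by
  intro w
  have hp := S.mem_U (φ p)
  obtain ⟨u, hu⟩ := S.transverse (φ p) fun i => (c (φ p) p i)⁻¹ * w i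
  obtain ⟨v, hv⟩ := (h.bijective (φ p) p hp).2 (u, fun i => (S.f i (φ p) (φ p))⁻¹ *
    (w i - c (φ p) p i * dAt I (S.f i (φ p)) (φ p) u))
  have h1 : mfderiv J I φ p v = u := congrArg Prod.fst hv
  have h2 : dAt J (c (φ p)) p v = fun i => (S.f i (φ p) (φ p))⁻¹ *
    (w i - c (φ p) p i * dAt I (S.f i (φ p)) (φ p) u) := congrArg Prod.snd hv
  refine ⟨v, funext fun i => ?_⟩
  rw [h.dAt_fun hp, h1, h2]
  have hne := h.coord_ne_zero _ p hp i
  by_cases h0 : S.f i (φ p) (φ p) = 0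
  · rw [hu i h0, h0, mul_zero, zero_add, mul_inv_cancel_left₀ hne]
  · change (S.f i (φ p) (φ p))⁻¹ * (w i - c (φ p) p i * dAt I (S.f i (φ p)) (φ p) u) *
      S.f i (φ p) (φ p) + _ = _
    field_simp
    ring

theorem frequently_ne_zero (p : N) : ∃ᶠ q in 𝓝 p, ∀ i, Φ q i ≠ 0 := by
  have h1 := map_nhds_of_surjective_dAt isOpen_univ (mem_univ p) h.contMDiff_fun.contMDiffOn
    (h.surjective_dAt p)
  have hd : Dense (univ.pi fun _ : ι => ({0}ᶜ : Set 𝕂)) :=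
    dense_pi univ fun _ _ => dense_compl_singleton (0 : 𝕂)
  have h2 := mem_closure_iff_frequently.1 (hd (Φ p))
  rw [← h1] at h2
  exact (Filter.frequently_map.1 h2).mono fun q hq i => hq i (mem_univ i)

theorem dense : Dense {p | ∀ v ∈ levelDistribution J Φ p, mfderiv J I φ p v = 0 → v = 0} := by
  intro p
  refine mem_closure_iff_frequently.2 ((h.frequently_ne_zero p).mono fun q hq v hv hv0 => ?_)
  have hp := S.mem_U (φ q)
  refine (h.bijective (φ q) q hp).1 (Prod.ext ?_ (funext fun i => ?_))
  · exact hv0.trans (map_zero _).symm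
  · have h1 := congrFun (mem_levelDistribution.1 hv) i
    have h3 : dAt J Φ q v i = 0 := h1
    rw [h.dAt_fun hp, hv0, map_zero, mul_zero, add_zero] at h3
    have h4 := hq i
    rw [h.fun_eq _ q hp i] at h4
    have h5 := (mul_eq_zero.1 h3).resolve_right (right_ne_zero_of_mul h4)
    refine h5.trans ?_
    exact (congrFun (map_zero (dAt J (c (φ q)) q)) i).symm

theorem finrank_eq (p : N) :
    Module.finrank ℝ E' = Module.finrank ℝ E + Module.finrank ℝ (ι → 𝕂) := by
  let A : E' →ₗ[ℝ] E × (ι → 𝕂) :=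
    (mfderiv J I φ p : E' →L[ℝ] E).toLinearMap.prod (dAt J (c (φ p)) p : E' →L[ℝ] _).toLinearMap
  rw [(LinearEquiv.ofBijective A (h.bijective (φ p) p (S.mem_U _))).finrank_eq, Module.finrank_prod]

/-- The fibre coordinates together with the coordinates on the base. -/
theorem coordinates {x : M} {p : N} (hp : φ p ∈ S.U x) (hp' : φ p ∈ (chartAt H x).source) :
    ContMDiffAt J 𝓘(ℝ, E × (ι → 𝕂)) ∞ (fun q => (extChartAt I x (φ q), c x q)) p ∧
    (∀ v, dAt J (fun q => (extChartAt I x (φ q), c x q)) p v =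
      (dAt I (extChartAt I x) (φ p) (mfderiv J I φ p v), dAt J (c x) p v)) ∧
    (mfderiv J 𝓘(ℝ, E × (ι → 𝕂)) (fun q => (extChartAt I x (φ q), c x q)) p).IsInvertible := by
  have h1 := contMDiffAt_extChartAt' (I := I) (n := ∞) hp'
  have h2 : ContMDiffAt J 𝓘(ℝ, E) ∞ (fun q => extChartAt I x (φ q)) p :=
    h1.comp p (h.contMDiff p)
  have h3 : ∀ v, dAt J (fun q => (extChartAt I x (φ q), c x q)) p v =
      (dAt I (extChartAt I x) (φ p) (mfderiv J I φ p v), dAt J (c x) p v) := by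
    intro v
    rw [dAt_prodMk (h2.mdifferentiableAt (by simp))
      ((h.contMDiffAt_coord hp).mdifferentiableAt (by simp)),
      dAt_comp (h1.mdifferentiableAt (by simp)) (h.contMDiff.mdifferentiableAt (by simp))]
  refine ⟨h2.prodMk_space (h.contMDiffAt_coord hp), h3, ?_⟩
  have hinv : (mfderiv I 𝓘(ℝ, E) (extChartAt I x) (φ p)).IsInvertible :=
    isInvertible_mfderiv_extChartAt (by rwa [extChartAt_source])
  let A : E' →L[ℝ] E × (ι → 𝕂) := dAt J (fun q => (extChartAt I x (φ q), c x q)) p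
  have hA : Function.Injective A := by
    refine (injective_iff_map_eq_zero A).2 fun v hv => ?_
    have h4 := (h3 v).symm.trans hv
    have h5 : mfderiv J I φ p v = 0 :=
      hinv.injective ((congrArg Prod.fst h4).trans (map_zero _).symm)
    refine (h.bijective x p hp).1 (Prod.ext ?_ ?_)
    · exact h5.trans (map_zero _).symm
    · exact (congrArg Prod.snd h4).trans (map_zero _).symm
  refine isInvertible_of_injective_of_finrank_eq (V := E') (W := E × (ι → 𝕂)) hA ?_
  rw [h.finrank_eq p, Module.finrank_prod]

theorem exists_local_lift {X : SmoothVectorField I M} (hX : S.IsLogarithmic X) (x : M) :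
    ∃ Y : ∀ p : N, TangentSpace J p, ∀ p, φ p ∈ S.U x ∩ (chartAt H x).source →
      ContMDiffAt J J.tangent ∞ (T% Y) p ∧ Y p ∈ levelDistribution J Φ p ∧
      mfderiv J I φ p (Y p) = X (φ p) := by
  choose l hl hl' using fun i => hX i x
  let g : N → E × (ι → 𝕂) := fun q => (extChartAt I x (φ q), c x q)
  let W : N → E × (ι → 𝕂) := fun q => (dAt I (extChartAt I x) (φ q) (X (φ q)),
    fun i => - (c x q i * l i (φ q)))
  refine ⟨fun p => (mfderiv J 𝓘(ℝ, E × (ι → 𝕂)) g p).inverse (W p), fun p hp => ?_⟩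
  obtain ⟨hg, hdg, hinv⟩ := h.coordinates hp.1 hp.2
  have hW : ContMDiffAt J 𝓘(ℝ, E × (ι → 𝕂)) ∞ W p := by
    refine ContMDiffAt.prodMk_space ?_ (contMDiffAt_pi_space.2 fun i => ContMDiffAt.neg
      (contMDiffAt_mul_of_algebra (h.contMDiffAt_coord_apply hp.1 i) ?_))
    · exact (contMDiffAt_derivAlong (X.contMDiffAt (φ p)) (contMDiffAt_extChartAt' hp.2)).comp p
        (h.contMDiff p)
    · exact ((hl i).contMDiffAt ((S.isOpen_U x).mem_nhds hp.1)).comp p (h.contMDiff p)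
  have h1 : dAt J g p ((mfderiv J 𝓘(ℝ, E × (ι → 𝕂)) g p).inverse (W p)) = W p :=
    hinv.self_apply_inverse (W p)
  rw [hdg] at h1
  have hinvM : (mfderiv I 𝓘(ℝ, E) (extChartAt I x) (φ p)).IsInvertible :=
    isInvertible_mfderiv_extChartAt (by rw [extChartAt_source]; exact hp.2)
  have h2 : mfderiv J I φ p ((mfderiv J 𝓘(ℝ, E × (ι → 𝕂)) g p).inverse (W p)) = X (φ p) :=
    hinvM.injective (congrArg Prod.fst h1)
  have h3 : dAt J (c x) p ((mfderiv J 𝓘(ℝ, E × (ι → 𝕂)) g p).inverse (W p)) =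
    fun i => - (c x p i * l i (φ p)) := congrArg Prod.snd h1
  refine ⟨contMDiffAt_inverse_mfderiv hg hinv hW, ?_, h2⟩
  rw [mem_levelDistribution]
  funext i
  rw [h.dAt_fun hp.1, h2, h3, hl' i _ hp.1]
  change - (c x p i * l i (φ p)) * S.f i x (φ p) + c x p i * (l i (φ p) * S.f i x (φ p)) = 0
  ring

theorem exists_isLift {X : SmoothVectorField I M} (hX : S.IsLogarithmic X) :
    ∃ Y : SmoothVectorField J N, IsLift φ (levelDistribution J Φ) Y X := by
  choose Y hY using h.exists_local_lift hX
  have hmem : ∀ p, φ p ∈ S.U (φ p) ∩ (chartAt H (φ p)).source := fun p =>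
    ⟨S.mem_U _, mem_chart_source H _⟩
  have hcongr : ∀ p, ∀ᶠ q in 𝓝 p, Y (φ q) q = Y (φ p) q := by
    intro p
    have ho : ∀ x, IsOpen (φ ⁻¹' (S.U x ∩ (chartAt H x).source)) := fun x =>
      ((S.isOpen_U x).inter (chartAt H x).open_source).preimage h.contMDiff.continuous
    filter_upwards [(ho (φ p)).mem_nhds (hmem p)] with q hq
    refine eq_of_mfderiv_eq_of_dense h.dense (hY (φ q) q (hmem q)).1 (hY (φ p) q hq).1 ?_
    filter_upwards [(ho (φ p)).mem_nhds hq, (ho (φ q)).mem_nhds (hmem q)] with t ht ht'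
    refine ⟨(hY (φ q) t ht').2.1, (hY (φ p) t ht).2.1, ?_⟩
    rw [(hY (φ q) t ht').2.2, (hY (φ p) t ht).2.2]
  refine ⟨⟨fun p => Y (φ p) p, fun p => ?_⟩, fun p => (hY (φ p) p (hmem p)).2⟩
  refine (hY (φ p) p (hmem p)).1.congr_of_eventuallyEq ?_
  filter_upwards [hcongr p] with q hq
  rw [hq]

theorem dAt_coord_of_isLift {X : SmoothVectorField I M} {Y : SmoothVectorField J N}
    (hY : IsLift φ (levelDistribution J Φ) Y X) {x : M} {U : Set M} (hU : IsOpen U)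
    (hUx : U ⊆ S.U x) {m : M → ι → 𝕂}
    (hm : ∀ i, ∀ y ∈ U, dAt I (S.f i x) y (X y) = m y i * S.f i x y) {p : N} (hp : φ p ∈ U)
    (hmc : ContinuousAt m (φ p)) (i : ι) : dAt J (c x) p (Y p) i = - (c x p i * m (φ p) i) := by
  have h1 : ContinuousAt (fun q => dAt J (c x) q (Y q) i) p :=
    (continuous_apply i).continuousAt.comp
      (contMDiffAt_derivAlong (Y.contMDiffAt p) (h.contMDiffAt_coord (hUx hp))).continuousAt
  have hφ := h.contMDiff.continuous.continuousAt (x := p)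
  have h2 : ContinuousAt (fun q => - (c x q i * m (φ q) i)) p :=
    ((h.contMDiffAt_coord_apply (hUx hp) i).continuousAt.mul
      ((continuous_apply i).continuousAt.comp (hmc.comp hφ))).neg
  refine tendsto_nhds_unique_of_frequently_eq h1 h2
    (((h.frequently_ne_zero p).and_eventually (hφ (hU.mem_nhds hp))).mono ?_)
  rintro q ⟨hq, hqU⟩
  have hqU' : φ q ∈ U := hqU
  have h3 : dAt J Φ q (Y q) i = 0 := congrFun (mem_levelDistribution.1 (hY q).1) i
  rw [h.dAt_fun (hUx hqU'), (hY q).2, hm i _ hqU'] at h3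
  have h4 := hq i
  rw [h.fun_eq x q (hUx hqU') i] at h4
  refine mul_right_cancel₀ (right_ne_zero_of_mul h4) ?_
  rw [eq_neg_of_add_eq_zero_left h3]
  ring

/-- The vector fields that are logarithmic are regularised by the distribution tangent to the level
sets. -/
theorem isRegularisation [T2Space M] [T2Space N] : IsRegularisation I J φ (levelDistribution J Φ)
    {X | S.IsLogarithmic X} (Module.finrank ℝ E) where
  contMDiff := h.contMDiff
  surjective := h.surjective
  surjective_mfderiv p v := by
    obtain ⟨u, hu⟩ := (h.bijective (φ p) p (S.mem_U _)).2 (v, 0)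
    exact ⟨u, congrArg Prod.fst hu⟩
  finrank_eq p := by
    let A : E' →L[ℝ] (ι → 𝕂) := dAt J Φ p
    have h1 := LinearMap.finrank_range_add_finrank_ker A.toLinearMap
    have h2 : LinearMap.range A.toLinearMap = ⊤ :=
      LinearMap.range_eq_top.2 (h.surjective_dAt p)
    rw [h2, finrank_top, h.finrank_eq p] at h1
    have h3 : Module.finrank ℝ (ι → 𝕂) + Module.finrank ℝ (levelDistribution J Φ p) =
      Module.finrank ℝ E + Module.finrank ℝ (ι → 𝕂) := h1
    omega
  involutive := (isFoliation_levelDistribution h.contMDiff_fun h.surjective_dAt).involutive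
  dense := h.dense
  exists_isLift _ hX := h.exists_isLift hX
  exists_frame x₀ := by
    obtain ⟨U, hU, hx₀, hUS, hUc, X, hX, hZ, m, hm, hmc, hli⟩ := S.exists_frame x₀
    refine ⟨U, hU, hx₀, X, hX, hZ, fun Y hY p hp => ?_⟩
    let A : TangentSpace J p →ₗ[ℝ] E × (ι → 𝕂) :=
      { toFun := fun v => (dAt I (extChartAt I x₀) (φ p) (mfderiv J I φ p v),
          fun i => - ((c x₀ p i)⁻¹ * dAt J (c x₀) p v i))
        map_add' := fun v w => by
          refine Prod.ext (by simp [map_add]) (funext fun i => ?_)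
          change - ((c x₀ p i)⁻¹ * dAt J (c x₀) p (v + w) i) =
            - ((c x₀ p i)⁻¹ * dAt J (c x₀) p v i) + - ((c x₀ p i)⁻¹ * dAt J (c x₀) p w i)
          rw [map_add, Pi.add_apply]
          ring
        map_smul' := fun t v => by
          refine Prod.ext (by simp [map_smul]) (funext fun i => ?_)
          change - ((c x₀ p i)⁻¹ * dAt J (c x₀) p (t • v) i) =
            t • - ((c x₀ p i)⁻¹ * dAt J (c x₀) p v i)
          rw [map_smul, Pi.smul_apply, mul_smul_comm, smul_neg] }
    refine LinearIndependent.of_comp A ?_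
    have h1 : (A ∘ fun k => Y k p) = fun k =>
        ((dAt I (extChartAt I x₀) (φ p) (X k (φ p)), m k (φ p)) : E × (ι → 𝕂)) := by
      funext k
      refine Prod.ext ?_ (funext fun i => ?_)
      · change dAt I (extChartAt I x₀) (φ p) (mfderiv J I φ p (Y k p)) = _
        rw [(hY k p).2]
      · change - ((c x₀ p i)⁻¹ * dAt J (c x₀) p (Y k p) i) = m k (φ p) i
        rw [h.dAt_coord_of_isLift (hY k) hU hUS (hm k) hp (hmc k _ hp), mul_neg, neg_neg,
          inv_mul_cancel_left₀ (h.coord_ne_zero x₀ p (hUS hp) i)]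
    rw [h1]
    exact hli (φ p) hp
  mem_of_locally Z hZ := S.isLogarithmic_of_combination fun x => by
    obtain ⟨X, hX, a, ha, hZ'⟩ := hZ x
    exact ⟨X, hX, fun k y => a y k, fun k => contMDiffAt_euclidean_apply ha k, hZ'⟩
  bracket_mem _ hX _ hY _ hZ := S.isLogarithmic_bracket hX hY hZ

end IsRegularisingCover

end Cover

/-! ### Division of functions on manifolds -/

section ManifoldDivision

variable {E : Type} [NormedAddCommGroup E] [NormedSpace ℝ E] [FiniteDimensional ℝ E]
  {H : Type*} [TopologicalSpace H]
  {I : ModelWithCorners ℝ E H} [I.Boundaryless] {M : Type*} [TopologicalSpace M] [ChartedSpace H M]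
  [IsManifold I ∞ M] {V : Type*} [NormedAddCommGroup V] [NormedSpace ℝ V] [FiniteDimensional ℝ V]

theorem exists_straightening_cutoff {O : Set M} (hO : IsOpen O) {p₀ : M} (hp : p₀ ∈ O) {Φ : M → V}
    (hΦ : ContMDiffOn I 𝓘(ℝ, V) ∞ Φ O) (hs : Function.Surjective (dAt I Φ p₀)) :
    ∃ (K : Submodule ℝ E) (ψ : OpenPartialHomeomorph M (V × K)) (χ : V × K → ℝ),
      p₀ ∈ ψ.source ∧ ψ.source ⊆ O ∧ ContMDiffOn I 𝓘(ℝ, V × K) ∞ ψ ψ.source ∧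
      ContMDiffOn 𝓘(ℝ, V × K) I ∞ ψ.symm ψ.target ∧ (∀ p ∈ ψ.source, (ψ p).1 = Φ p) ∧
      ContDiff ℝ ∞ χ ∧ (∀ᶠ q in 𝓝 (ψ p₀), χ q = 1) ∧ tsupport χ ⊆ ψ.target := by
  obtain ⟨K, ψ, h1, h2, h3, h4, h5⟩ := exists_straightening hO hp hΦ hs
  obtain ⟨χ, hχ, hχ'⟩ := exists_bump 𝓘(ℝ, V × K) (ψ.open_target.mem_nhds (ψ.map_source h1))
  exact ⟨K, ψ, χ, h1, h2, h3, h4, h5, χ.contMDiff.contDiff, hχ, hχ'⟩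

theorem contDiff_cutoff_smul {W V : Type*} [NormedAddCommGroup W] [NormedSpace ℝ W]
    [NormedAddCommGroup V] [NormedSpace ℝ V] {ψ : OpenPartialHomeomorph M W}
    (hψ : ContMDiffOn 𝓘(ℝ, W) I ∞ ψ.symm ψ.target) {χ : W → ℝ} (hχ : ContDiff ℝ ∞ χ)
    (hχ' : tsupport χ ⊆ ψ.target) {F : M → V} (hF : ContMDiffOn I 𝓘(ℝ, V) ∞ F ψ.source) :
    ContDiff ℝ ∞ fun q => χ q • F (ψ.symm q) := by
  refine contDiff_iff_contDiffAt.2 fun q => ?_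
  by_cases hq : q ∈ tsupport χ
  · have h1 : ContMDiffAt 𝓘(ℝ, W) 𝓘(ℝ, V) ∞ (fun q => F (ψ.symm q)) q :=
      (hF.comp hψ fun r hr => ψ.map_target hr).contMDiffAt
        (ψ.open_target.mem_nhds (hχ' hq))
    exact hχ.contDiffAt.smul h1.contDiffAt
  · refine contDiffAt_const (c := (0 : V)) |>.congr_of_eventuallyEq ?_
    filter_upwards [(isClosed_tsupport χ).isOpen_compl.mem_nhds hq] with r hr
    rw [image_eq_zero_of_notMem_tsupport hr, zero_smul]

theorem eventually_of_cutoff {W V : Type*} [NormedAddCommGroup W] [NormedSpace ℝ W]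
    [NormedAddCommGroup V] [NormedSpace ℝ V] {ψ : OpenPartialHomeomorph M W} {p₀ : M}
    (hp : p₀ ∈ ψ.source) {χ : W → ℝ} (hχ : ∀ᶠ q in 𝓝 (ψ p₀), χ q = 1) (F : M → V) :
    ∀ᶠ y in 𝓝 p₀, y ∈ ψ.source ∧ χ (ψ y) • F (ψ.symm (ψ y)) = F y := by
  filter_upwards [(ψ.continuousAt hp).eventually hχ, ψ.open_source.mem_nhds hp] with y hy hys
  exact ⟨hys, by rw [hy, one_smul, ψ.left_inv hys]⟩

/-- A function that vanishes on a regular hypersurface is divisible by its equation. -/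
theorem exists_eq_mul_of_eq_zero {O : Set M} (hO : IsOpen O) {p₀ : M} (hp : p₀ ∈ O) {f k : M → ℝ}
    (hf : ContMDiffOn I 𝓘(ℝ, ℝ) ∞ f O) (hs : Function.Surjective (dAt I f p₀))
    (hk : ContMDiffOn I 𝓘(ℝ, ℝ) ∞ k O) (h : ∀ y ∈ O, f y = 0 → k y = 0) :
    ∃ l : M → ℝ, ContMDiffAt I 𝓘(ℝ, ℝ) ∞ l p₀ ∧ ∀ᶠ y in 𝓝 p₀, k y = l y * f y := by
  obtain ⟨K, ψ, χ, hpψ, hψO, hψ, hψ', hψf, hχ, hχ1, hχs⟩ := exists_straightening_cutoff hO hp hf hs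
  obtain ⟨g, hg, hgk⟩ := exists_eq_smul_of_eq_zero
    (contDiff_cutoff_smul hψ' hχ hχs (hk.mono hψO)) fun w => by
      by_cases hw : ((0 : ℝ), w) ∈ ψ.target
      · have h1 := hψf _ (ψ.map_target hw)
        rw [ψ.right_inv hw] at h1
        rw [h _ (hψO (ψ.map_target hw)) h1.symm, smul_zero]
      · rw [image_eq_zero_of_notMem_tsupport fun h => hw (hχs h), zero_smul]
  refine ⟨fun y => g (ψ y), hg.contMDiff.contMDiffAt.comp p₀
    (hψ.contMDiffAt (ψ.open_source.mem_nhds hpψ)), ?_⟩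
  filter_upwards [eventually_of_cutoff hpψ hχ1 k] with y hy
  rw [← hy.2, hgk, hψf y hy.1, smul_eq_mul, mul_comm]

/-- Complex division, given divisibility of a real part. -/
theorem exists_eq_mul_of_conj_mul_re {O : Set M} (hO : IsOpen O) {p₀ : M} (hp : p₀ ∈ O)
    {f k : M → ℂ} {b : M → ℝ} (hf : ContMDiffOn I 𝓘(ℝ, ℂ) ∞ f O)
    (hs : Function.Surjective (dAt I f p₀)) (hk : ContMDiffOn I 𝓘(ℝ, ℂ) ∞ k O)
    (hb : ContMDiffOn I 𝓘(ℝ, ℝ) ∞ b O)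
    (h : ∀ y ∈ O, (f y).re * (k y).re + (f y).im * (k y).im = ((f y).re ^ 2 + (f y).im ^ 2) * b y) :
    ∃ l : M → ℂ, ContMDiffAt I 𝓘(ℝ, ℂ) ∞ l p₀ ∧ ∀ᶠ y in 𝓝 p₀, k y = l y * f y := by
  obtain ⟨K, ψ, χ, hpψ, hψO, hψ, hψ', hψf, hχ, hχ1, hχs⟩ := exists_straightening_cutoff hO hp hf hs
  obtain ⟨g, hg, hgk⟩ := exists_eq_mul_of_re_eq
    (contDiff_cutoff_smul hψ' hχ hχs (hk.mono hψO)) (contDiff_cutoff_smul hψ' hχ hχs (hb.mono hψO))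
    fun p => by
      by_cases hw : p ∈ ψ.target
      · have h1 := hψf _ (ψ.map_target hw)
        rw [ψ.right_inv hw] at h1
        have h2 := h _ (hψO (ψ.map_target hw))
        rw [← h1] at h2
        simp only [Complex.real_smul, Complex.mul_re, Complex.mul_im, Complex.ofReal_re,
          Complex.ofReal_im, zero_mul, sub_zero, add_zero, smul_eq_mul]
        linear_combination χ p * h2
      · have h1 : χ p = 0 := image_eq_zero_of_notMem_tsupport fun h => hw (hχs h)
        simp [h1]
  refine ⟨fun y => g (ψ y), hg.contMDiff.contMDiffAt.comp p₀
    (hψ.contMDiffAt (ψ.open_source.mem_nhds hpψ)), ?_⟩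
  filter_upwards [eventually_of_cutoff hpψ hχ1 k] with y hy
  rw [← hy.2, hgk, hψf y hy.1, mul_comm]

/-- Complex divisibility can be checked at a dense set of zeros. -/
theorem exists_eq_mul_of_frequently {O : Set M} (hO : IsOpen O) {p₀ : M} (hp : p₀ ∈ O)
    {f k : M → ℂ} (hf : ContMDiffOn I 𝓘(ℝ, ℂ) ∞ f O)
    (hs : Function.Surjective (dAt I f p₀)) (hk : ContMDiffOn I 𝓘(ℝ, ℂ) ∞ k O)
    (h : ∀ y ∈ O, f y = 0 → ∃ᶠ z in 𝓝 y, f z = 0 ∧ ∃ l : M → ℂ, ContMDiffAt I 𝓘(ℝ, ℂ) ∞ l z ∧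
      ∀ᶠ t in 𝓝 z, k t = l t * f t) :
    ∃ l : M → ℂ, ContMDiffAt I 𝓘(ℝ, ℂ) ∞ l p₀ ∧ ∀ᶠ y in 𝓝 p₀, k y = l y * f y := by
  obtain ⟨K, ψ, χ, hpψ, hψO, hψ, hψ', hψf, hχ, hχ1, hχs⟩ := exists_straightening_cutoff hO hp hf hs
  have hdiv : DenselyDivisible (fun q => χ q • k (ψ.symm q)) 1 := by
    intro w
    by_cases hw : ((0 : ℂ), w) ∈ ψ.target
    · have h1 := hψf _ (ψ.map_target hw)
      rw [ψ.right_inv hw] at h1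
      have h2 := h _ (hψO (ψ.map_target hw)) h1.symm
      have h3 : ContinuousAt (fun z => (ψ z).2) (ψ.symm (0, w)) :=
        continuous_snd.continuousAt.comp (ψ.continuousAt (ψ.map_target hw))
      have h4 : Filter.Tendsto (fun z => (ψ z).2) (𝓝 (ψ.symm (0, w))) (𝓝 w) := by
        have h5 := h3.tendsto
        rwa [ψ.right_inv hw] at h5
      refine mem_closure_iff_frequently.2 (h4.frequently ((h2.and_eventually
        (ψ.open_source.mem_nhds (ψ.map_target hw))).mono ?_))
      rintro z ⟨⟨hz, l, hl, hl'⟩, hzs⟩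
      have hzs' : z ∈ ψ.source := hzs
      have h5 : ψ z = (0, (ψ z).2) := Prod.ext ((hψf z hzs).trans hz) rfl
      have h6 : ψ.symm (0, (ψ z).2) = z := by rw [← h5, ψ.left_inv hzs']
      have h7 : ((0 : ℂ), (ψ z).2) ∈ ψ.target := h5 ▸ ψ.map_source hzs'
      have h8 : ContMDiffAt 𝓘(ℝ, ℂ × K) I ∞ ψ.symm (0, (ψ z).2) :=
        hψ'.contMDiffAt (ψ.open_target.mem_nhds h7)
      refine ⟨fun q => χ q • l (ψ.symm q), hχ.contDiffAt.smul ?_, ?_⟩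
      · refine (ContMDiffAt.comp (I' := I) _ ?_ h8).contDiffAt
        rwa [h6]
      · have h9 : Filter.Tendsto ψ.symm (𝓝 (0, (ψ z).2)) (𝓝 z) := by
          have h10 := h8.continuousAt.tendsto
          rwa [h6] at h10
        filter_upwards [h9.eventually hl', ψ.open_target.mem_nhds h7] with q hq hqt
        have h10 := hψf _ (ψ.map_target hqt)
        rw [ψ.right_inv hqt] at h10
        rw [hq, ← h10, pow_one, smul_eq_mul, mul_smul_comm, mul_comm]
    · refine subset_closure ⟨fun _ => 0, contDiffAt_const, ?_⟩
      have h1 : ((0 : ℂ), w) ∉ tsupport χ := fun h => hw (hχs h)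
      filter_upwards [(isClosed_tsupport χ).isOpen_compl.mem_nhds h1] with r hr
      rw [image_eq_zero_of_notMem_tsupport hr, zero_smul, smul_zero]
  obtain ⟨g, hg, hgk⟩ := hdiv.exists_contDiff (contDiff_cutoff_smul hψ' hχ hχs (hk.mono hψO))
  refine ⟨fun y => g (ψ y), hg.contMDiff.contMDiffAt.comp p₀
    (hψ.contMDiffAt (ψ.open_source.mem_nhds hpψ)), ?_⟩
  filter_upwards [eventually_of_cutoff hpψ hχ1 k] with y hy
  rw [← hy.2, hgk, hψf y hy.1, pow_one, smul_eq_mul, mul_comm]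

end ManifoldDivision

/-! ### Characterizations of logarithmic vector fields -/

section Characterizations

variable {E : Type} [NormedAddCommGroup E] [NormedSpace ℝ E] [FiniteDimensional ℝ E]
  {H : Type*} [TopologicalSpace H]
  {I : ModelWithCorners ℝ E H} [I.Boundaryless] {M : Type*} [TopologicalSpace M] [ChartedSpace H M]
  [IsManifold I ∞ M] {ι : Type*} [Fintype ι] {𝕂 : Type*} [RCLike 𝕂]

namespace LocalEquations

theorem contMDiffOn_derivAlong (S : LocalEquations I M ι 𝕂) (X : SmoothVectorField I M) (i : ι)
    (x : M) : ContMDiffOn I 𝓘(ℝ, 𝕂) ∞ (derivAlong I (fun y => X y) (S.f i x)) (S.U x) :=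
  fun _ hy => (contMDiffAt_derivAlong (X.contMDiffAt _) (S.contMDiffAt i hy)).contMDiffWithinAt

theorem exists_multiplier_of_ne_zero (S : LocalEquations I M ι 𝕂) (X : SmoothVectorField I M)
    {i : ι} {x y : M} (hy : y ∈ S.U x) (h : S.f i x y ≠ 0) :
    ∃ l : M → 𝕂, ContMDiffAt I 𝓘(ℝ, 𝕂) ∞ l y ∧
      ∀ᶠ z in 𝓝 y, dAt I (S.f i x) z (X z) = l z * S.f i x z := by
  have h1 := S.contMDiffAt i hy
  refine ⟨fun z => derivAlong I (fun z => X z) (S.f i x) z * (S.f i x z)⁻¹,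
    contMDiffAt_mul_of_algebra (contMDiffAt_derivAlong (X.contMDiffAt y) h1)
      (((contDiffAt_inv ℝ h).contMDiffAt).comp y h1), ?_⟩
  filter_upwards [h1.continuousAt.eventually_ne h] with z hz
  rw [mul_assoc, inv_mul_cancel₀ hz, mul_one]
  rfl

/-- The logarithmic vector fields of hypersurfaces are those tangent to the hypersurfaces. -/
theorem isLogarithmic_iff_of_real (S : LocalEquations I M ι ℝ) {X : SmoothVectorField I M} :
    S.IsLogarithmic X ↔ ∀ i x, S.f i x x = 0 → dAt I (S.f i x) x (X x) = 0 := by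
  refine ⟨fun h i x hx => ?_, fun h => S.isLogarithmic_of_locally fun i x => ⟨x, S.mem_U x, ?_⟩⟩
  · obtain ⟨l, -, hl⟩ := h i x
    rw [hl x (S.mem_U x), hx, mul_zero]
  · by_cases hx : S.f i x x = 0
    · refine exists_eq_mul_of_eq_zero (S.isOpen_U x) (S.mem_U x) (S.contMDiffOn i x)
        (S.surjective_dAt i (S.mem_U x) hx) (S.contMDiffOn_derivAlong X i x) fun y hy hy0 => ?_
      obtain ⟨u, hu, hu'⟩ := S.transition i x y
      have hmem : y ∈ S.U x ∩ S.U y := ⟨hy, S.mem_U y⟩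
      have hmem' := ((S.isOpen_U x).inter (S.isOpen_U y)).mem_nhds hmem
      have h0 : S.f i y y = 0 := by
        have h1 := (hu' y hmem)
        rw [hy0] at h1
        exact (mul_eq_zero.1 h1.2.symm).resolve_left h1.1
      have h1 : S.f i x =ᶠ[𝓝 y] fun z => u z * S.f i y z := by
        filter_upwards [hmem'] with z hz using (hu' z hz).2
      refine (dAt_congr h1 (X y)).trans ?_
      rw [dAt_mul ((hu.contMDiffAt hmem').mdifferentiableAt (by simp))
        (S.mdifferentiableAt i (S.mem_U y)), h0, h i y h0, mul_zero, mul_zero, add_zero]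
    · exact S.exists_multiplier_of_ne_zero X (S.mem_U x) hx

end LocalEquations

end Characterizations

section NormSq

variable {E : Type} [NormedAddCommGroup E] [NormedSpace ℝ E] [FiniteDimensional ℝ E]
  {H : Type*} [TopologicalSpace H]
  {I : ModelWithCorners ℝ E H} [I.Boundaryless] {M : Type*} [TopologicalSpace M] [ChartedSpace H M]
  [IsManifold I ∞ M]

theorem contMDiffAt_normSq {f : M → ℂ} {x : M} (hf : ContMDiffAt I 𝓘(ℝ, ℂ) ∞ f x) :
    ContMDiffAt I 𝓘(ℝ, ℝ) ∞ (fun y => Complex.normSq (f y)) x := by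
  have h1 : ContMDiffAt I 𝓘(ℝ, ℝ) ∞ (fun y => (f y).re) x :=
    Complex.reCLM.contMDiff.contMDiffAt.comp x hf
  have h2 : ContMDiffAt I 𝓘(ℝ, ℝ) ∞ (fun y => (f y).im) x :=
    Complex.imCLM.contMDiff.contMDiffAt.comp x hf
  exact (h1.mul h1).add (h2.mul h2)

theorem dAt_normSq {f : M → ℂ} {x : M} (hf : MDifferentiableAt I 𝓘(ℝ, ℂ) f x)
    (v : TangentSpace I x) : dAt I (fun y => Complex.normSq (f y)) x v =
      2 * ((f x).re * (dAt I f x v).re + (f x).im * (dAt I f x v).im) := by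
  have h1 : MDifferentiableAt I 𝓘(ℝ, ℝ) (fun y => (f y).re) x :=
    Complex.reCLM.contMDiff.mdifferentiableAt (n := ∞) (by simp) |>.comp x hf
  have h2 : MDifferentiableAt I 𝓘(ℝ, ℝ) (fun y => (f y).im) x :=
    Complex.imCLM.contMDiff.mdifferentiableAt (n := ∞) (by simp) |>.comp x hf
  have h3 : dAt I (fun y => (f y).re) x v = (dAt I f x v).re := dAt_clm_comp Complex.reCLM hf v
  have h4 : dAt I (fun y => (f y).im) x v = (dAt I f x v).im := dAt_clm_comp Complex.imCLM hf v
  have h5 : dAt I (fun y => Complex.normSq (f y)) x v =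
    dAt I (fun y => (f y).re * (f y).re + (f y).im * (f y).im) x v := rfl
  rw [h5, dAt_add (f := fun y => (f y).re * (f y).re) (g := fun y => (f y).im * (f y).im)
    (h1.mul h1) (h2.mul h2), dAt_mul h1 h1,
    dAt_mul h2 h2, h3, h4]
  ring

namespace LocalEquations

variable {ι : Type*} [Fintype ι] (S : LocalEquations I M ι ℂ)

/-- Near a zero of one of the equations there are zeros of it at which no other equation
vanishes. -/
theorem frequently_only_zero {i : ι} {x y : M} (hy : y ∈ S.U x) (h0 : S.f i x y = 0) :
    ∃ᶠ z in 𝓝 y, S.f i x z = 0 ∧ ∀ j, j ≠ i → S.f j x z ≠ 0 := by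
  classical
  let Θ : M → ({j // S.f j x y = 0} → ℂ) := fun z j => S.f j x z
  have hΘ : ContMDiffOn I 𝓘(ℝ, {j // S.f j x y = 0} → ℂ) ∞ Θ (S.U x) :=
    contMDiffOn_pi_space.2 fun j => S.contMDiffOn j x
  have hs : Function.Surjective (dAt I Θ y) := fun w => by
    obtain ⟨v, hv⟩ := S.transverse_of_mem hy fun j => if h : S.f j x y = 0 then w ⟨j, h⟩ else 0
    refine ⟨v, funext fun j => ?_⟩
    rw [dAt_pi ((hΘ.contMDiffAt ((S.isOpen_U x).mem_nhds hy)).mdifferentiableAt (by simp)) v j]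
    refine (hv j j.2).trans ?_
    rw [dif_pos j.2]
  have h1 := map_nhds_of_surjective_dAt (S.isOpen_U x) hy hΘ hs
  have h2 : ∃ᶠ w in 𝓝 (Θ y), w ⟨i, h0⟩ = 0 ∧ ∀ j, j ≠ ⟨i, h0⟩ → w j ≠ 0 := by
    have h3 : Θ y = 0 := funext fun j => j.2
    have h4 : Filter.Tendsto (fun (t : ℝ) (j : {j // S.f j x y = 0}) =>
        if j = ⟨i, h0⟩ then (0 : ℂ) else (t : ℂ)) (𝓝[≠] 0) (𝓝 0) := by
      refine tendsto_pi_nhds.2 fun j => ?_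
      split_ifs
      · exact tendsto_const_nhds
      · exact ((Complex.continuous_ofReal.tendsto 0).mono_left nhdsWithin_le_nhds)
    rw [h3]
    refine h4.frequently (Filter.Eventually.frequently ?_)
    filter_upwards [self_mem_nhdsWithin] with t ht
    refine ⟨if_pos rfl, fun j hj => ?_⟩
    rw [if_neg hj]
    exact Complex.ofReal_ne_zero.2 ht
  rw [← h1] at h2
  have h5 : ∀ᶠ z in 𝓝 y, ∀ j, S.f j x y ≠ 0 → S.f j x z ≠ 0 := by
    refine Filter.eventually_all.2 fun j => ?_
    by_cases hj : S.f j x y = 0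
    · exact Filter.Eventually.of_forall fun z h => absurd hj h
    · exact ((S.contMDiffAt j hy).continuousAt.eventually_ne hj).mono fun z hz _ => hz
  refine ((Filter.frequently_map.1 h2).and_eventually h5).mono ?_
  rintro z ⟨⟨hz, hz'⟩, hz2⟩
  refine ⟨hz, fun j hj => ?_⟩
  by_cases hj0 : S.f j x y = 0
  · exact hz' ⟨j, hj0⟩ fun h => hj (congrArg Subtype.val h)
  · exact hz2 j hj0

/-- Vector fields that preserve, up to multiples, the product of the squared norms of the local
equations are logarithmic. -/
theorem isLogarithmic_of_prod_normSq {X : SmoothVectorField I M}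
    (h : ∀ x, ∃ O, IsOpen O ∧ x ∈ O ∧ O ⊆ S.U x ∧ ∃ a : M → ℝ, ContMDiffOn I 𝓘(ℝ, ℝ) ∞ a O ∧
      ∀ y ∈ O, dAt I (fun z => ∏ i, Complex.normSq (S.f i x z)) y (X y) =
        a y * ∏ i, Complex.normSq (S.f i x y)) : S.IsLogarithmic X := by
  classical
  refine S.isLogarithmic_of_locally fun i x => ⟨x, S.mem_U x, ?_⟩
  by_cases hx : S.f i x x = 0
  swap
  · exact S.exists_multiplier_of_ne_zero X (S.mem_U x) hx
  obtain ⟨O, hO, hxO, hOU, a, ha, h⟩ := h x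
  refine exists_eq_mul_of_frequently hO hxO ((S.contMDiffOn i x).mono hOU)
    (S.surjective_dAt i (S.mem_U x) hx) ((S.contMDiffOn_derivAlong X i x).mono hOU)
    fun y hy hy0 => ?_
  refine ((S.frequently_only_zero (hOU hy) hy0).and_eventually (hO.mem_nhds hy)).mono ?_
  rintro z ⟨⟨hz0, hz⟩, hzO⟩
  refine ⟨hz0, ?_⟩
  let R : M → ℝ := fun t => ∏ j ∈ Finset.univ.erase i, Complex.normSq (S.f j x t)
  have hR : ∀ t ∈ O, ContMDiffAt I 𝓘(ℝ, ℝ) ∞ R t := fun t ht =>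
    ContMDiffAt.prod fun j _ => contMDiffAt_normSq (S.contMDiffAt j (hOU ht))
  let O' := O ∩ R ⁻¹' {0}ᶜ
  have hO' : IsOpen O' := ContinuousOn.isOpen_inter_preimage
    (fun t ht => (hR t ht).continuousAt.continuousWithinAt) hO isOpen_compl_singleton
  have hzO' : z ∈ O' := by
    refine ⟨hzO, ?_⟩
    refine Finset.prod_ne_zero_iff.2 fun j hj => ?_
    rw [Ne, Complex.normSq_eq_zero]
    exact hz j (Finset.ne_of_mem_erase hj)
  have hO'O : O' ⊆ O := inter_subset_left
  refine exists_eq_mul_of_conj_mul_re (b := fun t => (a t - derivAlong I (fun t => X t) R t *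
    (R t)⁻¹) * 2⁻¹) hO' hzO' ((S.contMDiffOn i x).mono (hO'O.trans hOU))
    (S.surjective_dAt i (hOU hzO) hz0) ((S.contMDiffOn_derivAlong X i x).mono (hO'O.trans hOU)) ?_ ?_
  · intro t ht
    refine (((ha.contMDiffAt (hO.mem_nhds ht.1)).sub
      ((contMDiffAt_derivAlong (X.contMDiffAt t) (hR t ht.1)).mul
      (((contDiffAt_inv ℝ ht.2).contMDiffAt).comp t (hR t ht.1)))).mul
      contMDiffAt_const).contMDiffWithinAt
  · intro t ht
    have hRt : R t ≠ 0 := ht.2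
    have h1 : (fun z => ∏ i, Complex.normSq (S.f i x z)) =
        fun z => Complex.normSq (S.f i x z) * R z := funext fun z =>
      (Finset.mul_prod_erase Finset.univ (fun i => Complex.normSq (S.f i x z))
        (Finset.mem_univ i)).symm
    have h2 := h t ht.1
    rw [congrFun h1 t, h1, dAt_mul
      ((contMDiffAt_normSq (S.contMDiffAt i (hOU ht.1))).mdifferentiableAt (by simp))
      ((hR t ht.1).mdifferentiableAt (by simp)), dAt_normSq (S.mdifferentiableAt i (hOU ht.1)),
      Complex.normSq_apply] at h2
    change (S.f i x t).re * (dAt I (S.f i x) t (X t)).re +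
      (S.f i x t).im * (dAt I (S.f i x) t (X t)).im =
      ((S.f i x t).re ^ 2 + (S.f i x t).im ^ 2) * ((a t - dAt I R t (X t) * (R t)⁻¹) * 2⁻¹)
    field_simp
    linear_combination h2

end LocalEquations

end NormSq

/-! ### Local equations of sections of line bundles -/

section LineBundle

variable {E : Type*} [NormedAddCommGroup E] [NormedSpace ℝ E]
  {H : Type*} [TopologicalSpace H]
  {I : ModelWithCorners ℝ E H} {M : Type*} [TopologicalSpace M] [ChartedSpace H M]
  [IsManifold I ∞ M] {𝕂 : Type*} [RCLike 𝕂] {L : M → Type*}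
  [∀ x, AddCommGroup (L x)] [∀ x, Module 𝕂 (L x)] [∀ x, Module ℝ (L x)]
  [∀ x, TopologicalSpace (L x)] [TopologicalSpace (TotalSpace 𝕂 L)] [FiberBundle 𝕂 L]
  [VectorBundle 𝕂 𝕂 L] [VectorBundle ℝ 𝕂 L] [ContMDiffVectorBundle ∞ 𝕂 L I]

/-- The section `σ` at the point `y`, read in the preferred trivialization around `x`. -/
def localEquation (σ : Cₛ^∞⟮I; 𝕂, L⟯) (x y : M) : 𝕂 := (trivializationAt 𝕂 L x ⟨y, σ y⟩).2

theorem contMDiffOn_localEquation (σ : Cₛ^∞⟮I; 𝕂, L⟯) (x : M) :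
    ContMDiffOn I 𝓘(ℝ, 𝕂) ∞ (localEquation σ x) (trivializationAt 𝕂 L x).baseSet :=
  ((trivializationAt 𝕂 L x).contMDiffOn_section_baseSet_iff).1 σ.contMDiff.contMDiffOn

theorem contMDiffAt_localEquation (σ : Cₛ^∞⟮I; 𝕂, L⟯) {x y : M}
    (hy : y ∈ (trivializationAt 𝕂 L x).baseSet) :
    ContMDiffAt I 𝓘(ℝ, 𝕂) ∞ (localEquation σ x) y :=
  (contMDiffOn_localEquation σ x).contMDiffAt
    ((trivializationAt 𝕂 L x).open_baseSet.mem_nhds hy)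

theorem eq_smul_frame {x z : M} (hz : z ∈ (trivializationAt 𝕂 L x).baseSet) (v : L z) :
    v = (trivializationAt 𝕂 L x ⟨z, v⟩).2 • (trivializationAt 𝕂 L x).symmL 𝕂 z 1 := by
  have h := (trivializationAt 𝕂 L x).symmL_continuousLinearMapAt (R := 𝕂) hz v
  rw [Trivialization.continuousLinearMapAt_apply, Trivialization.coe_linearMapAt_of_mem _ hz] at h
  rw [← map_smul, smul_eq_mul, mul_one]
  exact h.symm

theorem trivializationAt_smul {x z : M} (hz : z ∈ (trivializationAt 𝕂 L x).baseSet) (c : 𝕂)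
    (v : L z) : (trivializationAt 𝕂 L x ⟨z, c • v⟩).2 = c * (trivializationAt 𝕂 L x ⟨z, v⟩).2 :=
  ((trivializationAt 𝕂 L x).linear 𝕂 hz).map_smul c v

theorem localEquation_eq_zero_iff (σ : Cₛ^∞⟮I; 𝕂, L⟯) {x z : M}
    (hz : z ∈ (trivializationAt 𝕂 L x).baseSet) : localEquation σ x z = 0 ↔ σ z = 0 := by
  constructor
  · intro h
    rw [eq_smul_frame hz (σ z)]
    change localEquation σ x z • _ = _
    rw [h, zero_smul]
  · intro h
    have h1 := trivializationAt_smul hz (0 : 𝕂) (σ z)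
    rw [zero_smul, zero_mul] at h1
    unfold localEquation
    rwa [h]

/-- The transition function between the preferred trivializations around `x` and `y`. -/
def transitionFunction (𝕂 : Type*) [RCLike 𝕂] (L : M → Type*)
    [∀ x, AddCommGroup (L x)] [∀ x, Module 𝕂 (L x)]
    [∀ x, TopologicalSpace (L x)] [TopologicalSpace (TotalSpace 𝕂 L)] [FiberBundle 𝕂 L]
    [VectorBundle 𝕂 𝕂 L] (x y z : M) : 𝕂 :=
  ((trivializationAt 𝕂 L y).coordChangeL 𝕂 (trivializationAt 𝕂 L x) z : 𝕂 →L[𝕂] 𝕂) 1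

theorem contMDiffOn_transitionFunction (x y : M) :
    ContMDiffOn I 𝓘(ℝ, 𝕂) ∞ (transitionFunction 𝕂 L x y)
      ((trivializationAt 𝕂 L x).baseSet ∩ (trivializationAt 𝕂 L y).baseSet) := by
  have h := contMDiffOn_coordChangeL (IB := I) (n := ∞) (trivializationAt 𝕂 L y)
    (trivializationAt 𝕂 L x)
  rw [inter_comm]
  refine (h.clm_apply (contMDiffOn_const (c := (1 : 𝕂)))).congr fun z hz => ?_
  exact (((trivializationAt 𝕂 L y).coordChangeL_apply (R := 𝕂) (trivializationAt 𝕂 L x) hz 1).trans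
    ((trivializationAt 𝕂 L y).coordChangeL_apply (R := ℝ) (trivializationAt 𝕂 L x) hz 1).symm)

theorem transitionFunction_ne_zero (x y z : M) : transitionFunction 𝕂 L x y z ≠ 0 := fun h =>
  one_ne_zero (((trivializationAt 𝕂 L y).coordChangeL 𝕂 (trivializationAt 𝕂 L x) z).injective
    (h.trans (map_zero _).symm))

theorem trivializationAt_eq_transitionFunction_mul {x y z : M}
    (hx : z ∈ (trivializationAt 𝕂 L x).baseSet) (hy : z ∈ (trivializationAt 𝕂 L y).baseSet)
    (v : L z) : (trivializationAt 𝕂 L x ⟨z, v⟩).2 =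
      transitionFunction 𝕂 L x y z * (trivializationAt 𝕂 L y ⟨z, v⟩).2 := by
  conv_lhs => rw [eq_smul_frame hy v]
  rw [trivializationAt_smul hx, mul_comm]
  congr 1
  refine Eq.trans ?_ ((trivializationAt 𝕂 L y).coordChangeL_apply (R := 𝕂)
    (trivializationAt 𝕂 L x) ⟨hy, hx⟩ 1).symm
  rw [Trivialization.symmL_apply _ hy]

end LineBundle

section Families

theorem surjective_pi_of_finrank_quotient {V W κ : Type*} [AddCommGroup V] [Module ℝ V]
    [FiniteDimensional ℝ V] [AddCommGroup W] [Module ℝ W] [FiniteDimensional ℝ W] [Fintype κ]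
    (A : κ → V →ₗ[ℝ] W) (hA : ∀ i, Function.Surjective (A i))
    (h : Module.finrank ℝ (V ⧸ ⨅ i, LinearMap.ker (A i)) =
      ∑ i, Module.finrank ℝ (V ⧸ LinearMap.ker (A i))) : Function.Surjective (LinearMap.pi A) := by
  rw [← LinearMap.range_eq_top]
  refine Submodule.eq_top_of_finrank_eq ?_
  rw [← (LinearMap.pi A).quotKerEquivRange.finrank_eq, LinearMap.ker_pi, h,
    Module.finrank_pi_fintype]
  exact Finset.sum_congr rfl fun i _ => ((A i).quotKerEquivOfSurjective (hA i)).finrank_eq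

variable {E : Type*} [NormedAddCommGroup E] [NormedSpace ℝ E]
  {H : Type*} [TopologicalSpace H]
  {I : ModelWithCorners ℝ E H} {M : Type*} [TopologicalSpace M] [ChartedSpace H M]
  [IsManifold I ∞ M] {𝕂 : Type*} [RCLike 𝕂] {ι : Type*} [Fintype ι] {L : ι → M → Type*}
  [∀ i x, AddCommGroup (L i x)] [∀ i x, Module 𝕂 (L i x)] [∀ i x, Module ℝ (L i x)]
  [∀ i x, TopologicalSpace (L i x)] [∀ i, TopologicalSpace (TotalSpace 𝕂 (L i))]
  [∀ i, FiberBundle 𝕂 (L i)] [∀ i, VectorBundle 𝕂 𝕂 (L i)] [∀ i, VectorBundle ℝ 𝕂 (L i)]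
  [∀ i, ContMDiffVectorBundle ∞ 𝕂 (L i) I]

/-- The local equations of a family of sections whose vertical derivatives at the common zeros are
jointly surjective. -/
def sectionEquations (σ : ∀ i, Cₛ^∞⟮I; 𝕂, L i⟯) (hσ : ∀ x, ∀ w : ι → 𝕂, ∃ v : TangentSpace I x,
    ∀ i, σ i x = 0 → verticalDeriv (σ i) x v = w i) : LocalEquations I M ι 𝕂 where
  f i := localEquation (σ i)
  U x := ⋂ i, (trivializationAt 𝕂 (L i) x).baseSet
  isOpen_U x := isOpen_iInter_of_finite fun i => (trivializationAt 𝕂 (L i) x).open_baseSet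
  mem_U x := mem_iInter.2 fun i => mem_baseSet_trivializationAt 𝕂 (L i) x
  contMDiffOn i x := (contMDiffOn_localEquation (σ i) x).mono (iInter_subset _ i)
  transition i x y := ⟨transitionFunction 𝕂 (L i) x y, (contMDiffOn_transitionFunction x y).mono
    (inter_subset_inter (iInter_subset _ i) (iInter_subset _ i)), fun z hz =>
      ⟨transitionFunction_ne_zero x y z, trivializationAt_eq_transitionFunction_mul
        (mem_iInter.1 hz.1 i) (mem_iInter.1 hz.2 i) _⟩⟩
  transverse x w := by
    obtain ⟨v, hv⟩ := hσ x w
    exact ⟨v, fun i hi => hv i ((localEquation_eq_zero_iff (σ i)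
      (mem_baseSet_trivializationAt 𝕂 (L i) x)).1 hi)⟩

/-- Transversality of the zero loci means joint surjectivity of the vertical derivatives. -/
theorem exists_verticalDeriv_eq [FiniteDimensional ℝ E] {σ : ∀ i, Cₛ^∞⟮I; 𝕂, L i⟯}
    (hσ : ∀ i, VanishesTransversely (σ i)) (ht : ZeroLociTransverse σ) (x : M) (w : ι → 𝕂) :
    ∃ v : TangentSpace I x, ∀ i, σ i x = 0 → verticalDeriv (σ i) x v = w i := by
  classical
  have : FiniteDimensional ℝ (TangentSpace I x) := inferInstanceAs (FiniteDimensional ℝ E)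
  obtain ⟨v, hv⟩ := surjective_pi_of_finrank_quotient
    (fun i : {i // σ i x = 0} => (verticalDeriv (σ i) x).toLinearMap) (fun i => hσ i x i.2) (ht x)
    fun i => w i
  exact ⟨v, fun i hi => congrFun hv ⟨i, hi⟩⟩

end Families

section Tangent

variable {E : Type} [NormedAddCommGroup E] [NormedSpace ℝ E] [FiniteDimensional ℝ E]
  {H : Type*} [TopologicalSpace H]
  {I : ModelWithCorners ℝ E H} [I.Boundaryless] {M : Type*} [TopologicalSpace M] [ChartedSpace H M]
  [IsManifold I ∞ M] {ι : Type*} [Fintype ι] {W : ι → M → Type*}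
  [∀ i x, AddCommGroup (W i x)] [∀ i x, Module ℝ (W i x)] [∀ i x, TopologicalSpace (W i x)]
  [∀ i, TopologicalSpace (TotalSpace ℝ (W i))] [∀ i, FiberBundle ℝ (W i)]
  [∀ i, VectorBundle ℝ ℝ (W i)] [∀ i, ContMDiffVectorBundle ∞ ℝ (W i) I]

theorem tangentFields_eq (s : ∀ i, Cₛ^∞⟮I; ℝ, W i⟯) (hs : ∀ x, ∀ w : ι → ℝ, ∃ v : TangentSpace I x,
    ∀ i, s i x = 0 → verticalDeriv (s i) x v = w i) :
    tangentFields s = {X | (sectionEquations s hs).IsLogarithmic X} := by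
  ext X
  refine Iff.trans ?_ (LocalEquations.isLogarithmic_iff_of_real _).symm
  exact forall_congr' fun i => forall_congr' fun x => imp_congr (localEquation_eq_zero_iff (s i)
    (mem_baseSet_trivializationAt ℝ (W i) x)).symm Iff.rfl

end Tangent

/-! ### Elliptic ideals -/

section EllipticIdeals

variable {E : Type} [NormedAddCommGroup E] [NormedSpace ℝ E] [FiniteDimensional ℝ E]
  {H : Type*} [TopologicalSpace H]
  {I : ModelWithCorners ℝ E H} [I.Boundaryless] {M : Type*} [TopologicalSpace M] [ChartedSpace H M]
  [IsManifold I ∞ M]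

section One

variable {L : M → Type*} [∀ x, AddCommGroup (L x)] [∀ x, Module ℂ (L x)] [∀ x, Module ℝ (L x)]
  [∀ x, TopologicalSpace (L x)] [TopologicalSpace (TotalSpace ℂ L)] [FiberBundle ℂ L]
  [VectorBundle ℂ ℂ L] [VectorBundle ℝ ℂ L] [ContMDiffVectorBundle ∞ ℂ L I]

theorem hermitian_apply_self {x z : M} (h : ∀ x, L x →ₗ⋆[ℂ] L x →ₗ[ℂ] ℂ)
    (hz : z ∈ (trivializationAt ℂ L x).baseSet) (v : L z) :
    (h z v v).re = (h z ((trivializationAt ℂ L x).symm z 1)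
      ((trivializationAt ℂ L x).symm z 1)).re *
      Complex.normSq (trivializationAt ℂ L x ⟨z, v⟩).2 := by
  have h1 := eq_smul_frame hz v
  rw [Trivialization.symmL_apply _ hz] at h1
  generalize (trivializationAt ℂ L x ⟨z, v⟩).2 = c at h1 ⊢
  rw [h1]
  simp only [map_smulₛₗ, LinearMap.smul_apply, smul_eq_mul, Complex.normSq_apply, RingHom.id_apply,
    Complex.mul_re, Complex.mul_im, Complex.conj_re, Complex.conj_im]
  ring

theorem exists_eq_mul_normSq_of_mem_ellipticIdeal {σ : Cₛ^∞⟮I; ℂ, L⟯} {G : C^∞⟮I, M; ℝ⟯}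
    (hG : G ∈ ellipticIdeal σ) (x : M) : ∃ a : M → ℝ,
      ContMDiffOn I 𝓘(ℝ, ℝ) ∞ a (trivializationAt ℂ L x).baseSet ∧
      ∀ y ∈ (trivializationAt ℂ L x).baseSet,
        G y = a y * Complex.normSq (localEquation σ x y) := by
  obtain ⟨h, hh, hG⟩ := hG
  exact ⟨_, hh.smooth x, fun y hy => (hG y).trans (hermitian_apply_self h hy (σ y))⟩

/-- The Hermitian form with a given value at the frame given by the preferred trivialization. -/
def hermitianForm (L : M → Type*) [∀ x, AddCommGroup (L x)] [∀ x, Module ℂ (L x)]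
    [∀ x, TopologicalSpace (L x)] [TopologicalSpace (TotalSpace ℂ L)] [FiberBundle ℂ L]
    [VectorBundle ℂ ℂ L] (A : M → ℝ) (z : M) : L z →ₗ⋆[ℂ] L z →ₗ[ℂ] ℂ :=
  LinearMap.mk₂'ₛₗ (starRingEnd ℂ) (RingHom.id ℂ)
    (fun u v => (A z : ℂ) * (starRingEnd ℂ ((trivializationAt ℂ L z).linearMapAt ℂ z u) *
      (trivializationAt ℂ L z).linearMapAt ℂ z v))
    (fun u u' v => by rw [map_add, map_add]; ring)
    (fun c u v => by rw [map_smul, smul_eq_mul, smul_eq_mul, map_mul]; ring)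
    (fun u v v' => by rw [map_add]; ring)
    (fun c u v => by rw [map_smul, smul_eq_mul, smul_eq_mul, RingHom.id_apply]; ring)

theorem hermitianForm_self (A : M → ℝ) {z : M} (u : L z) : (hermitianForm L A z u u).re =
    A z * Complex.normSq (trivializationAt ℂ L z ⟨z, u⟩).2 := by
  have h1 : (trivializationAt ℂ L z).linearMapAt ℂ z u = (trivializationAt ℂ L z ⟨z, u⟩).2 := by
    rw [Trivialization.coe_linearMapAt_of_mem _ (mem_baseSet_trivializationAt ℂ L z)]
  change ((A z : ℂ) * (starRingEnd ℂ ((trivializationAt ℂ L z).linearMapAt ℂ z u) *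
      (trivializationAt ℂ L z).linearMapAt ℂ z u)).re = _
  rw [h1, ← Complex.normSq_eq_conj_mul_self, ← Complex.ofReal_mul, Complex.ofReal_re]

theorem frequently_localEquation_ne_zero {σ : Cₛ^∞⟮I; ℂ, L⟯} (hσ : VanishesTransversely σ) {x y : M}
    (hy : y ∈ (trivializationAt ℂ L x).baseSet) : ∃ᶠ z in 𝓝 y, localEquation σ x z ≠ 0 :=
  (sectionEquations (fun _ : Unit => σ) fun x w => by
    by_cases h0 : σ x = 0
    · obtain ⟨v, hv⟩ := hσ x h0 (w ())
      exact ⟨v, fun _ _ => hv⟩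
    · exact ⟨0, fun _ h => absurd h h0⟩).frequently_ne_zero () (mem_iInter.2 fun _ => hy)

theorem mem_ellipticIdeal_of_locally {σ : Cₛ^∞⟮I; ℂ, L⟯} (hσ : VanishesTransversely σ)
    {G : C^∞⟮I, M; ℝ⟯} (h : ∀ x, ∃ a : M → ℝ, ContMDiffAt I 𝓘(ℝ, ℝ) ∞ a x ∧
      ∀ᶠ y in 𝓝 x, G y = a y * Complex.normSq (localEquation σ x y)) : G ∈ ellipticIdeal σ := by
  choose a ha hG using h
  refine ⟨hermitianForm L fun z => a z z, ⟨fun z u v => ?_, fun x₀ x hx => ?_⟩, fun x => ?_⟩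
  · change starRingEnd ℂ (((a z z : ℝ) : ℂ) * (starRingEnd ℂ ((trivializationAt ℂ L z).linearMapAt ℂ z u) *
      (trivializationAt ℂ L z).linearMapAt ℂ z v)) = ((a z z : ℝ) : ℂ) * (starRingEnd ℂ
      ((trivializationAt ℂ L z).linearMapAt ℂ z v) * (trivializationAt ℂ L z).linearMapAt ℂ z u)
    rw [map_mul, map_mul, Complex.conj_conj, Complex.conj_ofReal]
    ring
  · have hxx := mem_baseSet_trivializationAt ℂ L x
    have h1 : ContMDiffAt I 𝓘(ℝ, ℝ) ∞ (fun z => a x z *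
        Complex.normSq (transitionFunction ℂ L x x₀ z)) x :=
      (ha x).mul (contMDiffAt_normSq ((contMDiffOn_transitionFunction (I := I) x x₀).contMDiffAt
        (((trivializationAt ℂ L x).open_baseSet.inter
          (trivializationAt ℂ L x₀).open_baseSet).mem_nhds ⟨hxx, hx⟩)))
    refine (h1.congr_of_eventuallyEq ?_).contMDiffWithinAt
    have hc : ∀ᶠ z in 𝓝 x, ContinuousAt (a x) z := by
      have h1 : ContMDiffAt I 𝓘(ℝ, ℝ) 1 (a x) x := (ha x).of_le (by simp)
      filter_upwards [(contMDiffAt_iff_contMDiffAt_nhds (by simp)).1 h1] with z hz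
      exact hz.continuousAt
    filter_upwards [hc, (hG x).eventually_nhds, (trivializationAt ℂ L x).open_baseSet.mem_nhds hxx,
      (trivializationAt ℂ L x₀).open_baseSet.mem_nhds hx] with z hz hGz hzx hz₀
    have hzz := mem_baseSet_trivializationAt ℂ L z
    have h2 : a z z = a x z * Complex.normSq (transitionFunction ℂ L x z z) := by
      have ht : ContinuousAt (fun t => a x t * Complex.normSq (transitionFunction ℂ L x z t)) z :=
        hz.mul (contMDiffAt_normSq ((contMDiffOn_transitionFunction (I := I) x z).contMDiffAt
        (((trivializationAt ℂ L x).open_baseSet.inter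
          (trivializationAt ℂ L z).open_baseSet).mem_nhds ⟨hzx, hzz⟩))).continuousAt
      refine tendsto_nhds_unique_of_frequently_eq (ha z).continuousAt ht
        (((frequently_localEquation_ne_zero hσ hzz).and_eventually ((hG z).and (hGz.and
        (((trivializationAt ℂ L x).open_baseSet.inter
          (trivializationAt ℂ L z).open_baseSet).mem_nhds ⟨hzx, hzz⟩)))).mono ?_)
      rintro t ⟨ht0, ht1, ht2, ht3⟩
      have h3 : localEquation σ x t = transitionFunction ℂ L x z t * localEquation σ z t :=
        trivializationAt_eq_transitionFunction_mul ht3.1 ht3.2 _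
      rw [h3, ht1, Complex.normSq_mul, ← mul_assoc] at ht2
      exact mul_right_cancel₀ (fun h => ht0 (Complex.normSq_eq_zero.1 h)) ht2
    rw [hermitianForm_self, h2, mul_assoc, ← Complex.normSq_mul,
      ← trivializationAt_eq_transitionFunction_mul hzx hzz,
      trivializationAt_eq_transitionFunction_mul hzx hz₀]
    congr 2
    have h4 := (trivializationAt ℂ L x₀).continuousLinearMapAt_symmL (R := ℂ) hz₀ 1
    rw [Trivialization.symmL_apply _ hz₀, Trivialization.continuousLinearMapAt_apply,
      Trivialization.coe_linearMapAt_of_mem _ hz₀] at h4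
    exact (congrArg _ h4).trans (mul_one _)
  · rw [hermitianForm_self]
    exact (hG x).self_of_nhds

end One

/-- The derivative of a function along a vector field, as a smooth function. -/
def SmoothVectorField.deriv (X : SmoothVectorField I M) (G : C^∞⟮I, M; ℝ⟯) : C^∞⟮I, M; ℝ⟯ :=
  ⟨derivAlong I (fun x => X x) G, fun x => contMDiffAt_derivAlong (X.contMDiffAt x) (G.contMDiff x)⟩

theorem mem_preservingFields_iff {𝔞 : Ideal C^∞⟮I, M; ℝ⟯} {X : SmoothVectorField I M} :
    X ∈ preservingFields 𝔞 ↔ ∀ G ∈ 𝔞, X.deriv G ∈ 𝔞 := by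
  refine forall₂_congr fun G hG => ⟨?_, fun h => ⟨_, h, fun _ => rfl⟩⟩
  rintro ⟨g, hg, hg'⟩
  have h1 : X.deriv G = g := ContMDiffMap.ext fun x => (hg' x).symm
  rwa [h1]

theorem SmoothVectorField.deriv_add (X : SmoothVectorField I M) (F G : C^∞⟮I, M; ℝ⟯) :
    X.deriv (F + G) = X.deriv F + X.deriv G :=
  ContMDiffMap.ext fun x => dAt_add (F.contMDiff.mdifferentiableAt (by simp))
    (G.contMDiff.mdifferentiableAt (by simp)) _

theorem SmoothVectorField.deriv_mul (X : SmoothVectorField I M) (F G : C^∞⟮I, M; ℝ⟯) :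
    X.deriv (F * G) = X.deriv F * G + F * X.deriv G :=
  ContMDiffMap.ext fun x => dAt_mul (F.contMDiff.mdifferentiableAt (by simp))
    (G.contMDiff.mdifferentiableAt (by simp)) _

theorem mem_preservingFields_mul {𝔞 𝔟 : Ideal C^∞⟮I, M; ℝ⟯} {X : SmoothVectorField I M}
    (h𝔞 : X ∈ preservingFields 𝔞) (h𝔟 : X ∈ preservingFields 𝔟) :
    X ∈ preservingFields (𝔞 * 𝔟) := by
  rw [mem_preservingFields_iff] at *
  intro G hG
  refine Submodule.mul_induction_on hG (fun F hF G hG => ?_) fun F G hF hG => ?_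
  · rw [X.deriv_mul]
    exact add_mem (Ideal.mul_mem_mul (h𝔞 F hF) hG) (Ideal.mul_mem_mul hF (h𝔟 G hG))
  · rw [X.deriv_add]
    exact add_mem hF hG

theorem mem_preservingFields_prod {ι : Type*} {𝔞 : ι → Ideal C^∞⟮I, M; ℝ⟯}
    {X : SmoothVectorField I M} (h : ∀ i, X ∈ preservingFields (𝔞 i)) (s : Finset ι) :
    X ∈ preservingFields (∏ i ∈ s, 𝔞 i) := by
  classical
  induction s using Finset.induction_on with
  | empty =>
    rw [Finset.prod_empty, mem_preservingFields_iff, Ideal.one_eq_top]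
    exact fun _ _ => trivial
  | insert i s hi ih =>
    rw [Finset.prod_insert hi]
    exact mem_preservingFields_mul (h i) ih

section Several

variable {ι : Type*} [Fintype ι] {L : ι → M → Type*}
  [∀ i x, AddCommGroup (L i x)] [∀ i x, Module ℂ (L i x)] [∀ i x, Module ℝ (L i x)]
  [∀ i x, TopologicalSpace (L i x)] [∀ i, TopologicalSpace (TotalSpace ℂ (L i))]
  [∀ i, FiberBundle ℂ (L i)] [∀ i, VectorBundle ℂ ℂ (L i)] [∀ i, VectorBundle ℝ ℂ (L i)]
  [∀ i, ContMDiffVectorBundle ∞ ℂ (L i) I]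

theorem exists_eq_mul_normSq_of_mem_prod {σ : ∀ i, Cₛ^∞⟮I; ℂ, L i⟯} (s : Finset ι)
    {G : C^∞⟮I, M; ℝ⟯} (hG : G ∈ ∏ i ∈ s, ellipticIdeal (σ i)) (x : M) : ∃ a : M → ℝ,
      ContMDiffOn I 𝓘(ℝ, ℝ) ∞ a (⋂ i, (trivializationAt ℂ (L i) x).baseSet) ∧
      ∀ y ∈ ⋂ i, (trivializationAt ℂ (L i) x).baseSet,
        G y = a y * ∏ i ∈ s, Complex.normSq (localEquation (σ i) x y) := by
  classical
  induction s using Finset.induction_on generalizing G with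
  | empty => exact ⟨G, G.contMDiff.contMDiffOn, fun y _ => by simp⟩
  | insert i s hi ih =>
    rw [Finset.prod_insert hi] at hG
    refine Submodule.mul_induction_on hG (fun F hF G hG => ?_) fun F G hF hG => ?_
    · obtain ⟨a, ha, haF⟩ := exists_eq_mul_normSq_of_mem_ellipticIdeal hF x
      obtain ⟨b, hb, hbG⟩ := ih hG
      refine ⟨fun y => a y * b y, (ha.mono (iInter_subset _ i)).mul hb, fun y hy => ?_⟩
      rw [Finset.prod_insert hi]
      change F y * G y = _
      rw [haF y (mem_iInter.1 hy i), hbG y hy]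
      ring
    · obtain ⟨a, ha, haF⟩ := hF
      obtain ⟨b, hb, hbG⟩ := hG
      refine ⟨fun y => a y + b y, ha.add hb, fun y hy => ?_⟩
      change F y + G y = _
      rw [haF y hy, hbG y hy]
      ring

theorem mem_ellipticIdeal_cutoff {L : M → Type*} [∀ x, AddCommGroup (L x)] [∀ x, Module ℂ (L x)]
    [∀ x, Module ℝ (L x)] [∀ x, TopologicalSpace (L x)] [TopologicalSpace (TotalSpace ℂ L)]
    [FiberBundle ℂ L] [VectorBundle ℂ ℂ L] [VectorBundle ℝ ℂ L] [ContMDiffVectorBundle ∞ ℂ L I]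
    [T2Space M] {σ : Cₛ^∞⟮I; ℂ, L⟯} (hσ : VanishesTransversely σ) (x : M) :
    ∃ G ∈ ellipticIdeal σ, ∀ᶠ y in 𝓝 x, G y = Complex.normSq (localEquation σ x y) := by
  have hxx := mem_baseSet_trivializationAt ℂ L x
  have hopen := (trivializationAt ℂ L x).open_baseSet
  obtain ⟨χ, hχ, hχ'⟩ := exists_bump I (hopen.mem_nhds hxx)
  have hoff : ∀ y ∉ tsupport χ, ∀ᶠ z in 𝓝 y, χ z = 0 := fun y hy => by
    filter_upwards [(isClosed_tsupport χ).isOpen_compl.mem_nhds hy] with z hz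
    exact image_eq_zero_of_notMem_tsupport hz
  refine ⟨⟨fun y => χ y * Complex.normSq (localEquation σ x y), fun y => ?_⟩, ?_, ?_⟩
  · by_cases hy : y ∈ tsupport χ
    · exact (χ.contMDiff y).mul (contMDiffAt_normSq (contMDiffAt_localEquation σ (hχ' hy)))
    · refine (contMDiffAt_const (c := (0 : ℝ))).congr_of_eventuallyEq ?_
      filter_upwards [hoff y hy] with z hz
      rw [hz, zero_mul]
  · refine mem_ellipticIdeal_of_locally hσ fun y => ?_
    by_cases hy : y ∈ tsupport χ
    · have hmem := (hopen.inter (trivializationAt ℂ L y).open_baseSet).mem_nhds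
        ⟨hχ' hy, mem_baseSet_trivializationAt ℂ L y⟩
      refine ⟨fun z => χ z * Complex.normSq (transitionFunction ℂ L x y z), (χ.contMDiff y).mul
        (contMDiffAt_normSq ((contMDiffOn_transitionFunction (I := I) x y).contMDiffAt hmem)), ?_⟩
      filter_upwards [hmem] with z hz
      have h3 : localEquation σ x z = transitionFunction ℂ L x y z * localEquation σ y z :=
        trivializationAt_eq_transitionFunction_mul hz.1 hz.2 _
      change χ z * Complex.normSq (localEquation σ x z) = _
      rw [h3, Complex.normSq_mul, mul_assoc]
    · refine ⟨fun _ => 0, contMDiffAt_const, ?_⟩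
      filter_upwards [hoff y hy] with z hz
      change χ z * Complex.normSq (localEquation σ x z) = _
      rw [hz, zero_mul, zero_mul]
  · filter_upwards [hχ] with y hy
    change χ y * Complex.normSq (localEquation σ x y) = _
    rw [hy, one_mul]

theorem preservingFields_eq [T2Space M] {σ : ∀ i, Cₛ^∞⟮I; ℂ, L i⟯}
    (hσ : ∀ i, VanishesTransversely (σ i))
    (hs : ∀ x, ∀ w : ι → ℂ, ∃ v : TangentSpace I x,
      ∀ i, σ i x = 0 → verticalDeriv (σ i) x v = w i) :
    preservingFields (∏ i, ellipticIdeal (σ i)) =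
      {X | (sectionEquations σ hs).IsLogarithmic X} := by
  ext X
  constructor
  · intro hX
    rw [mem_preservingFields_iff] at hX
    refine LocalEquations.isLogarithmic_of_prod_normSq _ fun x => ?_
    choose F hF hF' using fun i => mem_ellipticIdeal_cutoff (hσ i) x
    have h1 : ∏ i, F i ∈ ∏ i, ellipticIdeal (σ i) := Ideal.prod_mem_prod fun i _ => hF i
    obtain ⟨a, ha, ha'⟩ := exists_eq_mul_normSq_of_mem_prod Finset.univ (hX _ h1) x
    have h2 : ∀ᶠ y in 𝓝 x, (∏ i, F i : C^∞⟮I, M; ℝ⟯) y =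
        ∏ i, Complex.normSq (localEquation (σ i) x y) := by
      filter_upwards [Filter.eventually_all.2 hF'] with y hy
      rw [show (∏ i, F i : C^∞⟮I, M; ℝ⟯) y = ∏ i, F i y from
        map_prod (ContMDiffMap.evalRingHom y) F Finset.univ]
      exact Finset.prod_congr rfl fun i _ => hy i
    obtain ⟨O, hO, hOo, hxO⟩ := mem_nhds_iff.1 (Filter.inter_mem h2
      (((sectionEquations σ hs).isOpen_U x).mem_nhds ((sectionEquations σ hs).mem_U x)))
    refine ⟨O, hOo, hxO, fun y hy => (hO hy).2, a, ha.mono fun y hy => (hO hy).2, fun y hy => ?_⟩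
    refine Eq.trans (dAt_congr ?_ (X y)) (ha' y (hO hy).2)
    filter_upwards [hOo.mem_nhds hy] with z hz using (hO hz).1.symm
  · intro hX
    refine mem_preservingFields_prod (fun i => mem_preservingFields_iff.2 fun G hG => ?_) _
    refine mem_ellipticIdeal_of_locally (hσ i) fun x => ?_
    obtain ⟨a, ha, haG⟩ := exists_eq_mul_normSq_of_mem_ellipticIdeal hG x
    obtain ⟨l, hl, hl'⟩ := hX i x
    have hxx := mem_baseSet_trivializationAt ℂ (L i) x
    have hopen := (trivializationAt ℂ (L i) x).open_baseSet
    have hU := ((sectionEquations σ hs).isOpen_U x).mem_nhds ((sectionEquations σ hs).mem_U x)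
    have hax := ha.contMDiffAt (hopen.mem_nhds hxx)
    have hlre : ContMDiffAt I 𝓘(ℝ, ℝ) ∞ (fun y => (l y).re) x :=
      Complex.reCLM.contMDiff.contMDiffAt.comp x (hl.contMDiffAt hU)
    refine ⟨fun y => derivAlong I (fun y => X y) a y + 2 * (a y * (l y).re),
      (contMDiffAt_derivAlong (X.contMDiffAt x) hax).add
        (contMDiffAt_const.mul (hax.mul hlre)), ?_⟩
    filter_upwards [hU, hopen.mem_nhds hxx] with y hyU hy
    have h1 : G =ᶠ[𝓝 y] fun z => a z * Complex.normSq (localEquation (σ i) x z) := by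
      filter_upwards [hopen.mem_nhds hy] with z hz using haG z hz
    have hf := contMDiffAt_localEquation (σ i) hy
    refine (dAt_congr h1 (X y)).trans ?_
    rw [dAt_mul ((ha.contMDiffAt (hopen.mem_nhds hy)).mdifferentiableAt (by simp))
      ((contMDiffAt_normSq hf).mdifferentiableAt (by simp)),
      dAt_normSq (hf.mdifferentiableAt (by simp))]
    have h2 : dAt I (localEquation (σ i) x) y (X y) = l y * localEquation (σ i) x y := hl' y hyU
    rw [h2, Complex.normSq_apply, Complex.mul_re, Complex.mul_im]
    change dAt I a y (X y) * _ + _ = (dAt I a y (X y) + _) * _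
    ring

end Several

end EllipticIdeals

/-! ### Open subsets of vector bundles -/

section LocalSections

variable {E : Type*} [NormedAddCommGroup E] [NormedSpace ℝ E] [FiniteDimensional ℝ E]
  {H : Type*} [TopologicalSpace H]
  {I : ModelWithCorners ℝ E H} {M : Type*} [TopologicalSpace M] [ChartedSpace H M]
  {E' : Type*} [NormedAddCommGroup E'] [NormedSpace ℝ E'] [FiniteDimensional ℝ E']
  {H' : Type*} [TopologicalSpace H']
  {J : ModelWithCorners ℝ E' H'} {N : Type*} [TopologicalSpace N] [ChartedSpace H' N]
  {F : Type*} [NormedAddCommGroup F] [NormedSpace ℝ F] [FiniteDimensional ℝ F]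

/-- A map with a differentiable local section, between spaces of the same dimension, has bijective
derivative. -/
theorem bijective_mfderiv_of_section (hdim : Module.finrank ℝ E' = Module.finrank ℝ (E × F))
    {φ : N → M} {c : N → F} {γ : M × F → N} {p : N} (hφ : MDifferentiableAt J I φ p)
    (hc : MDifferentiableAt J 𝓘(ℝ, F) c p)
    (hγ : MDifferentiableAt (I.prod 𝓘(ℝ, F)) J γ (φ p, c p)) (hp : γ (φ p, c p) = p)
    (h : ∀ᶠ q in 𝓝 (φ p, c p), φ (γ q) = q.1 ∧ c (γ q) = q.2) :
    Function.Bijective (fun v : TangentSpace J p => ((mfderiv J I φ p v, dAt J c p v) :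
      TangentSpace I (φ p) × F)) := by
  let A : E' →ₗ[ℝ] E × F :=
    (mfderiv J I φ p : E' →L[ℝ] E).toLinearMap.prod (dAt J c p : E' →L[ℝ] F).toLinearMap
  have hA : Function.Surjective A := by
    rintro ⟨u, w⟩
    let v : E' := mfderiv (I.prod 𝓘(ℝ, F)) J γ (φ p, c p) (u, w)
    refine ⟨v, Prod.ext ?_ ?_⟩
    · have h1 : MDifferentiableAt J I φ (γ (φ p, c p)) := by rwa [hp]
      have h2 := mfderiv_comp_apply (φ p, c p) h1 hγ (u, w)
      have h3 : φ ∘ γ =ᶠ[𝓝 (φ p, c p)] Prod.fst := h.mono fun q hq => hq.1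
      rw [h3.mfderiv_eq, mfderiv_fst] at h2
      have h4 : ∀ q : N, q = p → (mfderiv J I φ q v : E) = (mfderiv J I φ p v : E) := by
        rintro q rfl; rfl
      exact (h4 _ hp).symm.trans h2.symm
    · have h1 : MDifferentiableAt J 𝓘(ℝ, F) c (γ (φ p, c p)) := by rwa [hp]
      have h2 := mfderiv_comp_apply (φ p, c p) h1 hγ (u, w)
      have h3 : c ∘ γ =ᶠ[𝓝 (φ p, c p)] Prod.snd := h.mono fun q hq => hq.2
      rw [h3.mfderiv_eq, mfderiv_snd] at h2
      have h4 : ∀ q : N, q = p → (dAt J c q v : F) = (dAt J c p v : F) := by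
        rintro q rfl; rfl
      exact (h4 _ hp).symm.trans h2.symm
  exact ⟨(LinearMap.injective_iff_surjective_of_finrank_eq_finrank hdim).2 hA, hA⟩

end LocalSections

section OpenSubbundle

variable {E : Type*} [NormedAddCommGroup E] [NormedSpace ℝ E] [FiniteDimensional ℝ E]
  {H : Type*} [TopologicalSpace H]
  {I : ModelWithCorners ℝ E H} {M : Type*} [TopologicalSpace M] [ChartedSpace H M]
  [IsManifold I ∞ M]
  {F : Type*} [NormedAddCommGroup F] [NormedSpace ℝ F] [FiniteDimensional ℝ F]
  {V : M → Type*} [∀ x, AddCommGroup (V x)] [∀ x, Module ℝ (V x)] [∀ x, TopologicalSpace (V x)]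
  [TopologicalSpace (TotalSpace F V)] [FiberBundle F V] [VectorBundle ℝ F V]
  [ContMDiffVectorBundle ∞ F V I]

theorem t2Space_totalSpace {M F : Type*} {V : M → Type*} [TopologicalSpace M] [TopologicalSpace F]
    [TopologicalSpace (TotalSpace F V)] [∀ x, TopologicalSpace (V x)] [FiberBundle F V] [T2Space M]
    [T2Space F] : T2Space (TotalSpace F V) := by
  refine ⟨fun p q hpq => ?_⟩
  by_cases h : p.1 = q.1
  · set e := trivializationAt F V p.1
    have hp : p ∈ e.source := e.mem_source.2 (mem_baseSet_trivializationAt F V p.1)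
    have hq : q ∈ e.source := e.mem_source.2 (h ▸ mem_baseSet_trivializationAt F V p.1)
    obtain ⟨u, v, hu, hv, hpu, hqv, huv⟩ := t2_separation fun h => hpq (e.injOn hp hq h)
    exact ⟨e.source ∩ e ⁻¹' u, e.source ∩ e ⁻¹' v,
      e.continuousOn_toFun.isOpen_inter_preimage e.open_source hu,
      e.continuousOn_toFun.isOpen_inter_preimage e.open_source hv, ⟨hp, hpu⟩, ⟨hq, hqv⟩,
      (huv.preimage e).mono inter_subset_right inter_subset_right⟩
  · obtain ⟨u, v, hu, hv, hpu, hqv, huv⟩ := t2_separation h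
    exact ⟨_, _, hu.preimage (FiberBundle.continuous_proj F V),
      hv.preimage (FiberBundle.continuous_proj F V), hpu, hqv, huv.preimage _⟩

theorem contMDiff_proj_opens (N : TopologicalSpace.Opens (TotalSpace F V)) :
    ContMDiff (I.prod 𝓘(ℝ, F)) I ∞ fun p : N => p.1.1 :=
  (contMDiff_proj V).comp contMDiff_subtype_val

theorem contMDiffOn_fibreCoordinate (N : TopologicalSpace.Opens (TotalSpace F V)) (x : M) :
    ContMDiffOn (I.prod 𝓘(ℝ, F)) 𝓘(ℝ, F) ∞ (fun p : N => (trivializationAt F V x p.1).2)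
      ((fun p : N => p.1.1) ⁻¹' (trivializationAt F V x).baseSet) := fun _ hp =>
  (((((trivializationAt F V x).contMDiffOn (IB := I) (n := ∞)).contMDiffAt
    ((trivializationAt F V x).open_source.mem_nhds ((trivializationAt F V x).mem_source.2 hp))).snd).comp
    _ contMDiff_subtype_val.contMDiffAt).contMDiffWithinAt

theorem bijective_fibreCoordinate (N : TopologicalSpace.Opens (TotalSpace F V)) {x : M} {p : N}
    (hp : p.1.1 ∈ (trivializationAt F V x).baseSet) :
    Function.Bijective (fun v : TangentSpace (I.prod 𝓘(ℝ, F)) p =>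
      ((mfderiv (I.prod 𝓘(ℝ, F)) I (fun p : N => p.1.1) p v,
        dAt (I.prod 𝓘(ℝ, F)) (fun p : N => (trivializationAt F V x p.1).2) p v) :
      TangentSpace I p.1.1 × F)) := by
  classical
  set e := trivializationAt F V x
  have hps : p.1 ∈ e.source := e.mem_source.2 hp
  let G : M × F → TotalSpace F V := e.toOpenPartialHomeomorph.symm
  have hq₀ : ((p.1.1, (e p.1).2) : M × F) = e p.1 := Prod.ext (e.coe_fst hps).symm rfl
  have hq₀t : ((p.1.1, (e p.1).2) : M × F) ∈ e.target := by
    rw [hq₀]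
    exact e.map_source hps
  have hG₀ : G (p.1.1, (e p.1).2) = p.1 := (congrArg G hq₀).trans (e.left_inv hps)
  have hGs : ContMDiffAt (I.prod 𝓘(ℝ, F)) (I.prod 𝓘(ℝ, F)) ∞ G (p.1.1, (e p.1).2) :=
    (e.contMDiffOn_symm (IB := I) (n := ∞)).contMDiffAt (e.open_target.mem_nhds hq₀t)
  have hGN : G (p.1.1, (e p.1).2) ∈ N := by
    rw [hG₀]
    exact p.2
  have hN : ∀ᶠ q in 𝓝 (p.1.1, (e p.1).2), G q ∈ N := hGs.continuousAt (N.2.mem_nhds hGN)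
  let γ : M × F → N := fun q => if h : G q ∈ N then ⟨G q, h⟩ else p
  have hγ : ∀ q, G q ∈ N → (γ q).1 = G q := fun q h => by
    simp only [γ, dif_pos h]
  refine bijective_mfderiv_of_section (γ := γ) ?_ ((contMDiff_proj_opens N).mdifferentiableAt (by simp))
    (((contMDiffOn_fibreCoordinate N x).contMDiffAt ((e.open_baseSet.preimage
      (contMDiff_proj_opens (I := I) N).continuous).mem_nhds hp)).mdifferentiableAt (by simp)) ?_ ?_ ?_
  · rfl
  · refine ((ContMDiffAt.subtypeVal_comp_iff N γ _).1 ?_).mdifferentiableAt (by simp)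
    exact hGs.congr_of_eventuallyEq (hN.mono fun q hq => hγ q hq)
  · exact Subtype.ext ((hγ _ hN.self_of_nhds).trans hG₀)
  · filter_upwards [hN, e.open_target.mem_nhds hq₀t] with q hq hqt
    rw [hγ q hq]
    exact ⟨e.proj_symm_apply hqt, congrArg Prod.snd (e.right_inv hqt)⟩

/-- Smoothness of maps to an open subset of a vector bundle. -/
theorem contMDiff_opens_iff {E' : Type*} [NormedAddCommGroup E'] [NormedSpace ℝ E']
    {H' : Type*} [TopologicalSpace H'] {J : ModelWithCorners ℝ E' H'} {P : Type*}
    [TopologicalSpace P] [ChartedSpace H' P] {N : TopologicalSpace.Opens (TotalSpace F V)}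
    {g : P → N} (h1 : ContMDiff J I ∞ fun q => (g q).1.1)
    (h2 : ∀ q, ContMDiffAt J 𝓘(ℝ, F) ∞ (fun r => (trivializationAt F V (g q).1.1 (g r).1).2) q) :
    ContMDiff J (I.prod 𝓘(ℝ, F)) ∞ g := fun q => by
  refine (ContMDiffAt.subtypeVal_comp_iff N g q).1 ?_
  exact contMDiffAt_totalSpace.2 ⟨h1 q, h2 q⟩

end OpenSubbundle

/-! ### Punctured duals of line bundles -/

section PuncturedOne

variable {E : Type*} [NormedAddCommGroup E] [NormedSpace ℝ E] [FiniteDimensional ℝ E]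
  {H : Type*} [TopologicalSpace H]
  {I : ModelWithCorners ℝ E H} [I.Boundaryless] {M : Type*} [TopologicalSpace M] [ChartedSpace H M]
  [IsManifold I ∞ M] {𝕂 : Type*} [RCLike 𝕂] {L : M → Type*}
  [∀ x, AddCommGroup (L x)] [∀ x, Module 𝕂 (L x)] [∀ x, Module ℝ (L x)]
  [∀ x, TopologicalSpace (L x)] [TopologicalSpace (TotalSpace 𝕂 L)] [FiberBundle 𝕂 L]
  [VectorBundle 𝕂 𝕂 L] [VectorBundle ℝ 𝕂 L] [ContMDiffVectorBundle ∞ 𝕂 L I]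

theorem trivializationAt_dualBundle (x y : M) (ξ : DualBundle 𝕂 L y) :
    (trivializationAt 𝕂 (DualBundle 𝕂 L) x ⟨y, ξ⟩).2 =
      ξ ((trivializationAt 𝕂 L x).symmL 𝕂 y 1) := rfl

theorem dualBundle_apply {x y : M} (hy : y ∈ (trivializationAt 𝕂 L x).baseSet)
    (ξ : DualBundle 𝕂 L y) (v : L y) : ξ v =
      (trivializationAt 𝕂 (DualBundle 𝕂 L) x ⟨y, ξ⟩).2 * (trivializationAt 𝕂 L x ⟨y, v⟩).2 := by
  conv_lhs => rw [eq_smul_frame hy v]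
  rw [map_smul, smul_eq_mul, mul_comm, trivializationAt_dualBundle]

theorem trivializationAt_dualBundle_ne_zero {x y : M}
    (hy : y ∈ (trivializationAt 𝕂 L x).baseSet) {ξ : DualBundle 𝕂 L y} (hξ : ξ ≠ 0) :
    (trivializationAt 𝕂 (DualBundle 𝕂 L) x ⟨y, ξ⟩).2 ≠ 0 := fun h => hξ (DualBundle.ext fun v => by
  rw [dualBundle_apply hy, h, zero_mul]
  rfl)

/-- The element of the dual with coordinate `1` in the preferred trivialization. -/
def unitDual (𝕂 : Type*) [RCLike 𝕂] (L : M → Type*) [∀ x, AddCommGroup (L x)]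
    [∀ x, Module 𝕂 (L x)] [∀ x, TopologicalSpace (L x)] [TopologicalSpace (TotalSpace 𝕂 L)]
    [FiberBundle 𝕂 L] [VectorBundle 𝕂 𝕂 L] (x : M) : DualBundle 𝕂 L x :=
  (trivializationAt 𝕂 L x).continuousLinearMapAt 𝕂 x

theorem unitDual_ne_zero (x : M) : unitDual 𝕂 L x ≠ 0 := fun h => by
  have h1 := (trivializationAt 𝕂 L x).continuousLinearMapAt_symmL (R := 𝕂)
    (mem_baseSet_trivializationAt 𝕂 L x) 1
  have h2 : unitDual 𝕂 L x ((trivializationAt 𝕂 L x).symmL 𝕂 x 1) = 0 := by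
    rw [h]
    rfl
  exact one_ne_zero (h1.symm.trans h2)

theorem pairing_eq (σ : Cₛ^∞⟮I; 𝕂, L⟯) {x : M} {e : PuncturedDual 𝕂 L}
    (he : PuncturedDual.proj e ∈ (trivializationAt 𝕂 L x).baseSet) : pairing σ e =
      (trivializationAt 𝕂 (DualBundle 𝕂 L) x e.1).2 * localEquation σ x (PuncturedDual.proj e) :=
  dualBundle_apply he _ _

theorem contMDiff_puncturedDual_proj :
    ContMDiff (I.prod 𝓘(ℝ, 𝕂)) I ∞ (PuncturedDual.proj : PuncturedDual 𝕂 L → M) :=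
  contMDiff_proj_opens (PuncturedDual 𝕂 L)

theorem contMDiffOn_dualCoordinate (x : M) : ContMDiffOn (I.prod 𝓘(ℝ, 𝕂)) 𝓘(ℝ, 𝕂) ∞
    (fun e : PuncturedDual 𝕂 L => (trivializationAt 𝕂 (DualBundle 𝕂 L) x e.1).2)
    (PuncturedDual.proj ⁻¹' (trivializationAt 𝕂 L x).baseSet) :=
  contMDiffOn_fibreCoordinate (PuncturedDual 𝕂 L) x

theorem contMDiffAt_dualCoordinate {x : M} {e : PuncturedDual 𝕂 L}
    (he : PuncturedDual.proj e ∈ (trivializationAt 𝕂 L x).baseSet) :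
    ContMDiffAt (I.prod 𝓘(ℝ, 𝕂)) 𝓘(ℝ, 𝕂) ∞
    (fun e : PuncturedDual 𝕂 L => (trivializationAt 𝕂 (DualBundle 𝕂 L) x e.1).2) e :=
  (contMDiffOn_dualCoordinate x).contMDiffAt (((trivializationAt 𝕂 L x).open_baseSet.preimage
    (contMDiff_puncturedDual_proj (I := I)).continuous).mem_nhds he)

theorem contMDiff_pairing (σ : Cₛ^∞⟮I; 𝕂, L⟯) :
    ContMDiff (I.prod 𝓘(ℝ, 𝕂)) 𝓘(ℝ, 𝕂) ∞ (pairing σ) := fun e => by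
  have hx := mem_baseSet_trivializationAt 𝕂 L (PuncturedDual.proj e)
  have hopen := (trivializationAt 𝕂 L (PuncturedDual.proj e)).open_baseSet.preimage
    (contMDiff_puncturedDual_proj (I := I) (L := L) (𝕂 := 𝕂)).continuous
  refine ContMDiffAt.congr_of_eventuallyEq (contMDiffAt_mul_of_algebra
    (contMDiffAt_dualCoordinate hx) ((contMDiffAt_localEquation σ hx).comp e
    (contMDiff_puncturedDual_proj e))) ?_
  filter_upwards [hopen.mem_nhds hx] with q hq using pairing_eq σ hq

theorem pairing_eq_zero_iff (σ : Cₛ^∞⟮I; 𝕂, L⟯) (e : PuncturedDual 𝕂 L) :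
    pairing σ e = 0 ↔ σ (PuncturedDual.proj e) = 0 := by
  have hx := mem_baseSet_trivializationAt 𝕂 L (PuncturedDual.proj e)
  rw [pairing_eq σ hx, ← localEquation_eq_zero_iff σ hx]
  exact mul_eq_zero_iff_left (trivializationAt_dualBundle_ne_zero hx e.2)

theorem contMDiff_scale (c : 𝕂ˣ) : ContMDiff (I.prod 𝓘(ℝ, 𝕂)) (I.prod 𝓘(ℝ, 𝕂)) ∞
    (PuncturedDual.scale c : PuncturedDual 𝕂 L → PuncturedDual 𝕂 L) := by
  refine contMDiff_opens_iff contMDiff_puncturedDual_proj fun e => ?_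
  exact contMDiffAt_mul_of_algebra (contMDiffAt_const (c := (c : 𝕂)))
    (contMDiffAt_dualCoordinate (mem_baseSet_trivializationAt 𝕂 L (PuncturedDual.proj e)))

theorem scale_scale (c d : 𝕂ˣ) (h : c * d = 1) (e : PuncturedDual 𝕂 L) :
    PuncturedDual.scale c (PuncturedDual.scale d e) = e := by
  refine Subtype.ext (congrArg (TotalSpace.mk e.1.1) ?_)
  change (c : 𝕂) • (d : 𝕂) • e.1.2 = e.1.2
  rw [smul_smul, ← Units.val_mul, h, Units.val_one, one_smul]

instance [T2Space M] : T2Space (PuncturedDual 𝕂 L) :=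
  have : T2Space (TotalSpace 𝕂 (DualBundle 𝕂 L)) := t2Space_totalSpace
  inferInstance

theorem levelDistribution_const_pi {H' E' : Type*} [NormedAddCommGroup E'] [NormedSpace ℝ E']
    [TopologicalSpace H'] {J : ModelWithCorners ℝ E' H'} {N : Type*} [TopologicalSpace N]
    [ChartedSpace H' N] {V : Type*} [NormedAddCommGroup V] [NormedSpace ℝ V] {φ : N → V}
    (hφ : ContMDiff J 𝓘(ℝ, V) ∞ φ) :
    levelDistribution J (fun p (_ : Unit) => φ p) = levelDistribution J φ := by
  funext p
  ext v
  have h1 : MDifferentiableAt J 𝓘(ℝ, Unit → V) (fun p (_ : Unit) => φ p) p :=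
    (contMDiff_pi_space.2 fun _ => hφ).mdifferentiableAt (by simp)
  have h2 := dAt_pi h1 v ()
  constructor
  · intro h
    exact h2.symm.trans (congrFun h ())
  · intro h
    exact funext fun _ => h2.trans h

end PuncturedOne

section PuncturedOneCover

variable {E : Type*} [NormedAddCommGroup E] [NormedSpace ℝ E] [FiniteDimensional ℝ E]
  {H : Type*} [TopologicalSpace H]
  {I : ModelWithCorners ℝ E H} [I.Boundaryless] {M : Type*} [TopologicalSpace M] [ChartedSpace H M]
  [IsManifold I ∞ M] {𝕂 : Type*} [RCLike 𝕂] {L : M → Type*}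
  [∀ x, AddCommGroup (L x)] [∀ x, Module 𝕂 (L x)] [∀ x, Module ℝ (L x)]
  [∀ x, TopologicalSpace (L x)] [TopologicalSpace (TotalSpace 𝕂 L)] [FiberBundle 𝕂 L]
  [VectorBundle 𝕂 𝕂 L] [VectorBundle ℝ 𝕂 L] [ContMDiffVectorBundle ∞ 𝕂 L I]

theorem bijective_pi_unit {V W 𝕂 : Type*} {f : V → W × 𝕂} (hf : Function.Bijective f) :
    Function.Bijective fun v => ((f v).1, fun _ : Unit => (f v).2) :=
  ((Equiv.refl W).prodCongr (Equiv.funUnique Unit 𝕂).symm).bijective.comp hf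

theorem isRegularisingCover_puncturedDual (σ : Cₛ^∞⟮I; 𝕂, L⟯) (hσ : ∀ x, ∀ w : Unit → 𝕂,
    ∃ v : TangentSpace I x, ∀ _ : Unit, σ x = 0 → verticalDeriv σ x v = w ()) :
    IsRegularisingCover (I.prod 𝓘(ℝ, 𝕂)) (sectionEquations (fun _ : Unit => σ) hσ)
      (PuncturedDual.proj : PuncturedDual 𝕂 L → M) (fun e _ => pairing σ e)
      (fun x e _ => (trivializationAt 𝕂 (DualBundle 𝕂 L) x e.1).2) where
  contMDiff := contMDiff_puncturedDual_proj
  surjective x := ⟨⟨⟨x, unitDual 𝕂 L x⟩, unitDual_ne_zero x⟩, rfl⟩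
  contMDiff_fun := contMDiff_pi_space.2 fun _ => contMDiff_pairing σ
  contMDiffOn_coord x := contMDiffOn_pi_space.2 fun _ =>
    (contMDiffOn_dualCoordinate x).mono (preimage_mono (iInter_subset _ ()))
  coord_ne_zero x e he _ := trivializationAt_dualBundle_ne_zero (mem_iInter.1 he ()) e.2
  fun_eq x e he _ := pairing_eq σ (mem_iInter.1 he ())
  bijective x e he := by
    have hx : PuncturedDual.proj e ∈ (trivializationAt 𝕂 L x).baseSet := mem_iInter.1 he ()
    have h1 := bijective_pi_unit (bijective_fibreCoordinate (I := I) (PuncturedDual 𝕂 L)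
      (x := x) (p := e) hx)
    have h2 : MDifferentiableAt (I.prod 𝓘(ℝ, 𝕂)) 𝓘(ℝ, Unit → 𝕂)
        (fun (q : PuncturedDual 𝕂 L) (_ : Unit) =>
          (trivializationAt 𝕂 (DualBundle 𝕂 L) x q.1).2) e :=
      (contMDiffAt_pi_space.2 fun _ => contMDiffAt_dualCoordinate hx).mdifferentiableAt (by simp)
    have h3 : ∀ v, (fun _ : Unit => dAt (I.prod 𝓘(ℝ, 𝕂)) (fun q : PuncturedDual 𝕂 L =>
        (trivializationAt 𝕂 (DualBundle 𝕂 L) x q.1).2) e v) =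
        dAt (I.prod 𝓘(ℝ, 𝕂)) (fun (q : PuncturedDual 𝕂 L) (_ : Unit) =>
          (trivializationAt 𝕂 (DualBundle 𝕂 L) x q.1).2) e v := fun v =>
      funext fun i => (dAt_pi h2 v i).symm
    simp only [h3] at h1
    exact h1

theorem levelDistribution_pairing_unit (σ : Cₛ^∞⟮I; 𝕂, L⟯) :
    levelDistribution (I.prod 𝓘(ℝ, 𝕂)) (fun e (_ : Unit) => pairing σ e) =
      levelDistribution (I.prod 𝓘(ℝ, 𝕂)) (pairing σ) :=
  levelDistribution_const_pi (contMDiff_pairing σ)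

/-- A level set of the pairing over a component of the complement of the zero locus is a graph. -/
theorem isGraphOver_connectedComponentIn (σ : Cₛ^∞⟮I; 𝕂, L⟯) (e : PuncturedDual 𝕂 L)
    (he : σ (PuncturedDual.proj e) ≠ 0) :
    IsGraphOver I (connectedComponentIn {e' | pairing σ e' = pairing σ e} e)
      (connectedComponentIn {x | σ x ≠ 0} (PuncturedDual.proj e)) := by
  set z := pairing σ e
  set S := {e' | pairing σ e' = z}
  set U := {x | σ x ≠ 0}
  set C := connectedComponentIn U (PuncturedDual.proj e)
  have hz : z ≠ 0 := fun h => he ((pairing_eq_zero_iff σ e).1 h)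
  have hCU : C ⊆ U := connectedComponentIn_subset _ _
  let τ : M → TotalSpace 𝕂 (DualBundle 𝕂 L) := fun x =>
    ⟨x, (z / localEquation σ x x) • unitDual 𝕂 L x⟩
  have hτ : ∀ x, σ x ≠ 0 → (τ x).2 (σ x) = z := by
    intro x hx
    have hx' := mem_baseSet_trivializationAt 𝕂 L x
    have h1 : unitDual 𝕂 L x (σ x) = localEquation σ x x := by
      change (trivializationAt 𝕂 L x).continuousLinearMapAt 𝕂 x (σ x) = _
      rw [Trivialization.continuousLinearMapAt_apply, Trivialization.coe_linearMapAt_of_mem _ hx']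
      rfl
    change z / localEquation σ x x * unitDual 𝕂 L x (σ x) = z
    rw [h1, div_mul_cancel₀ _ fun h => hx ((localEquation_eq_zero_iff σ hx').1 h)]
  have huniq : ∀ (x : M) (ξ η : DualBundle 𝕂 L x), σ x ≠ 0 → ξ (σ x) = η (σ x) → ξ = η := by
    intro x ξ η hx h
    have hx' := mem_baseSet_trivializationAt 𝕂 L x
    have h0 : localEquation σ x x ≠ 0 := fun h => hx ((localEquation_eq_zero_iff σ hx').1 h)
    rw [dualBundle_apply hx' ξ, dualBundle_apply hx' η] at h
    refine DualBundle.ext fun v => ?_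
    rw [dualBundle_apply hx' ξ, dualBundle_apply hx' η, mul_right_cancel₀ h0 h]
  have hsm : ContMDiffOn I (I.prod 𝓘(ℝ, 𝕂)) ∞ τ U := by
    intro x hx
    have hx' := mem_baseSet_trivializationAt 𝕂 L x
    have h0 : localEquation σ x x ≠ 0 := fun h => hx ((localEquation_eq_zero_iff σ hx').1 h)
    have hf := contMDiffAt_localEquation σ hx'
    refine (contMDiffAt_totalSpace.2 ⟨contMDiffAt_id, ?_⟩).contMDiffWithinAt
    refine (contMDiffAt_mul_of_algebra (contMDiffAt_const (c := z))
      (((contDiffAt_inv ℝ h0).contMDiffAt).comp x hf)).congr_of_eventuallyEq ?_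
    filter_upwards [hf.continuousAt.eventually_ne h0,
      (trivializationAt 𝕂 L x).open_baseSet.mem_nhds hx'] with y hy0 hy
    refine (eq_mul_inv_iff_mul_eq₀ hy0).2 ((dualBundle_apply hy (τ y).2 (σ y)).symm.trans (hτ y ?_))
    exact fun h => hy0 ((localEquation_eq_zero_iff σ hy).2 h)
  refine ⟨τ, hsm.mono hCU, fun _ _ => rfl, Subset.antisymm ?_ ?_⟩
  · rintro _ ⟨e', he', rfl⟩
    have hS : e' ∈ S := connectedComponentIn_subset _ _ he'
    have hU : ∀ q : PuncturedDual 𝕂 L, pairing σ q = z → σ (PuncturedDual.proj q) ≠ 0 :=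
      fun q hq h0 => hz (hq.symm.trans ((pairing_eq_zero_iff σ q).2 h0))
    refine ⟨PuncturedDual.proj e', ?_, ?_⟩
    · have h1 : (PuncturedDual.proj : PuncturedDual 𝕂 L → M) '' connectedComponentIn S e ⊆ C := by
        refine IsPreconnected.subset_connectedComponentIn ?_ ?_ ?_
        · exact isPreconnected_connectedComponentIn.image _
            (contMDiff_puncturedDual_proj (I := I)).continuous.continuousOn
        · exact mem_image_of_mem _ (mem_connectedComponentIn rfl)
        · rintro _ ⟨q, hq, rfl⟩
          have hqS : q ∈ S := connectedComponentIn_subset _ _ hq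
          exact hU q hqS
      exact h1 (mem_image_of_mem _ he')
    · exact congrArg (TotalSpace.mk e'.1.1) (huniq _ _ _ (hU e' hS) ((hτ _ (hU e' hS)).trans hS.symm))
  · have hne : ∀ x ∈ C, (τ x).2 ≠ 0 := fun x hx h0 => hz (by
      rw [← hτ x (hCU hx), h0]
      rfl)
    let A : Set (PuncturedDual 𝕂 L) := Subtype.val ⁻¹' (τ '' C)
    have hA : Subtype.val '' A = τ '' C := by
      refine image_preimage_eq_of_subset ?_
      rintro _ ⟨x, hx, rfl⟩
      exact ⟨⟨τ x, hne x hx⟩, rfl⟩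
    have h1 : A ⊆ connectedComponentIn S e := by
      refine IsPreconnected.subset_connectedComponentIn ?_ ?_ ?_
      · have h2 : IsPreconnected (Subtype.val '' A) := by
          rw [hA]
          exact isPreconnected_connectedComponentIn.image _ (hsm.mono hCU).continuousOn
        exact Topology.IsInducing.subtypeVal.isPreconnected_image.1 h2
      · exact ⟨PuncturedDual.proj e, mem_connectedComponentIn he,
          congrArg (TotalSpace.mk e.1.1) (huniq _ _ _ he (hτ _ he))⟩
      · rintro q ⟨x, hx, hq⟩
        have h2 : ∀ t : TotalSpace 𝕂 (DualBundle 𝕂 L), t = τ x → t.2 (σ t.1) = z := by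
          rintro _ rfl
          exact hτ x (hCU hx)
        exact h2 q.1 hq.symm
    rw [← hA]
    exact image_mono h1

end PuncturedOneCover

/-! ### Fibre products of punctured duals -/

section PuncturedSum

variable {E : Type*} [NormedAddCommGroup E] [NormedSpace ℝ E] [FiniteDimensional ℝ E]
  {H : Type*} [TopologicalSpace H]
  {I : ModelWithCorners ℝ E H} [I.Boundaryless] {M : Type*} [TopologicalSpace M] [ChartedSpace H M]
  [IsManifold I ∞ M] {𝕂 : Type*} [RCLike 𝕂] {ι : Type*} [Fintype ι] {L : ι → M → Type*}
  [∀ i x, AddCommGroup (L i x)] [∀ i x, Module 𝕂 (L i x)] [∀ i x, Module ℝ (L i x)]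
  [∀ i x, TopologicalSpace (L i x)] [∀ i, TopologicalSpace (TotalSpace 𝕂 (L i))]
  [∀ i, FiberBundle 𝕂 (L i)] [∀ i, VectorBundle 𝕂 𝕂 (L i)] [∀ i, VectorBundle ℝ 𝕂 (L i)]
  [∀ i, ContMDiffVectorBundle ∞ 𝕂 (L i) I]

instance [T2Space M] : T2Space (PuncturedDualSum 𝕂 L) :=
  have : T2Space (TotalSpace (ι → 𝕂) (DualSum 𝕂 L)) := t2Space_totalSpace
  inferInstance

/-- The coordinates of the components in the preferred trivializations around `x`. -/
def sumCoordinate (x : M) (p : PuncturedDualSum 𝕂 L) (i : ι) : 𝕂 :=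
  (trivializationAt 𝕂 (DualBundle 𝕂 (L i)) x (PuncturedDualSum.pr i p).1).2

theorem trivializationAt_dualSum {x y : M} (hy : y ∈ ⋂ i, (trivializationAt 𝕂 (L i) x).baseSet)
    (ξ : DualSum 𝕂 L y) (i : ι) : (trivializationAt (ι → 𝕂) (DualSum 𝕂 L) x ⟨y, ξ⟩).2 i =
      (trivializationAt 𝕂 (DualBundle 𝕂 (L i)) x ⟨y, DirectSumBundle.component i ξ⟩).2 := by
  have h1 : (trivializationAt (ι → 𝕂) (DualSum 𝕂 L) x ⟨y, ξ⟩).2 i =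
    (trivializationAt 𝕂 (DualBundle 𝕂 (L i)) x).continuousLinearMapAt ℝ y
      (DirectSumBundle.component i ξ) := rfl
  rw [h1, Trivialization.continuousLinearMapAt_apply, Trivialization.coe_linearMapAt_of_mem]
  exact mem_iInter.1 hy i

theorem contMDiff_puncturedDualSum_proj :
    ContMDiff (I.prod 𝓘(ℝ, ι → 𝕂)) I ∞ (PuncturedDualSum.proj : PuncturedDualSum 𝕂 L → M) :=
  contMDiff_proj_opens (PuncturedDualSum 𝕂 L)

theorem isOpen_sumDomain (x : M) : IsOpen ((PuncturedDualSum.proj : PuncturedDualSum 𝕂 L → M) ⁻¹'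
    ⋂ i, (trivializationAt 𝕂 (L i) x).baseSet) :=
  (isOpen_iInter_of_finite fun i => (trivializationAt 𝕂 (L i) x).open_baseSet).preimage
    ((FiberBundle.continuous_proj (ι → 𝕂) (DualSum 𝕂 L)).comp continuous_subtype_val)

theorem sumCoordinate_eqOn (x : M) : EqOn (sumCoordinate x)
    (fun p : PuncturedDualSum 𝕂 L => (trivializationAt (ι → 𝕂) (DualSum 𝕂 L) x p.1).2)
    (PuncturedDualSum.proj ⁻¹' ⋂ i, (trivializationAt 𝕂 (L i) x).baseSet) := fun _ hp =>
  funext fun i => (trivializationAt_dualSum hp _ i).symm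

theorem contMDiffOn_sumCoordinate (x : M) : ContMDiffOn (I.prod 𝓘(ℝ, ι → 𝕂)) 𝓘(ℝ, ι → 𝕂) ∞
    (sumCoordinate x : PuncturedDualSum 𝕂 L → ι → 𝕂)
    (PuncturedDualSum.proj ⁻¹' ⋂ i, (trivializationAt 𝕂 (L i) x).baseSet) :=
  (contMDiffOn_fibreCoordinate (PuncturedDualSum 𝕂 L) x).congr (sumCoordinate_eqOn x)

theorem contMDiffAt_sumCoordinate {x : M} {p : PuncturedDualSum 𝕂 L}
    (hp : PuncturedDualSum.proj p ∈ ⋂ i, (trivializationAt 𝕂 (L i) x).baseSet) (i : ι) :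
    ContMDiffAt (I.prod 𝓘(ℝ, ι → 𝕂)) 𝓘(ℝ, 𝕂) ∞
      (fun p : PuncturedDualSum 𝕂 L => sumCoordinate x p i) p :=
  contMDiffAt_pi_space.1 ((contMDiffOn_sumCoordinate x).contMDiffAt
    ((isOpen_sumDomain x).mem_nhds hp)) i

theorem mem_sumDomain (x : M) : x ∈ ⋂ i, (trivializationAt 𝕂 (L i) x).baseSet :=
  mem_iInter.2 fun i => mem_baseSet_trivializationAt 𝕂 (L i) x

theorem contMDiff_pr (i : ι) : ContMDiff (I.prod 𝓘(ℝ, ι → 𝕂)) (I.prod 𝓘(ℝ, 𝕂)) ∞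
    (PuncturedDualSum.pr i : PuncturedDualSum 𝕂 L → PuncturedDual 𝕂 (L i)) :=
  contMDiff_opens_iff contMDiff_puncturedDualSum_proj fun p =>
    contMDiffAt_sumCoordinate (mem_sumDomain (PuncturedDualSum.proj p)) i

theorem contMDiff_sumScale (c : ι → 𝕂ˣ) : ContMDiff (I.prod 𝓘(ℝ, ι → 𝕂)) (I.prod 𝓘(ℝ, ι → 𝕂)) ∞
    (PuncturedDualSum.scale c : PuncturedDualSum 𝕂 L → PuncturedDualSum 𝕂 L) := by
  refine contMDiff_opens_iff contMDiff_puncturedDualSum_proj fun p => ?_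
  have hp := mem_sumDomain (𝕂 := 𝕂) (L := L) (PuncturedDualSum.proj p)
  have h1 : ContMDiffAt (I.prod 𝓘(ℝ, ι → 𝕂)) 𝓘(ℝ, ι → 𝕂) ∞ (fun q : PuncturedDualSum 𝕂 L =>
      fun i => (c i : 𝕂) * sumCoordinate (PuncturedDualSum.proj p) q i) p :=
    contMDiffAt_pi_space.2 fun i => contMDiffAt_mul_of_algebra contMDiffAt_const
      (contMDiffAt_sumCoordinate hp i)
  refine h1.congr_of_eventuallyEq ?_
  filter_upwards [(isOpen_sumDomain _).mem_nhds hp] with q hq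
  exact funext fun i => trivializationAt_dualSum hq _ i

theorem sumScale_sumScale (c d : ι → 𝕂ˣ) (h : ∀ i, c i * d i = 1) (p : PuncturedDualSum 𝕂 L) :
    PuncturedDualSum.scale c (PuncturedDualSum.scale d p) = p := by
  refine Subtype.ext (congrArg (TotalSpace.mk p.1.1) (funext fun i => ?_))
  change (c i : 𝕂) • (d i : 𝕂) • p.1.2 i = p.1.2 i
  rw [smul_smul, ← Units.val_mul, h, Units.val_one, one_smul]

/-- The pairings with the components. -/
def sumPairing (σ : ∀ i, Cₛ^∞⟮I; 𝕂, L i⟯) (p : PuncturedDualSum 𝕂 L) (i : ι) : 𝕂 :=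
  pairing (σ i) (PuncturedDualSum.pr i p)

theorem contMDiff_sumPairing (σ : ∀ i, Cₛ^∞⟮I; 𝕂, L i⟯) :
    ContMDiff (I.prod 𝓘(ℝ, ι → 𝕂)) 𝓘(ℝ, ι → 𝕂) ∞ (sumPairing σ) :=
  contMDiff_pi_space.2 fun i => (contMDiff_pairing (σ i)).comp (contMDiff_pr i)

theorem fibreProduct_levelDistribution (σ : ∀ i, Cₛ^∞⟮I; 𝕂, L i⟯) :
    fibreProduct (fun i => levelDistribution (I.prod 𝓘(ℝ, 𝕂)) (pairing (σ i))) =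
      levelDistribution (I.prod 𝓘(ℝ, ι → 𝕂)) (sumPairing σ) := by
  funext p
  ext v
  have h1 := (contMDiff_sumPairing σ).mdifferentiableAt (x := p) (by simp)
  have h2 : ∀ i, dAt (I.prod 𝓘(ℝ, ι → 𝕂)) (sumPairing σ) p v i =
      dAt (I.prod 𝓘(ℝ, 𝕂)) (pairing (σ i)) (PuncturedDualSum.pr i p)
        (mfderiv (I.prod 𝓘(ℝ, ι → 𝕂)) (I.prod 𝓘(ℝ, 𝕂)) (PuncturedDualSum.pr i) p v) := fun i =>
    (dAt_pi h1 v i).trans (dAt_comp ((contMDiff_pairing (σ i)).mdifferentiableAt (by simp))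
      ((contMDiff_pr i).mdifferentiableAt (by simp)) v)
  refine Submodule.mem_iInf _ |>.trans ⟨fun h => funext fun i => (h2 i).trans (h i),
    fun h i => (h2 i).symm.trans (congrFun h i)⟩

theorem isRegularisingCover_puncturedDualSum (σ : ∀ i, Cₛ^∞⟮I; 𝕂, L i⟯) (hσ : ∀ x, ∀ w : ι → 𝕂,
    ∃ v : TangentSpace I x, ∀ i, σ i x = 0 → verticalDeriv (σ i) x v = w i) :
    IsRegularisingCover (I.prod 𝓘(ℝ, ι → 𝕂)) (sectionEquations σ hσ)
      (PuncturedDualSum.proj : PuncturedDualSum 𝕂 L → M) (sumPairing σ) sumCoordinate where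
  contMDiff := contMDiff_puncturedDualSum_proj
  surjective x := ⟨⟨⟨x, fun i => unitDual 𝕂 (L i) x⟩, fun _ => unitDual_ne_zero x⟩, rfl⟩
  contMDiff_fun := contMDiff_sumPairing σ
  contMDiffOn_coord x := contMDiffOn_sumCoordinate x
  coord_ne_zero x p hp i := trivializationAt_dualBundle_ne_zero (mem_iInter.1 hp i) (p.2 i)
  fun_eq x p hp i := pairing_eq (σ i) (mem_iInter.1 hp i)
  bijective x p hp := by
    have h1 := bijective_fibreCoordinate (I := I) (PuncturedDualSum 𝕂 L) (x := x) (p := p) hp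
    have h2 : ∀ v, dAt (I.prod 𝓘(ℝ, ι → 𝕂)) (fun p : PuncturedDualSum 𝕂 L =>
        (trivializationAt (ι → 𝕂) (DualSum 𝕂 L) x p.1).2) p v =
        dAt (I.prod 𝓘(ℝ, ι → 𝕂)) (sumCoordinate x) p v := fun v =>
      dAt_congr (by
        filter_upwards [(isOpen_sumDomain x).mem_nhds hp] with q hq
        exact (sumCoordinate_eqOn x hq).symm) v
    simp only [h2] at h1
    exact h1

theorem isInvariantUnder_sumScale (σ : ∀ i, Cₛ^∞⟮I; 𝕂, L i⟯) (c : ι → 𝕂ˣ) :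
    IsInvariantUnder (I.prod 𝓘(ℝ, ι → 𝕂)) (levelDistribution (I.prod 𝓘(ℝ, ι → 𝕂)) (sumPairing σ))
      (PuncturedDualSum.scale c) :=
  isInvariantUnder_levelDistribution (contMDiff_sumPairing σ) (contMDiff_sumScale c)
    (contMDiff_sumScale c⁻¹) (sumScale_sumScale _ _ fun i => mul_inv_cancel (c i))
    (sumScale_sumScale _ _ fun i => inv_mul_cancel (c i))
    (ContinuousLinearMap.pi fun i => (ContinuousLinearMap.mul ℝ 𝕂 (c i)).comp
      (ContinuousLinearMap.proj i))
    (ContinuousLinearMap.pi fun i => (ContinuousLinearMap.mul ℝ 𝕂 (c⁻¹ i : 𝕂ˣ)).comp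
      (ContinuousLinearMap.proj i)) (fun _ => rfl) fun _ => rfl

theorem isInvariantUnder_scale {L : M → Type*} [∀ x, AddCommGroup (L x)] [∀ x, Module 𝕂 (L x)]
    [∀ x, Module ℝ (L x)] [∀ x, TopologicalSpace (L x)] [TopologicalSpace (TotalSpace 𝕂 L)]
    [FiberBundle 𝕂 L] [VectorBundle 𝕂 𝕂 L] [VectorBundle ℝ 𝕂 L] [ContMDiffVectorBundle ∞ 𝕂 L I]
    (σ : Cₛ^∞⟮I; 𝕂, L⟯) (c : 𝕂ˣ) :
    IsInvariantUnder (I.prod 𝓘(ℝ, 𝕂)) (levelDistribution (I.prod 𝓘(ℝ, 𝕂)) (pairing σ))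
      (PuncturedDual.scale c) :=
  isInvariantUnder_levelDistribution (contMDiff_pairing σ) (contMDiff_scale c)
    (contMDiff_scale c⁻¹) (scale_scale _ _ (mul_inv_cancel c))
    (scale_scale _ _ (inv_mul_cancel c)) (ContinuousLinearMap.mul ℝ 𝕂 c)
    (ContinuousLinearMap.mul ℝ 𝕂 (c⁻¹ : 𝕂ˣ)) (fun _ => rfl) fun _ => rfl

end PuncturedSum

end Regularisation

end

theorem mainTheorem9 {n : ℕ} {M : Type*} [TopologicalSpace M]
    [ChartedSpace (EuclideanSpace ℝ (Fin n)) M] [IsManifold (𝓡 n) ∞ M] [T2Space M]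
    [SecondCountableTopology M] :
    -- a complex log divisor
    (∀ (L : M → Type*) [∀ x, AddCommGroup (L x)] [∀ x, Module ℂ (L x)] [∀ x, Module ℝ (L x)]
        [∀ x, TopologicalSpace (L x)] [TopologicalSpace (TotalSpace ℂ L)] [FiberBundle ℂ L]
        [VectorBundle ℂ ℂ L] [VectorBundle ℝ ℂ L] [ContMDiffVectorBundle ∞ ℂ L (𝓡 n)]
        (σ : Cₛ^∞⟮𝓡 n; ℂ, L⟯), VanishesTransversely σ →
      let J := (𝓡 n).prod 𝓘(ℝ, ℂ)
      let F := levelDistribution J (pairing σ)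
      IsFoliation J F 2 ∧
      (∀ e, leaf J F e = connectedComponentIn {e' | pairing σ e' = pairing σ e} e) ∧
      (∀ c : ℂˣ, IsInvariantUnder J F (PuncturedDual.scale c)) ∧
      (∀ e, σ (PuncturedDual.proj e) = 0 →
        leaf J F e = connectedComponentIn {e' | σ (PuncturedDual.proj e') = 0} e) ∧
      (∀ e, σ (PuncturedDual.proj e) ≠ 0 →
        IsGraphOver (𝓡 n) (leaf J F e) (connectedComponentIn {x | σ x ≠ 0} (PuncturedDual.proj e))) ∧
      SubmersesIsomorphically J PuncturedDual.proj F (preservingFields (ellipticIdeal σ))) ∧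
    -- transversely intersecting hypersurfaces with their b-divisors
    (∀ (k : ℕ) (W : Fin k → M → Type*) [∀ i x, AddCommGroup (W i x)] [∀ i x, Module ℝ (W i x)]
        [∀ i x, TopologicalSpace (W i x)] [∀ i, TopologicalSpace (TotalSpace ℝ (W i))]
        [∀ i, FiberBundle ℝ (W i)] [∀ i, VectorBundle ℝ ℝ (W i)]
        [∀ i, ContMDiffVectorBundle ∞ ℝ (W i) (𝓡 n)] (s : ∀ i, Cₛ^∞⟮𝓡 n; ℝ, W i⟯),
        (∀ i, VanishesTransversely (s i)) → ZeroLociTransverse s →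
      let J := (𝓡 n).prod 𝓘(ℝ, Fin k → ℝ)
      let F := fibreProduct (fun i => levelDistribution ((𝓡 n).prod 𝓘(ℝ, ℝ)) (pairing (s i)))
      IsFoliation J F k ∧
      (∀ c : Fin k → ℝˣ, IsInvariantUnder J F (PuncturedDualSum.scale c)) ∧
      SubmersesIsomorphically J PuncturedDualSum.proj F (tangentFields s)) ∧
    -- transversely intersecting elliptic divisors with their complex log divisors
    (∀ (k : ℕ) (L : Fin k → M → Type*) [∀ i x, AddCommGroup (L i x)] [∀ i x, Module ℂ (L i x)]
        [∀ i x, Module ℝ (L i x)] [∀ i x, TopologicalSpace (L i x)]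
        [∀ i, TopologicalSpace (TotalSpace ℂ (L i))] [∀ i, FiberBundle ℂ (L i)]
        [∀ i, VectorBundle ℂ ℂ (L i)] [∀ i, VectorBundle ℝ ℂ (L i)]
        [∀ i, ContMDiffVectorBundle ∞ ℂ (L i) (𝓡 n)] (σ : ∀ i, Cₛ^∞⟮𝓡 n; ℂ, L i⟯),
        (∀ i, VanishesTransversely (σ i)) → ZeroLociTransverse σ →
      let J := (𝓡 n).prod 𝓘(ℝ, Fin k → ℂ)
      let F := fibreProduct (fun i => levelDistribution ((𝓡 n).prod 𝓘(ℝ, ℂ)) (pairing (σ i)))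
      IsFoliation J F (2 * k) ∧
      (∀ c : Fin k → ℂˣ, IsInvariantUnder J F (PuncturedDualSum.scale c)) ∧
      SubmersesIsomorphically J PuncturedDualSum.proj F
        (preservingFields (∏ i, ellipticIdeal (σ i)))) := by
  refine ⟨?_, ?_, ?_⟩
  · intro L _ _ _ _ _ _ _ _ _ σ hσ
    have hs : ∀ x, ∀ w : Unit → ℂ, ∃ v : TangentSpace (𝓡 n) x,
        ∀ _ : Unit, σ x = 0 → verticalDeriv σ x v = w () := fun x w => by
      by_cases h0 : σ x = 0
      · obtain ⟨v, hv⟩ := hσ x h0 (w ())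
        exact ⟨v, fun _ _ => hv⟩
      · exact ⟨0, fun _ h => absurd h h0⟩
    have hcov := isRegularisingCover_puncturedDual σ hs
    have hF := levelDistribution_pairing_unit (I := 𝓡 n) σ
    have hsurj : ∀ e, Function.Surjective (dAt ((𝓡 n).prod 𝓘(ℝ, ℂ)) (pairing σ) e) := fun e w => by
      obtain ⟨v, hv⟩ := hcov.surjective_dAt e fun _ => w
      exact ⟨v, (dAt_pi (hcov.contMDiff_fun.mdifferentiableAt (by simp)) v ()).symm.trans
        (congrFun hv ())⟩
    have hleaf := leaf_levelDistribution (contMDiff_pairing σ) hsurj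
    refine ⟨?_, hleaf, fun c => isInvariantUnder_scale σ c, fun e he => ?_, fun e he => ?_, ?_⟩
    · have h1 := isFoliation_levelDistribution (contMDiff_pairing σ) hsurj
      rwa [Complex.finrank_real_complex] at h1
    · have h1 := (pairing_eq_zero_iff σ e).2 he
      have h2 : {e' | pairing σ e' = pairing σ e} =
          {e' : PuncturedDual ℂ L | σ (PuncturedDual.proj e') = 0} := by
        ext e'
        rw [mem_ofPred_eq, h1, pairing_eq_zero_iff]
        rfl
      rw [← h2]
      exact hleaf e
    · have h1 := isGraphOver_connectedComponentIn σ e he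
      rw [← hleaf e] at h1
      exact h1
    · have h1 := hcov.isRegularisation
      rw [finrank_euclideanSpace_fin, hF, ← preservingFields_eq (fun _ => hσ) hs,
        Fintype.prod_unique] at h1
      exact h1.submersesIsomorphically
  · intro k W _ _ _ _ _ _ _ s hσ ht
    have hs := exists_verticalDeriv_eq hσ ht
    have hcov := isRegularisingCover_puncturedDualSum s hs
    have hF := fibreProduct_levelDistribution (I := 𝓡 n) s
    refine ⟨?_, fun c => ?_, ?_⟩
    · have h1 := isFoliation_levelDistribution (contMDiff_sumPairing s) hcov.surjective_dAt
      rw [← hF, Module.finrank_pi, Fintype.card_fin] at h1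
      exact h1
    · have h1 := isInvariantUnder_sumScale s c
      rw [← hF] at h1
      exact h1
    · have h1 := hcov.isRegularisation
      rw [finrank_euclideanSpace_fin, ← hF, ← tangentFields_eq s hs] at h1
      exact h1.submersesIsomorphically
  · intro k L _ _ _ _ _ _ _ _ _ σ hσ ht
    have hs := exists_verticalDeriv_eq hσ ht
    have hcov := isRegularisingCover_puncturedDualSum σ hs
    have hF := fibreProduct_levelDistribution (I := 𝓡 n) σ
    refine ⟨?_, fun c => ?_, ?_⟩
    · have h1 := isFoliation_levelDistribution (contMDiff_sumPairing σ) hcov.surjective_dAt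
      rw [← hF, Module.finrank_pi_fintype, Finset.sum_const, Complex.finrank_real_complex,
        Finset.card_univ, Fintype.card_fin, smul_eq_mul, mul_comm] at h1
      exact h1
    · have h1 := isInvariantUnder_sumScale σ c
      rw [← hF] at h1
      exact h1
    · have h1 := hcov.isRegularisation
      rw [finrank_euclideanSpace_fin, ← hF, ← preservingFields_eq hσ hs] at h1
      exact h1.submersesIsomorphically
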